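/- Let $q$ be a prime power. Let $\Sigma_\infty$ be a hyperplane of $\mathrm{PG}(6,q)$, and let $\mathcal S$ be a regular 2-spread of $\Sigma_\infty$ with transversal lines $g,g^q,g^{q^2}$ in $\mathrm{PG}(6,q^3)$. That is, $g$ is a line of the extension of $\Sigma_\infty$ disjoint from $\mathrm{PG}(6,q)$, and the planes $\langle P,P^q,P^{q^2}\rangle\cap\mathrm{PG}(6,q)$, for $P\in g$, partition $\Sigma_\infty$ and are the elements of $\mathcal S$. Represent $\mathrm{PG}(2,q^3)$ in the Bruck–Bose way. Its points are the points of $\mathrm{PG}(6,q)\setminus\Sigma_\infty$ together with the elements of $\mathcal S$. Its lines are the 3-spaces of $\mathrm{PG}(6,q)$ not in $\Sigma_\infty$ that contain an element of $\mathcal S$, together with the line at infinity $\ell_\infty$, whose points are the elements of $\mathcal S$. A set $X$ of points of $\mathrm{PG}(6,q)$ *corresponds* to a set $B$ of points of $\mathrm{PG}(2,q^3)$ if $B$ consists of the points of $X$ not in $\Sigma_\infty$ and the spread elements that contain a point of $X$. A star $K^*$ denotes the natural extension to $\mathrm{PG}(6,q^3)$ of a subspace, a parametrised curve or a ruled surface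 $K$. Let $\mathcal B$ be a ruled surface of $\mathrm{PG}(6,q)$ defined by a projectivity from a conic directrix $\mathcal C$ (non-degenerate, in a plane) to a normal rational curve directrix $\mathcal N$ (in a 3-space). Corresponding points are distinct, and the points of $\mathcal B$ are the points of the $q+1$ lines joining them. Call $(\mathcal C,\mathcal N)$ and its projectivity *special* if 1. $\mathcal C$ lies in some $\pi\in\mathcal S$, and $\mathcal C^*$ contains the points $\pi^*\cap g,\ \pi^*\cap g^q,\ \pi^*\cap g^{q^2}$ ($\mathcal C$ is a special conic in $\pi$); 2. $\mathcal N$ lies in a 3-space not in $\Sigma_\infty$ about some $\alpha\in\mathcal S$, $\alpha\ne\pi$, and $\mathcal N^*$ contains the points $\alpha^*\cap g,\ \alpha^*\cap g^q,\ \alpha^*\cap g^{q^2}$ ($\mathcal N$ is a special normal rational curve); 3. $\mathcal B^*$ contains the transversal lines $g,g^q,g^{q^2}$ of $\mathcal S$. Then: (a) If $q\ge 4$, then $\mathcal B$ corresponds to a subplane of order $q$ of $\mathrm{PG}(2,q^3)$ if and only if $\mathcal C$, $\mathcal N$ and the projectivity are special. (b) For every $q$, $\mathcal B$ corresponds to a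 subplane of order $q$ of $\mathrm{PG}(2,q^3)$ that is tangent to $\ell_\infty$ (meets it in exactly one point) if and only if the point set of $\mathcal B$ is also the point set of a ruled surface defined by a projectivity from a conic to a normal rational curve that are special. In particular, if $\mathcal C$, $\mathcal N$ and the projectivity are special, then $\mathcal B$ corresponds to such a tangent subplane. -/

import Mathlib

namespace BruckBose

open Module

/-- The vector space underlying `PG(6, F)`. -/
abbrev V7 (F : Type*) := Fin 7 → F

section Extension

variable {K L : Type*} [Field K] [Field L] [Algebra K L]

/-- The inclusion of the vectors over `K` into the vectors over the extension `L`. -/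
def incl (K L : Type*) [Field K] [Field L] [Algebra K L] : V7 K →ₗ[K] V7 L :=
  (Algebra.linearMap K L).compLeft (Fin 7)

/-- The natural extension `W*` of a subspace `W` of `PG(6, K)` to `PG(6, L)`. -/
def extend (L : Type*) [Field L] [Algebra K L] (W : Submodule K (V7 K)) : Submodule L (V7 L) :=
  Submodule.span L (incl K L '' (W : Set (V7 K)))

/-- The intersection of a subspace `U` of `PG(6, L)` with `PG(6, K)`. -/
def rational (K : Type*) [Field K] [Algebra K L] (U : Submodule L (V7 L)) :
    Submodule K (V7 K) :=
  (U.restrictScalars K).comap (incl K L)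

/-- The `i`-th power of the Frobenius map, `x ↦ x ^ (q ^ i)` with `q = |K|`, applied to each
coordinate of a vector. -/
noncomputable def frob (K : Type*) (i : ℕ) (x : V7 L) : V7 L :=
  fun j => x j ^ (Nat.card K ^ i)

/-- The conjugate subspace `U^(q^i)` of `PG(6, L)`. -/
def conj (K : Type*) (i : ℕ) (U : Submodule L (V7 L)) : Submodule L (V7 L) :=
  Submodule.span L (frob K i '' (U : Set (V7 L)))

/-- `S` is the regular 2-spread of the hyperplane `H` of `PG(6, K)` with transversal lines
`g, g^q, g^(q^2)`: the line `g` of `H*` is disjoint from `PG(6, K)`, the elements of `S` are the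
sets of `K`-rational points of the planes `⟨P, P^q, P^(q^2)⟩`, where `P` is a point of `g`, and
these are planes that partition the points of `H`. -/
structure IsRegularSpread (H : Submodule K (V7 K)) (S : Set (Submodule K (V7 K)))
    (g : Submodule L (V7 L)) : Prop where
  line : finrank L g = 2
  le : g ≤ extend L H
  disjoint : rational K g = ⊥
  mem_iff : ∀ W, W ∈ S ↔ ∃ P ∈ g, P ≠ 0 ∧
    W = rational K (Submodule.span L {P, frob K 1 P, frob K 2 P})
  plane : ∀ W ∈ S, W ≤ H ∧ finrank K W = 3
  partition : ∀ x ∈ H, x ≠ 0 → ∃! W, W ∈ S ∧ x ∈ W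

end Extension

section Plane

variable {K : Type*} [Field K]

/-- The points of the Bruck–Bose plane of the spread `S` of `H`: the points of `PG(6, K)` not
in `H`, and (as points at infinity) the elements of `S`. -/
def points (H : Submodule K (V7 K)) (S : Set (Submodule K (V7 K))) : Set (Submodule K (V7 K)) :=
  {W | (finrank K W = 1 ∧ ¬ W ≤ H) ∨ W ∈ S}

/-- The lines of the Bruck–Bose plane: the 3-spaces of `PG(6, K)` not in `H` that contain an
element of `S`, and the line at infinity, represented by `H`. A point `W` is incident with
a line `M` if and only if `W ≤ M`. -/
def lines (H : Submodule K (V7 K)) (S : Set (Submodule K (V7 K))) : Set (Submodule K (V7 K)) :=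
  {M | (finrank K M = 4 ∧ ¬ M ≤ H ∧ ∃ W ∈ S, W ≤ M) ∨ M = H}

/-- `B` is the set of points of a subplane of order `n` of the Bruck–Bose plane: it contains
a quadrangle, any two distinct lines that both join two points of `B` meet in a point of `B`, and
`B` has `n ^ 2 + n + 1` points. -/
structure IsSubplane (H : Submodule K (V7 K)) (S : Set (Submodule K (V7 K))) (n : ℕ)
    (B : Set (Submodule K (V7 K))) : Prop where
  subset : B ⊆ points H S
  quadrangle : ∃ A : Fin 4 → Submodule K (V7 K), (∀ i, A i ∈ B) ∧
    ∀ i j k, i ≠ j → j ≠ k → i ≠ k → ∀ l ∈ lines H S, ¬ (A i ≤ l ∧ A j ≤ l ∧ A k ≤ l)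
  meet : ∀ l ∈ lines H S, ∀ m ∈ lines H S, l ≠ m →
    (∃ P ∈ B, ∃ Q ∈ B, P ≠ Q ∧ P ≤ l ∧ Q ≤ l) →
    (∃ P ∈ B, ∃ Q ∈ B, P ≠ Q ∧ P ≤ m ∧ Q ≤ m) →
    ∃ P ∈ B, P ≤ l ∧ P ≤ m
  card : B.ncard = n ^ 2 + n + 1

/-- `B` is tangent to the line at infinity: exactly one point of `B` lies on that line. -/
def IsTangent (H : Submodule K (V7 K)) (B : Set (Submodule K (V7 K))) : Prop :=
  ∃! W, W ∈ B ∧ W ≤ H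

/-- The set `X` of points of `PG(6, K)` corresponds to the set `B` of points of the Bruck–Bose
plane: `B` consists of the points of `X` outside `H`, and of the elements of `S` that contain
a point of `X`. -/
def CorrespondsTo (H : Submodule K (V7 K)) (S : Set (Submodule K (V7 K)))
    (X : Set (Projectivization K (V7 K))) (B : Set (Submodule K (V7 K))) : Prop :=
  B = {W | W ∈ points H S ∧ ∃ p ∈ X, p.submodule ≤ W}

end Plane

section Curves

/-- The point with parameter `(x 0 : x 1)` of the rational curve of degree `d` with coefficient
vectors `a 0, …, a d`. If these are linearly independent, the curve is a normal rational curve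
(a non-degenerate conic when `d = 2`) in the `d`-space that they span. -/
def curve {F : Type*} [Field F] {d : ℕ} (a : Fin (d + 1) → V7 F) (x : Fin 2 → F) : V7 F :=
  ∑ i : Fin (d + 1), (x 0 ^ (d - (i : ℕ)) * x 1 ^ (i : ℕ)) • a i

/-- The join of the point with parameter `x` of the curve `c` to the point with parameter `A x`
of the curve `n`. -/
def join {F : Type*} [Field F] (c : Fin 3 → V7 F) (n : Fin 4 → V7 F)
    (A : Matrix (Fin 2) (Fin 2) F) (x : Fin 2 → F) : Submodule F (V7 F) :=
  Submodule.span F {curve c x, curve n (A.mulVec x)}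

/-- A ruled surface of `PG(6, K)` defined by a projectivity from a conic directrix to a normal
rational curve directrix (of a 3-space): corresponding points are distinct, and the generator
lines are their joins. -/
structure RuledSurface (K : Type*) [Field K] where
  conic : Fin 3 → V7 K
  conic_indep : LinearIndependent K conic
  nrc : Fin 4 → V7 K
  nrc_indep : LinearIndependent K nrc
  proj : Matrix.GeneralLinearGroup (Fin 2) K
  join_line : ∀ x : Fin 2 → K, x ≠ 0 → finrank K (join conic nrc proj.val x) = 2

variable {K L : Type*} [Field K] [Field L] [Algebra K L]

/-- The points of the ruled surface: the points on the generator lines. -/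
def RuledSurface.points (R : RuledSurface K) : Set (Projectivization K (V7 K)) :=
  {p | ∃ x : Fin 2 → K, x ≠ 0 ∧ p.submodule ≤ join R.conic R.nrc R.proj.val x}

/-- The points of the extension of the ruled surface to `PG(6, L)`. -/
def RuledSurface.extPoints (L : Type*) [Field L] [Algebra K L] (R : RuledSurface K) :
    Set (Projectivization L (V7 L)) :=
  {p | ∃ x : Fin 2 → L, x ≠ 0 ∧
    p.submodule ≤ join (fun i => incl K L (R.conic i)) (fun i => incl K L (R.nrc i))
      (R.proj.val.map (algebraMap K L)) x}

/-- The extension to `PG(6, L)` of the curve with coefficient vectors `a` contains the three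
points in which `W*` meets the transversal lines `g, g^q, g^(q^2)`. -/
def ContainsTransversalPoints {d : ℕ} (g : Submodule L (V7 L)) (W : Submodule K (V7 K))
    (a : Fin (d + 1) → V7 K) : Prop :=
  ∀ i : Fin 3, ∃ x : Fin 2 → L, x ≠ 0 ∧
    Submodule.span L {curve (fun j => incl K L (a j)) x} = extend L W ⊓ conj K i g

/-- The conic with coefficient vectors `c` is a special conic of the spread element `W`. -/
def IsSpecialConic (g : Submodule L (V7 L)) (W : Submodule K (V7 K)) (c : Fin 3 → V7 K) : Prop :=
  (∀ i, c i ∈ W) ∧ ContainsTransversalPoints g W c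

/-- The normal rational curve with coefficient vectors `n` is a special normal rational curve in
the 3-space `T`, which is not in `H` and contains the spread element `W`. -/
def IsSpecialNRC (H : Submodule K (V7 K)) (g : Submodule L (V7 L)) (W T : Submodule K (V7 K))
    (n : Fin 4 → V7 K) : Prop :=
  finrank K T = 4 ∧ ¬ T ≤ H ∧ W ≤ T ∧ (∀ i, n i ∈ T) ∧ ContainsTransversalPoints g W n

/-- The conic directrix is a special conic in a spread element, the other directrix is a special
normal rational curve in a 3-space about a different spread element, and the extension to
`PG(6, L)` contains the three transversal lines of the spread. -/
def RuledSurface.IsSpecial (R : RuledSurface K) (H : Submodule K (V7 K))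
    (S : Set (Submodule K (V7 K))) (g : Submodule L (V7 L)) : Prop :=
  (∃ W ∈ S, IsSpecialConic g W R.conic ∧
    ∃ W' ∈ S, W' ≠ W ∧ ∃ T, IsSpecialNRC H g W' T R.nrc) ∧
  ∀ i : Fin 3, ∀ p : Projectivization L (V7 L), p.submodule ≤ conj K i g → p ∈ R.extPoints L

end Curves

end BruckBose

/-!
The Bruck–Bose representation is made explicit by coordinates. The hyperplane `H*` is the direct
sum of `g` and its conjugates, so the projection from `⟨g^q, g^(q^2)⟩` is a linear map `c` to
`L ^ 3`, and on the rational vectors it is injective: the affine points become the vectors `w` with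
`Λ w ∈ K`, `Λ w ≠ 0`, for a linear functional `Λ`, and the spread elements are the points of the
line `Λ = 0` (`IsCoord`). In this way the Bruck–Bose plane is `PG(2, L)`, and up to a change of
coordinates a subplane of order `q` is `PG(2, K)` (`exists_isCoord_eq_stdSubplane`). A tangent
subplane can be given the point `(0, 0, 1)` at infinity. Let `l (x) = Λ (x 0, x 1, 0)`, a linear
form over `L` without zeros over `K`. The affine points `(x 0, x 1, s)`, `s ∈ K`, of a line of the
subplane through the point at infinity are represented by the vectors `l (x)⁻¹ • (x 0, x 1, s)`,
which form the affine part of a line of `PG(6, K)`, the generator with parameter `x` (`IsGen`).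
Multiplication by the norm of `l (x)` shows that these generators form a ruled surface with
directrices `l^q l^(q^2) • (0, 0, 1)` and `l^q l^(q^2) • (x 0, x 1, 0)`. The zero `y` of `l` over
`L` is the parameter of a point on `g` of either curve, so the surface is special
(`exists_isStdSurface_isSpecial`).

Conversely, for a special surface the common parameter `y` of the points of the two directrices on
`g` forces all coordinates of the directrices to be divisible by the linear forms with the zeros
`y^q` and `y^(q^2)`. Cancelling these leaves the situation above
(`RuledSurface.IsSpecial.exists_isStdSurface`), so the surface corresponds to a tangent subplane.

If some ruled surface corresponds to a tangent subplane, then counting affine points shows that no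
generator is at infinity, and each generator is one of the lines found above (`exists_isGen`), so
that the two surfaces have the same points. This proves the part that holds for all `q`.

For `q ≥ 4`, a subplane represented by a ruled surface is tangent: it has too many points to be
disjoint from the line at infinity, and a subplane with a line at infinity has its affine points in
a plane of `PG(6, K)`, which contains at most three points of a normal rational curve
(`isTangent_of_four_le`). In the tangent case the conic lies in a spread element, by a count of
dimensions (`conic_mem_ptOf`), and has coordinates `f (x) • (0, 0, 1)` with a quadratic form `f`.
The values of `1 / f` at the `q + 1` points over `K` are proportional over `K` to values of the
linear form `l`; a relation of degree four, which has to hold identically, then shows that `f`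
vanishes at two conjugate points `y^q`, `y^(q^2)` (`exists_conjugate_zeros`). A second identity of
degree four gives the same for the coordinates of the normal rational curve, and the surface is
special with parameter `y` (`isSpecial_of_isTangent`).
-/

namespace BruckBose

open Module
open scoped LinearAlgebra.Projectivization

/-! ### The Frobenius map -/

theorem frob_zero {K L : Type*} [Field L] (v : V7 L) : frob K 0 v = v := by
  ext j
  simp [frob]

section Frobenius

variable {K L : Type*} [Field K] [Finite K] [Field L] [Algebra K L]

/-- The Frobenius map `x ↦ x ^ q` of `L` over `K`, where `q = |K|`. -/
noncomputable def phi (K L : Type*) [Field K] [Finite K] [Field L] [Algebra K L] : L →ₐ[K] L :=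
  letI := Fintype.ofFinite K
  FiniteField.frobeniusAlgHom K L

theorem phi_apply (x : L) : phi K L x = x ^ Nat.card K := by
  let := Fintype.ofFinite K
  simp [phi, Nat.card_eq_fintype_card]

theorem finite_of_finrank_eq_three (hL : finrank K L = 3) : Finite L := by
  have : FiniteDimensional K L := FiniteDimensional.of_finrank_pos (by omega)
  exact Module.finite_of_finite K

theorem phi_phi_phi (hL : finrank K L = 3) (x : L) :
    phi K L (phi K L (phi K L x)) = x := by
  let := Fintype.ofFinite K
  have : FiniteDimensional K L := FiniteDimensional.of_finrank_pos (by omega)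
  have : Finite L := finite_of_finrank_eq_three hL
  have h := pow_orderOf_eq_one (FiniteField.frobeniusAlgHom K L)
  rw [FiniteField.orderOf_frobeniusAlgHom, hL] at h
  exact DFunLike.congr_fun h x

theorem phi_eq_self_iff (hL : finrank K L = 3) {x : L} :
    phi K L x = x ↔ x ∈ Set.range (algebraMap K L) := by
  let := Fintype.ofFinite K
  have : FiniteDimensional K L := FiniteDimensional.of_finrank_pos (by omega)
  have : Finite L := finite_of_finrank_eq_three hL
  refine ⟨fun h => ?_, ?_⟩
  · rw [IsGalois.mem_range_algebraMap_iff_fixed]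
    intro f
    obtain ⟨n, rfl⟩ := (FiniteField.bijective_frobeniusAlgEquivOfAlgebraic_pow K L).2 f
    change (FiniteField.frobeniusAlgEquivOfAlgebraic K L ^ (n : ℕ)) x = x
    generalize (n : ℕ) = m
    induction m with
    | zero => rfl
    | succ m ih =>
      rw [pow_succ, AlgEquiv.mul_apply]
      have h' : FiniteField.frobeniusAlgEquivOfAlgebraic K L x = x := h
      rw [h', ih]
  · rintro ⟨a, rfl⟩
    exact AlgHom.commutes _ a

theorem phi_injective : Function.Injective (phi K L) := (phi K L).toRingHom.injective

theorem phi_phi_eq_self_iff (hL : finrank K L = 3) {x : L} :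
    phi K L (phi K L x) = x ↔ x ∈ Set.range (algebraMap K L) := by
  rw [← phi_eq_self_iff hL]
  constructor
  · intro h
    have h2 := phi_phi_phi (K := K) hL x
    rwa [h] at h2
  · intro h
    rw [h, h]

/-- The Frobenius map in each coordinate of a vector. -/
noncomputable def fr (K : Type*) [Field K] [Finite K] {L : Type*} [Field L] [Algebra K L]
    {ι : Type*} (v : ι → L) : ι → L := fun j => phi K L (v j)

variable {ι : Type*}

@[simp] theorem fr_apply (v : ι → L) (j : ι) : fr K v j = phi K L (v j) := rfl

@[simp] theorem fr_zero : fr K (0 : ι → L) = 0 := by ext; simp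

@[simp] theorem fr_add (v w : ι → L) : fr K (v + w) = fr K v + fr K w := by ext; simp

@[simp] theorem fr_smul (a : L) (v : ι → L) : fr K (a • v) = phi K L a • fr K v := by
  ext; simp

@[simp] theorem fr_sum {κ : Type*} (s : Finset κ) (v : κ → ι → L) :
    fr K (∑ i ∈ s, v i) = ∑ i ∈ s, fr K (v i) := by
  ext; simp

theorem fr_fr_fr (hL : finrank K L = 3) (v : ι → L) : fr K (fr K (fr K v)) = v := by
  ext; simp [phi_phi_phi hL]

theorem fr_injective : Function.Injective (fr K : (ι → L) → ι → L) := fun v w h => by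
  ext j
  exact phi_injective (congrFun h j)

theorem fr_eq_zero_iff {v : ι → L} : fr K v = 0 ↔ v = 0 :=
  ⟨fun h => fr_injective (h.trans fr_zero.symm), fun h => by rw [h, fr_zero]⟩

@[simp] theorem fr_incl (v : V7 K) : fr K (incl K L v) = incl K L v := by
  ext j
  simp [incl]

@[simp] theorem fr_algebraMap (x : ι → K) :
    fr K (fun i => algebraMap K L (x i)) = fun i => algebraMap K L (x i) := by
  ext j
  simp

theorem frob_one (v : V7 L) : frob K 1 v = fr K v := by
  ext j
  simp [frob, phi_apply]

theorem frob_two (v : V7 L) : frob K 2 v = fr K (fr K v) := by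
  ext j
  simp [frob, phi_apply, ← pow_mul, sq]

end Frobenius

/-! ### Binary forms -/

section Forms

variable {L : Type*} [Field L]

/-- The linear forms in two variables, as functions. The forms of degree `d` are the elements of
the power `linForms L ^ d` in the algebra of functions. -/
def linForms (L : Type*) [Field L] : Submodule L ((Fin 2 → L) → L) :=
  Submodule.span L {fun x => x 0, fun x => x 1}

/-- The determinant of two vectors: for `y ≠ 0`, the linear form with the zero `y`. -/
def bracket (x y : Fin 2 → L) : L := x 0 * y 1 - x 1 * y 0

theorem mem_linForms {F : (Fin 2 → L) → L} :
    F ∈ linForms L ↔ ∃ a b : L, F = fun x => a * x 0 + b * x 1 := by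
  rw [linForms, Submodule.mem_span_pair]
  refine exists_congr fun a => exists_congr fun b => ⟨fun h => ?_, fun h => ?_⟩
  · rw [← h]; rfl
  · rw [h]; rfl

theorem coord_mem_linForms (i : Fin 2) : (fun x : Fin 2 → L => x i) ∈ linForms L := by
  apply Submodule.subset_span
  fin_cases i <;> simp

theorem bracket_mem_linForms (y : Fin 2 → L) : (fun x => bracket x y) ∈ linForms L :=
  mem_linForms.2 ⟨y 1, -y 0, by ext x; simp [bracket]; ring⟩

theorem bracket_eq_zero_iff {x y : Fin 2 → L} (hy : y ≠ 0) :
    bracket x y = 0 ↔ ∃ a : L, x = a • y := by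
  constructor
  · intro h
    simp only [bracket] at h
    by_cases h0 : y 0 = 0
    · have h1 : y 1 ≠ 0 := fun h1 => hy (by ext i; fin_cases i <;> simp [h0, h1])
      refine ⟨x 1 / y 1, ?_⟩
      ext i
      fin_cases i
      · have : x 0 = 0 := by simpa [h0, h1] using h
        simp [h0, this]
      · simp [h1]
    · refine ⟨x 0 / y 0, ?_⟩
      ext i
      fin_cases i
      · simp [h0]
      · simp only [Fin.mk_one, Pi.smul_apply, smul_eq_mul]
        field_simp
        linear_combination -h
  · rintro ⟨a, rfl⟩
    simp [bracket]; ring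

theorem bracket_swap (x y : Fin 2 → L) : bracket x y = -bracket y x := by
  simp [bracket]; ring

theorem one_mem_forms (a : L) : (fun _ : Fin 2 → L => a) ∈ linForms L ^ 0 := by
  rw [pow_zero, Submodule.mem_one]
  exact ⟨a, rfl⟩

theorem mul_mem_forms {d e : ℕ} {F G : (Fin 2 → L) → L} (hF : F ∈ linForms L ^ d)
    (hG : G ∈ linForms L ^ e) : (fun x => F x * G x) ∈ linForms L ^ (d + e) := by
  rw [pow_add]
  exact Submodule.mul_mem_mul hF hG

theorem const_mul_mem_forms {d : ℕ} {F : (Fin 2 → L) → L} (a : L) (hF : F ∈ linForms L ^ d) :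
    (fun x => a * F x) ∈ linForms L ^ d :=
  Submodule.smul_mem _ a hF

theorem pow_mem_forms {F : (Fin 2 → L) → L} (hF : F ∈ linForms L) (d : ℕ) :
    (fun x => F x ^ d) ∈ linForms L ^ d :=
  Submodule.pow_mem_pow _ hF d

theorem forms_zero {F : (Fin 2 → L) → L} (hF : F ∈ linForms L ^ 0) : ∃ a, F = fun _ => a := by
  rw [pow_zero, Submodule.mem_one] at hF
  obtain ⟨a, rfl⟩ := hF
  exact ⟨a, rfl⟩

/-- Expansion of a form at a point `y`, with respect to a second point `z`. -/
theorem forms_expand {y z : Fin 2 → L} (hz : bracket z y = 1) {d : ℕ} {F : (Fin 2 → L) → L}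
    (hF : F ∈ linForms L ^ (d + 1)) :
    ∃ G ∈ linForms L ^ d, ∀ x,
      F x = bracket x y * G x + F y * bracket z x ^ (d + 1) := by
  have key : ∀ (a b : L) (x : Fin 2 → L), a * x 0 + b * x 1 =
      bracket x y * (a * z 0 + b * z 1) + bracket z x * (a * y 0 + b * y 1) := by
    intro a b x
    have h : a * x 0 + b * x 1 = bracket z y * (a * x 0 + b * x 1) := by rw [hz, one_mul]
    rw [h]
    simp only [bracket]
    ring
  induction d generalizing F with
  | zero =>
    rw [zero_add, pow_one, mem_linForms] at hF
    obtain ⟨a, b, rfl⟩ := hF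
    refine ⟨_, one_mem_forms (a * z 0 + b * z 1), fun x => ?_⟩
    simp only [zero_add, pow_one]
    rw [key a b x]
    ring
  | succ d ih =>
    rw [pow_succ] at hF
    induction hF using Submodule.mul_induction_on' with
    | mem_mul_mem F hF l hl =>
      obtain ⟨G, hG, h⟩ := ih hF
      obtain ⟨a, b, rfl⟩ := mem_linForms.1 hl
      refine ⟨fun x => G x * (a * x 0 + b * x 1) +
        F y * (a * z 0 + b * z 1) * bracket z x ^ (d + 1), ?_, fun x => ?_⟩
      · refine Submodule.add_mem _ (mul_mem_forms hG ?_) (const_mul_mem_forms _ ?_)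
        · rwa [pow_one]
        · refine pow_mem_forms (F := fun x => bracket z x) ?_ _
          simp_rw [bracket_swap z]
          exact Submodule.neg_mem _ (bracket_mem_linForms z)
      · simp only [Pi.mul_apply]
        rw [h x]
        have := key a b x
        linear_combination F y * bracket z x ^ (d + 1) * this
    | add F hF F' hF' h h' =>
      obtain ⟨G, hG, h⟩ := h
      obtain ⟨G', hG', h'⟩ := h'
      refine ⟨G + G', Submodule.add_mem _ hG hG', fun x => ?_⟩
      simp only [Pi.add_apply]
      rw [h x, h' x]
      ring

theorem exists_bracket_eq_one {y : Fin 2 → L} (hy : y ≠ 0) : ∃ z, bracket z y = 1 := by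
  by_cases h0 : y 0 = 0
  · have h1 : y 1 ≠ 0 := fun h1 => hy (by ext i; fin_cases i <;> simp [h0, h1])
    exact ⟨![(y 1)⁻¹, 0], by simp [bracket, h1]⟩
  · exact ⟨![0, -(y 0)⁻¹], by simp [bracket, h0]⟩

/-- A form with the zero `y` is divisible by the linear form with the zero `y`. -/
theorem forms_factor {y : Fin 2 → L} (hy : y ≠ 0) {d : ℕ} {F : (Fin 2 → L) → L}
    (hF : F ∈ linForms L ^ (d + 1)) (h : F y = 0) :
    ∃ G ∈ linForms L ^ d, ∀ x, F x = bracket x y * G x := by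
  obtain ⟨z, hz⟩ := exists_bracket_eq_one hy
  obtain ⟨G, hG, hFG⟩ := forms_expand hz hF
  exact ⟨G, hG, fun x => by rw [hFG x, h]; ring⟩

/-- A form of degree `d` with more than `d` zeros vanishes. -/
theorem forms_eq_zero {d : ℕ} {F : (Fin 2 → L) → L} (hF : F ∈ linForms L ^ d)
    (s : Finset (Fin 2 → L)) (hd : d < s.card) (h0 : ∀ x ∈ s, x ≠ 0)
    (hs : (s : Set (Fin 2 → L)).Pairwise fun x y => bracket x y ≠ 0)
    (h : ∀ x ∈ s, F x = 0) (x : Fin 2 → L) : F x = 0 := by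
  induction d generalizing F s x with
  | zero =>
    obtain ⟨a, rfl⟩ := forms_zero hF
    obtain ⟨y, hy⟩ := Finset.card_pos.1 hd
    exact h y hy
  | succ d ih =>
    classical
    obtain ⟨y, hy⟩ := Finset.card_pos.1 (Nat.zero_lt_of_lt hd)
    obtain ⟨G, hG, hFG⟩ := forms_factor (h0 y hy) hF (h y hy)
    rw [hFG, ih hG (s.erase y) (by rw [Finset.card_erase_of_mem hy]; omega)
      (fun x hx => h0 x (Finset.mem_of_mem_erase hx))
      (hs.mono (by simp)) (fun x hx => ?_) x, mul_zero]
    have h1 := hFG x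
    rw [h x (Finset.mem_of_mem_erase hx)] at h1
    exact (mul_eq_zero.1 h1.symm).resolve_left
      (hs (Finset.mem_of_mem_erase hx) hy (Finset.ne_of_mem_erase hx))

/-- A form of degree `d` over `L` that vanishes at more than `d` points over `K` vanishes. -/
theorem forms_eq_zero_of_points {K : Type*} [Field K] [Algebra K L] {d : ℕ}
    {F : (Fin 2 → L) → L} (hF : F ∈ linForms L ^ d) (s : Finset (ℙ K (Fin 2 → K)))
    (hd : d < s.card) (h : ∀ p ∈ s, F (fun i => algebraMap K L (p.rep i)) = 0)
    (x : Fin 2 → L) : F x = 0 := by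
  classical
  have hinj : Function.Injective fun p : ℙ K (Fin 2 → K) =>
      fun i => algebraMap K L (p.rep i) := by
    intro p p' hp
    have : p.rep = p'.rep := by
      ext i
      exact (algebraMap K L).injective (congrFun hp i)
    rw [← p.mk_rep, ← p'.mk_rep]
    simp_rw [this]
  refine forms_eq_zero hF (s.map ⟨_, hinj⟩) (by simpa using hd) ?_ ?_ ?_ x
  · intro x hx
    obtain ⟨p, _, rfl⟩ := Finset.mem_map.1 hx
    intro h0
    apply p.rep_nonzero
    ext i
    exact (algebraMap K L).injective (by simpa using congrFun h0 i)
  · intro x hx y hy hxy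
    obtain ⟨p, _, rfl⟩ := Finset.mem_map.1 (Finset.mem_coe.1 hx)
    obtain ⟨p', _, rfl⟩ := Finset.mem_map.1 (Finset.mem_coe.1 hy)
    intro h0
    have h1 : bracket p.rep p'.rep = 0 := by
      apply (algebraMap K L).injective
      simpa [bracket] using h0
    rw [bracket_eq_zero_iff p'.rep_nonzero] at h1
    obtain ⟨a, ha⟩ := h1
    apply hxy
    have : p = p' := by
      rw [← p.mk_rep, ← p'.mk_rep]
      exact (Projectivization.mk_eq_mk_iff' K _ _ _ _).2 ⟨a, ha.symm⟩
    rw [this]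
  · intro x hx
    obtain ⟨p, hp, rfl⟩ := Finset.mem_map.1 hx
    exact h p hp

/-- A linear functional on a rational curve of degree `d` is a form of degree `d`; so it is if the
parameter of the curve is substituted linearly. -/
theorem curve_mem_forms {d : ℕ} (ψ : V7 L →ₗ[L] L) (a : Fin (d + 1) → V7 L)
    (A : Matrix (Fin 2) (Fin 2) L) :
    (fun x => ψ (curve a (A.mulVec x))) ∈ linForms L ^ d := by
  have hA : ∀ i, (fun x => A.mulVec x i) ∈ linForms L := fun i =>
    mem_linForms.2 ⟨A i 0, A i 1, by ext x; simp [Matrix.mulVec, dotProduct]⟩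
  have : (fun x => ψ (curve a (A.mulVec x))) = ∑ i : Fin (d + 1),
      fun x => ψ (a i) * ((A.mulVec x) 0 ^ (d - (i : ℕ)) * (A.mulVec x) 1 ^ (i : ℕ)) := by
    ext x
    simp only [curve, map_sum, map_smul, smul_eq_mul, Finset.sum_apply]
    exact Finset.sum_congr rfl fun i _ => mul_comm _ _
  rw [this]
  refine Submodule.sum_mem _ fun i _ => const_mul_mem_forms _ ?_
  have h := mul_mem_forms (pow_mem_forms (hA 0) (d - (i : ℕ))) (pow_mem_forms (hA 1) (i : ℕ))
  rwa [Nat.sub_add_cancel (Nat.lt_succ_iff.1 i.2)] at h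

/-- If a linear functional vanishes on all points of a rational curve of degree `d`, and the field
has more than `d` elements, then it vanishes on the coefficient vectors. -/
theorem coeff_eq_zero_of_curve {d : ℕ} (ψ : V7 L →ₗ[L] L) (a : Fin (d + 1) → V7 L)
    (hd : d < Nat.card L) (h : ∀ x, ψ (curve a x) = 0) (i : Fin (d + 1)) : ψ (a i) = 0 := by
  classical
  have : Finite L := Nat.finite_of_card_ne_zero (by omega)
  let := Fintype.ofFinite L
  let p : Polynomial L := ∑ i : Fin (d + 1), Polynomial.monomial (i : ℕ) (ψ (a i))
  have hp : p = 0 := by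
    refine Polynomial.eq_zero_of_degree_lt_of_eval_finset_eq_zero Finset.univ ?_ fun t _ => ?_
    · refine lt_of_le_of_lt (Polynomial.degree_sum_le _ _) ?_
      rw [Finset.sup_lt_iff (by simp)]
      intro j _
      refine lt_of_le_of_lt (Polynomial.degree_monomial_le _ _) ?_
      rw [Finset.card_univ, ← Nat.card_eq_fintype_card]
      exact_mod_cast lt_of_le_of_lt (Nat.lt_succ_iff.1 j.2) hd
    · have := h ![1, t]
      simp only [curve, map_sum, map_smul, smul_eq_mul] at this
      simp only [p, Polynomial.eval_finsetSum, Polynomial.eval_monomial]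
      rw [← this]
      exact Finset.sum_congr rfl fun i _ => by simp; ring
  have : p.coeff i = ψ (a i) := by
    simp only [p, Polynomial.finsetSum_coeff, Polynomial.coeff_monomial]
    rw [Finset.sum_eq_single i]
    · simp
    · intro j _ hj
      rw [if_neg (fun h => hj (Fin.ext h))]
    · simp
  rw [← this, hp, Polynomial.coeff_zero]

variable {K : Type*} [Field K] [Finite K] [Algebra K L]

/-- The conjugate of a form of degree `d` is a form of degree `d`. -/
theorem conj_mem_forms (hL : finrank K L = 3) {d : ℕ} {F : (Fin 2 → L) → L}
    (hF : F ∈ linForms L ^ d) :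
    (fun x => phi K L (F (fr K (fr K x)))) ∈ linForms L ^ d := by
  induction hF using Submodule.pow_induction_on_left' with
  | algebraMap r => exact one_mem_forms (phi K L r)
  | add F G d hF hG h h' =>
    simp only [Pi.add_apply, map_add]
    exact Submodule.add_mem _ h h'
  | mem_mul l hl d F hF h =>
    simp only [Pi.mul_apply, map_mul]
    rw [Nat.succ_eq_one_add]
    refine mul_mem_forms ?_ h
    rw [pow_one]
    obtain ⟨a, b, rfl⟩ := mem_linForms.1 hl
    exact mem_linForms.2 ⟨phi K L a, phi K L b, by ext x; simp [phi_phi_phi hL]⟩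

end Forms

/-! ### Coordinates of the Bruck–Bose representation -/

section Coordinates

theorem incl_injective {K L : Type*} [Field K] [Field L] [Algebra K L] :
    Function.Injective (incl K L) := fun v w h => by
  ext j
  exact (algebraMap K L).injective (congrFun h j)

variable {K L : Type*} [Field K] [Finite K] [Field L] [Algebra K L]

theorem exists_smul_sub_mem {F V : Type*} [Field F] [AddCommGroup V] [Module F V]
    [FiniteDimensional F V] {U T : Submodule F V} (hUT : U ≤ T)
    (h : finrank F T = finrank F U + 1) {t : V} (ht : t ∈ T) (htU : t ∉ U) {v : V} (hv : v ∈ T) :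
    ∃ a : F, v - a • t ∈ U := by
  have hlt : U < U ⊔ Submodule.span F {t} := by
    refine lt_of_le_of_ne le_sup_left fun h => htU ?_
    rw [h]
    exact Submodule.mem_sup_right (Submodule.mem_span_singleton_self t)
  have hle : U ⊔ Submodule.span F {t} ≤ T :=
    sup_le hUT ((Submodule.span_singleton_le_iff_mem _ _).2 ht)
  have heq : U ⊔ Submodule.span F {t} = T :=
    Submodule.eq_of_le_of_finrank_le hle (by
      have := Submodule.finrank_lt_finrank_of_lt hlt
      omega)
  rw [← heq, Submodule.mem_sup] at hv
  obtain ⟨u, hu, w, hw, rfl⟩ := hv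
  obtain ⟨a, rfl⟩ := Submodule.mem_span_singleton.1 hw
  exact ⟨a, by simpa using hu⟩

theorem exists_incl_eq (hL : finrank K L = 3) {p : V7 L} (hp : fr K p = p) :
    ∃ v : V7 K, incl K L v = p := by
  have : ∀ j, ∃ a, algebraMap K L a = p j := fun j =>
    (phi_eq_self_iff hL).1 (congrFun hp j)
  choose v hv using this
  exact ⟨v, funext hv⟩

/-- Coordinates adapted to a regular spread. The linear map `c` from `V7 L` to `L ^ 3` is
determined by its kernel, the join of the conjugates `g^q` and `g^(q^2)`. Restricted to the
`K`-rational vectors, `c` is a `K`-linear isomorphism onto the vectors `w` with `Λ w ∈ K`, and the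
vectors of `H` are those with `Λ w = 0`. Thus the points and lines of the Bruck–Bose plane become
the points and lines of `PG(2, L)`, with line at infinity `Λ = 0`. -/
structure IsCoord (H : Submodule K (V7 K)) (g : Submodule L (V7 L))
    (c : V7 L →ₗ[L] (Fin 3 → L)) (Λ : (Fin 3 → L) →ₗ[L] L) : Prop where
  inj : ∀ p, c p = 0 → c (fr K p) = 0 → c (fr K (fr K p)) = 0 → p = 0
  mem_line : ∀ p, p ∈ g ↔ c (fr K p) = 0 ∧ c (fr K (fr K p)) = 0
  map_fr : ∀ p, Λ (c (fr K p)) = phi K L (Λ (c p))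
  mem_hyperplane : ∀ v, v ∈ H ↔ Λ (c (incl K L v)) = 0
  surj : ∀ w, Λ w ∈ Set.range (algebraMap K L) → ∃ v, c (incl K L v) = w
  surj_line : ∀ w, Λ w = 0 → ∃ p ∈ g, c p = w
  ne_zero : Λ ≠ 0

/-- The vectors of an affine origin, of a basis of `g`, and of its conjugates. -/
noncomputable def adaptedVec (K : Type*) {L : Type*} [Field K] [Finite K] [Field L] [Algebra K L]
    (t : V7 K) (b : Fin 2 → V7 L) : Option (Fin 2 × Fin 3) → V7 L
  | none => incl K L t
  | some (j, i) => ![b j, fr K (b j), fr K (fr K (b j))] i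

theorem fr_mem_span_adaptedVec (hL : finrank K L = 3) (t : V7 K) (b : Fin 2 → V7 L) {p : V7 L}
    (hp : p ∈ Submodule.span L (Set.range fun k => adaptedVec K t b (some k))) :
    fr K p ∈ Submodule.span L (Set.range fun k => adaptedVec K t b (some k)) := by
  induction hp using Submodule.span_induction with
  | mem x hx =>
    obtain ⟨⟨j, i⟩, rfl⟩ := hx
    refine Submodule.subset_span ⟨(j, i + 1), ?_⟩
    fin_cases i <;> simp [adaptedVec, fr_fr_fr hL]
  | zero => simp
  | add x y _ _ hx hy => rw [fr_add]; exact Submodule.add_mem _ hx hy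
  | smul a x _ hx => rw [fr_smul]; exact Submodule.smul_mem _ _ hx

variable {H : Submodule K (V7 K)} {S : Set (Submodule K (V7 K))} {g : Submodule L (V7 L)}

theorem incl_mem_span_adaptedVec (hL : finrank K L = 3) (hS : IsRegularSpread H S g) (t : V7 K)
    {b : Fin 2 → V7 L} (hb : Submodule.span L (Set.range b) = g) {v : V7 K} (hv : v ∈ H) :
    incl K L v ∈ Submodule.span L (Set.range fun k => adaptedVec K t b (some k)) := by
  by_cases h0 : v = 0
  · simp [h0]
  obtain ⟨W, ⟨hW, hvW⟩, -⟩ := hS.partition v hv h0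
  obtain ⟨P, hP, -, rfl⟩ := (hS.mem_iff W).1 hW
  have hP' : P ∈ Submodule.span L (Set.range fun k => adaptedVec K t b (some k)) := by
    rw [← hb] at hP
    refine Submodule.span_mono ?_ hP
    rintro _ ⟨j, rfl⟩
    exact ⟨(j, 0), rfl⟩
  have hv' : incl K L v ∈ Submodule.span L {P, frob K 1 P, frob K 2 P} := hvW
  refine Submodule.span_le.2 ?_ hv'
  rintro x (rfl | rfl | rfl)
  · exact hP'
  · rw [frob_one]; exact fr_mem_span_adaptedVec hL t b hP'
  · rw [frob_two]
    exact fr_mem_span_adaptedVec hL t b (fr_mem_span_adaptedVec hL t b hP')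

/-- The hyperplane `H` is spanned over `L` by `g` and its conjugates, and their sum is direct since
the dimensions add up. -/
theorem exists_adaptedBasis (hL : finrank K L = 3) (hH : finrank K H = 6)
    (hS : IsRegularSpread H S g) {t : V7 K} (ht : t ∉ H)
    {b : Fin 2 → V7 L} (hb : Submodule.span L (Set.range b) = g) :
    ∃ B : Basis (Option (Fin 2 × Fin 3)) L (V7 L), ∀ k, B k = adaptedVec K t b k := by
  have hspan : ⊤ ≤ Submodule.span L (Set.range (adaptedVec K t b)) := by
    intro p _
    have h1 : p = ∑ j, p j • incl K L (Pi.single j 1) := by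
      ext i
      simp [incl, Finset.sum_apply, Pi.single_apply]
    rw [h1]
    refine Submodule.sum_mem _ fun j _ => Submodule.smul_mem _ _ ?_
    obtain ⟨a, ha⟩ := exists_smul_sub_mem (U := H) (T := ⊤) le_top (by simp [hH])
      Submodule.mem_top ht (v := Pi.single j 1) Submodule.mem_top
    have h2 := incl_mem_span_adaptedVec hL hS t hb ha
    have h3 : incl K L (Pi.single j 1) =
        incl K L (Pi.single j 1 - a • t) + algebraMap K L a • incl K L t := by
      rw [map_sub, map_smul, algebraMap_smul, sub_add_cancel]
    rw [h3]
    refine Submodule.add_mem _ (Submodule.span_mono ?_ h2) (Submodule.smul_mem _ _ ?_)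
    · rintro _ ⟨k, rfl⟩
      exact ⟨some k, rfl⟩
    · exact Submodule.subset_span ⟨none, rfl⟩
  refine ⟨basisOfTopLeSpanOfCardEqFinrank _ hspan (by simp), fun k => by simp⟩

/-- The Frobenius map permutes the vectors of the adapted basis. -/
theorem repr_fr (hL : finrank K L = 3) {t : V7 K} {b : Fin 2 → V7 L}
    {B : Basis (Option (Fin 2 × Fin 3)) L (V7 L)} (hB : ∀ k, B k = adaptedVec K t b k)
    (p : V7 L) : B.repr (fr K p) none = phi K L (B.repr p none) ∧
      ∀ j i, B.repr (fr K p) (some (j, i + 1)) = phi K L (B.repr p (some (j, i))) := by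
  let s : Option (Fin 2 × Fin 3) → Option (Fin 2 × Fin 3)
    | none => none
    | some (j, i) => some (j, i + 1)
  have hs : Function.Injective s := by
    rintro (_ | ⟨j, i⟩) (_ | ⟨j', i'⟩) h <;> simp_all [s]
  have hfr : ∀ k, fr K (B k) = B (s k) := by
    rintro (_ | ⟨j, i⟩)
    · simp [hB, s, adaptedVec]
    · simp only [hB, s]
      fin_cases i <;> simp [adaptedVec, fr_fr_fr hL]
  have h : ∀ k, B.repr (fr K p) (s k) = phi K L (B.repr p k) := by
    intro k
    conv_lhs => rw [← B.sum_repr p]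
    simp only [fr_sum, fr_smul, hfr, map_sum, map_smul, Basis.repr_self, Finsupp.coe_finsetSum,
      Finset.sum_apply, Finsupp.smul_apply, smul_eq_mul]
    rw [Finset.sum_eq_single k]
    · simp
    · intro k' _ hk
      rw [Finsupp.single_eq_of_ne (fun h => hk (hs h.symm)), mul_zero]
    · simp
  exact ⟨h none, fun j i => h (some (j, i))⟩

/-- Adapted coordinates exist: those with respect to an adapted basis that belong to the origin and
to the basis of `g`. -/
theorem exists_isCoord (hL : finrank K L = 3) (hH : finrank K H = 6)
    (hS : IsRegularSpread H S g) {t : V7 K} (ht : t ∉ H)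
    {b : Fin 2 → V7 L} (hb : Submodule.span L (Set.range b) = g) :
    ∃ c : V7 L →ₗ[L] (Fin 3 → L), IsCoord H g c (LinearMap.proj 0) ∧
      c (incl K L t) = ![1, 0, 0] ∧ c (b 0) = ![0, 1, 0] ∧ c (b 1) = ![0, 0, 1] := by
  obtain ⟨B, hB⟩ := exists_adaptedBasis hL hH hS ht hb
  let c : V7 L →ₗ[L] (Fin 3 → L) :=
    LinearMap.pi ![B.coord none, B.coord (some (0, 0)), B.coord (some (1, 0))]
  have hc : ∀ p, c p =
      ![B.repr p none, B.repr p (some (0, 0)), B.repr p (some (1, 0))] := by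
    intro p
    ext i
    fin_cases i <;> simp [c]
  have hcB : c (B none) = ![1, 0, 0] ∧ (c (B (some (0, 0))) = ![0, 1, 0] ∧
      c (B (some (1, 0))) = ![0, 0, 1]) ∧ (∀ j, c (B (some (j, 1))) = 0) ∧
      ∀ j, c (B (some (j, 2))) = 0 := by
    refine ⟨?_, ⟨?_, ?_⟩, fun j => ?_, fun j => ?_⟩ <;> rw [hc] <;> ext i <;>
      fin_cases i <;> simp
  obtain ⟨hc0, ⟨hc1, hc2⟩, hc3, hc4⟩ := hcB
  have hb0 : ∀ j, B (some (j, 0)) = b j := fun j => hB _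
  have hb1 : ∀ j, B (some (j, 1)) = fr K (b j) := fun j => hB _
  have hb2 : ∀ j, B (some (j, 2)) = fr K (fr K (b j)) := fun j => hB _
  have hbn : B none = incl K L t := hB _
  have hd1 : ∀ j, c (fr K (b j)) = 0 := fun j => hb1 j ▸ hc3 j
  have hd2 : ∀ j, c (fr K (fr K (b j))) = 0 := fun j => hb2 j ▸ hc4 j
  have hr := fun p => repr_fr hL hB p
  have hr' : ∀ p, c (fr K p) = ![phi K L (B.repr p none), phi K L (B.repr p (some (0, 2))),
      phi K L (B.repr p (some (1, 2)))] := by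
    intro p
    rw [hc, (hr p).1, ← (hr p).2, ← (hr p).2]
    rfl
  have hr'' : ∀ p, c (fr K (fr K p)) = ![phi K L (phi K L (B.repr p none)),
      phi K L (phi K L (B.repr p (some (0, 1)))),
      phi K L (phi K L (B.repr p (some (1, 1))))] := by
    intro p
    rw [hr', (hr p).1, ← (hr p).2, ← (hr p).2]
    rfl
  have hφ : ∀ x : L, phi K L x = 0 ↔ x = 0 := fun x => map_eq_zero _
  refine ⟨c, ⟨?_, ?_, ?_, ?_, ?_, ?_, ?_⟩, hbn ▸ hc0, hb0 0 ▸ hc1, hb0 1 ▸ hc2⟩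
  · intro p h0 h1 h2
    rw [hc] at h0
    rw [hr'] at h1
    rw [hr''] at h2
    simp only [Matrix.cons_eq_zero_iff, hφ] at h0 h1 h2
    apply B.ext_elem
    rintro (_ | ⟨j, i⟩)
    · simp [h0.1]
    · fin_cases j <;> fin_cases i <;> simp [h0, h1, h2]
  · intro p
    constructor
    · intro hp
      rw [← hb, Submodule.mem_span_range_iff_exists_fun] at hp
      obtain ⟨a, rfl⟩ := hp
      simp [Fin.sum_univ_two, hd1, hd2]
    · rintro ⟨h1, h2⟩
      rw [hr'] at h1
      rw [hr''] at h2
      simp only [Matrix.cons_eq_zero_iff, hφ] at h1 h2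
      rw [← B.sum_repr p, Fintype.sum_option, Fintype.sum_prod_type]
      simp only [Fin.sum_univ_two, Fin.sum_univ_three, h1, h2, hb0, zero_smul, zero_add, add_zero,
        ← hb]
      exact Submodule.add_mem _ (Submodule.smul_mem _ _ (Submodule.subset_span ⟨0, rfl⟩))
        (Submodule.smul_mem _ _ (Submodule.subset_span ⟨1, rfl⟩))
  · intro p
    rw [hr', hc]
    rfl
  · have hmem : ∀ v ∈ H, c (incl K L v) 0 = 0 := by
      intro v hv
      have h := incl_mem_span_adaptedVec hL hS t hb hv
      have : Submodule.span L (Set.range fun k => adaptedVec K t b (some k)) ≤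
          LinearMap.ker (B.coord none) := by
        rw [Submodule.span_le]
        rintro _ ⟨k, rfl⟩
        change adaptedVec K t b (some k) ∈ _
        rw [← hB]
        simp
      have h2 := this h
      rw [hc]
      simpa using h2
    intro v
    refine ⟨hmem v, fun h => ?_⟩
    obtain ⟨a, ha⟩ := exists_smul_sub_mem (U := H) (T := ⊤) le_top (by simp [hH])
      Submodule.mem_top ht (v := v) Submodule.mem_top
    have h3 := hmem _ ha
    have h4 : c (incl K L v) 0 = 0 := h
    have h5 : incl K L (v - a • t) = incl K L v - algebraMap K L a • incl K L t := by
      rw [map_sub, map_smul, algebraMap_smul]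
    rw [h5, map_sub, map_smul, Pi.sub_apply, h4, ← hbn, hc0] at h3
    have ha0 : a = 0 := by simpa using h3
    simpa [ha0] using ha
  · rintro w ⟨a, ha⟩
    let p := w 1 • b 0 + w 2 • b 1
    obtain ⟨v, hv⟩ := exists_incl_eq (K := K) hL
      (p := algebraMap K L a • incl K L t + (p + fr K p + fr K (fr K p))) (by
        simp only [fr_add, fr_smul, fr_fr_fr hL, fr_incl, AlgHom.commutes]
        abel)
    refine ⟨v, ?_⟩
    have ha' : algebraMap K L a = w 0 := ha
    rw [hv]
    simp only [p, fr_add, fr_smul, map_add, map_smul, ← hb0, ← hbn, hc0, hc1, hc2, ha']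
    simp only [hb0, hd1, hd2]
    ext i
    fin_cases i <;> simp
  · intro w hw
    refine ⟨w 1 • b 0 + w 2 • b 1, ?_, ?_⟩
    · rw [← hb]
      exact Submodule.add_mem _ (Submodule.smul_mem _ _ (Submodule.subset_span ⟨0, rfl⟩))
        (Submodule.smul_mem _ _ (Submodule.subset_span ⟨1, rfl⟩))
    · have hw' : w 0 = 0 := hw
      simp only [map_add, map_smul, ← hb0, hc1, hc2]
      ext i
      fin_cases i <;> simp [hw']
  · intro h
    have := LinearMap.congr_fun h (Pi.single (0 : Fin 3) (1 : L))
    simp at this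

/-- A change of coordinates in `PG(2, L)`. -/
theorem IsCoord.trans {c : V7 L →ₗ[L] (Fin 3 → L)} {Λ : (Fin 3 → L) →ₗ[L] L}
    (hc : IsCoord H g c Λ) (M : (Fin 3 → L) ≃ₗ[L] (Fin 3 → L)) :
    IsCoord H g (M.symm.toLinearMap ∘ₗ c) (Λ ∘ₗ M.toLinearMap) where
  inj p := by simpa using hc.inj p
  mem_line p := by simpa using hc.mem_line p
  map_fr p := by simpa using hc.map_fr p
  mem_hyperplane v := by simpa using hc.mem_hyperplane v
  surj w hw := by
    obtain ⟨v, hv⟩ := hc.surj (M w) (by simpa using hw)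
    exact ⟨v, by simp [hv]⟩
  surj_line w hw := by
    obtain ⟨p, hp, h⟩ := hc.surj_line (M w) (by simpa using hw)
    exact ⟨p, hp, by simp [h]⟩
  ne_zero h := hc.ne_zero (by
    ext1 w
    have := LinearMap.congr_fun h (M.symm (Pi.single w 1))
    ext
    simpa using this)

end Coordinates

/-! ### Points and lines in coordinates -/

section Geometry

variable {K L : Type*} [Field K] [Field L] [Algebra K L]

/-- The inclusion of `K ^ n` into `L ^ n`. -/
def emb (L : Type*) [Field L] [Algebra K L] {ι : Type*} (z : ι → K) : ι → L :=
  fun i => algebraMap K L (z i)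

@[simp] theorem emb_apply {ι : Type*} (z : ι → K) (i : ι) : emb L z i = algebraMap K L (z i) := rfl

@[simp] theorem emb_add {ι : Type*} (z z' : ι → K) : emb L (z + z') = emb L z + emb L z' := by
  ext; simp

@[simp] theorem emb_smul {ι : Type*} (a : K) (z : ι → K) :
    emb L (a • z) = algebraMap K L a • emb L z := by
  ext; simp

@[simp] theorem emb_zero {ι : Type*} : emb L (0 : ι → K) = 0 := by
  ext; simp

theorem emb_injective {ι : Type*} : Function.Injective (emb L : (ι → K) → ι → L) := fun z z' h => by
  ext i
  exact (algebraMap K L).injective (congrFun h i)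

theorem emb_ne_zero {ι : Type*} {z : ι → K} (hz : z ≠ 0) : emb L z ≠ 0 := fun h =>
  hz (emb_injective (h.trans emb_zero.symm))

/-- If two vectors over `K` are proportional over `L`, then they are proportional over `K`. -/
theorem exists_of_emb_eq_smul {ι : Type*} {z z' : ι → K} (hz' : z' ≠ 0) {a : L}
    (h : emb L z = a • emb L z') : ∃ k : K, algebraMap K L k = a ∧ z = k • z' := by
  obtain ⟨j, hj⟩ := Function.ne_iff.1 hz'
  have hj' : algebraMap K L (z' j) ≠ 0 := by simpa using hj
  have h1 := congrFun h j
  simp only [emb_apply, Pi.smul_apply, smul_eq_mul] at h1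
  have h2 : algebraMap K L (z j / z' j) = a := by
    rw [map_div₀, h1]
    field_simp
  refine ⟨z j / z' j, h2, emb_injective (L := L) ?_⟩
  rw [emb_smul, h2, h]

/-- The subspace of `PG(6, K)` that represents the point `w` of `PG(2, L)`. -/
def ptOf (K : Type*) {L : Type*} [Field K] [Field L] [Algebra K L]
    (c : V7 L →ₗ[L] (Fin 3 → L)) (w : Fin 3 → L) : Submodule K (V7 K) :=
  ((Submodule.span L {w}).restrictScalars K).comap (c.restrictScalars K ∘ₗ incl K L)

/-- The subspace of `PG(6, K)` that represents the line `a = 0` of `PG(2, L)`. -/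
def lnOf (K : Type*) {L : Type*} [Field K] [Field L] [Algebra K L]
    (c : V7 L →ₗ[L] (Fin 3 → L)) (a : (Fin 3 → L) →ₗ[L] L) : Submodule K (V7 K) :=
  ((LinearMap.ker a).restrictScalars K).comap (c.restrictScalars K ∘ₗ incl K L)

/-- The points of `PG(2, K)`, in the given coordinates of the Bruck–Bose plane. -/
def stdSubplane (K : Type*) {L : Type*} [Field K] [Field L] [Algebra K L]
    (c : V7 L →ₗ[L] (Fin 3 → L)) : Set (Submodule K (V7 K)) :=
  {W | ∃ z : Fin 3 → K, z ≠ 0 ∧ W = ptOf K c (emb L z)}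

variable {c : V7 L →ₗ[L] (Fin 3 → L)} {Λ : (Fin 3 → L) →ₗ[L] L}

theorem mem_ptOf {w : Fin 3 → L} {v : V7 K} :
    v ∈ ptOf K c w ↔ ∃ a : L, c (incl K L v) = a • w := by
  change c (incl K L v) ∈ Submodule.span L {w} ↔ _
  rw [Submodule.mem_span_singleton]
  simp_rw [eq_comm]

theorem mem_lnOf {a : (Fin 3 → L) →ₗ[L] L} {v : V7 K} :
    v ∈ lnOf K c a ↔ a (c (incl K L v)) = 0 := Iff.rfl

theorem ptOf_smul {a : L} (ha : a ≠ 0) (w : Fin 3 → L) : ptOf K c (a • w) = ptOf K c w := by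
  rw [ptOf, Submodule.span_singleton_smul_eq (IsUnit.mk0 a ha), ptOf]

theorem exists_common_zero (a b : (Fin 3 → L) →ₗ[L] L) : ∃ w ≠ 0, a w = 0 ∧ b w = 0 := by
  have h : LinearMap.ker (a.prod b) ≠ ⊥ := LinearMap.ker_ne_bot_of_finrank_lt (by simp)
  obtain ⟨w, hw, h0⟩ := (Submodule.ne_bot_iff _).1 h
  rw [LinearMap.mem_ker, LinearMap.prod_apply] at hw
  exact ⟨w, h0, congrArg Prod.fst hw, congrArg Prod.snd hw⟩

theorem exists_functional {F V : Type*} [Field F] [AddCommGroup V] [Module F V]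
    [FiniteDimensional F V] (hV : finrank F V = 3) (w w' : V) :
    ∃ a : V →ₗ[F] F, a ≠ 0 ∧ a w = 0 ∧ a w' = 0 := by
  have h : Submodule.span F (Set.range ![w, w']) < ⊤ := by
    refine lt_top_iff_ne_top.2 fun h => ?_
    have h1 := finrank_range_le_card (R := F) ![w, w']
    rw [Set.finrank, h, finrank_top] at h1
    simp [hV] at h1
  obtain ⟨a, ha, hle⟩ := Submodule.exists_le_ker_of_lt_top _ h
  exact ⟨a, ha, hle (Submodule.subset_span ⟨0, rfl⟩), hle (Submodule.subset_span ⟨1, rfl⟩)⟩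

variable [Finite K] {H : Submodule K (V7 K)} {S : Set (Submodule K (V7 K))}
  {g : Submodule L (V7 L)}

theorem IsCoord.eq_zero (hc : IsCoord H g c Λ) {v : V7 K} (h : c (incl K L v) = 0) : v = 0 := by
  apply incl_injective (L := L)
  rw [map_zero]
  exact hc.inj _ h (by simpa using h) (by simpa using h)

theorem IsCoord.injective (hc : IsCoord H g c Λ) {v v' : V7 K}
    (h : c (incl K L v) = c (incl K L v')) : v = v' := by
  rw [← sub_eq_zero]
  exact hc.eq_zero (by rw [map_sub, map_sub, h, sub_self])

theorem IsCoord.mem_range (hL : finrank K L = 3) (hc : IsCoord H g c Λ) (v : V7 K) :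
    Λ (c (incl K L v)) ∈ Set.range (algebraMap K L) := by
  rw [← phi_eq_self_iff hL, ← hc.map_fr, fr_incl]

theorem IsCoord.exists_mem_ptOf (hc : IsCoord H g c Λ) (w : Fin 3 → L) :
    ∃ v : V7 K, ∃ a : L, a ≠ 0 ∧ c (incl K L v) = a • w := by
  by_cases h : Λ w = 0
  · obtain ⟨v, hv⟩ := hc.surj w ⟨0, by simp [h]⟩
    exact ⟨v, 1, one_ne_zero, by simp [hv]⟩
  · obtain ⟨v, hv⟩ := hc.surj ((Λ w)⁻¹ • w) ⟨1, by simp [h]⟩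
    exact ⟨v, _, inv_ne_zero h, hv⟩

theorem IsCoord.ptOf_eq_of_mem (hc : IsCoord H g c Λ) {v : V7 K} (hv : v ≠ 0) {w : Fin 3 → L}
    (h : v ∈ ptOf K c w) : ptOf K c w = ptOf K c (c (incl K L v)) := by
  obtain ⟨a, ha⟩ := mem_ptOf.1 h
  have ha0 : a ≠ 0 := by
    rintro rfl
    exact hv (hc.eq_zero (by simpa using ha))
  rw [ha, ptOf_smul ha0]

theorem IsCoord.ptOf_eq_iff (hc : IsCoord H g c Λ) {w w' : Fin 3 → L} (hw' : w' ≠ 0) :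
    ptOf K c w = ptOf K c w' ↔ ∃ a : L, a ≠ 0 ∧ w' = a • w := by
  constructor
  · intro h
    obtain ⟨v, a, ha, hv⟩ := hc.exists_mem_ptOf w'
    have hv' : v ∈ ptOf K c w := by rw [h]; exact mem_ptOf.2 ⟨a, hv⟩
    obtain ⟨b, hb⟩ := mem_ptOf.1 hv'
    have h1 : w' = (a⁻¹ * b) • w := by
      rw [mul_smul, ← hb, hv, smul_smul, inv_mul_cancel₀ ha, one_smul]
    refine ⟨_, fun h0 => hw' ?_, h1⟩
    rw [h1, h0, zero_smul]
  · rintro ⟨a, ha, rfl⟩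
    rw [ptOf_smul ha]

theorem IsCoord.ptOf_le_lnOf (hc : IsCoord H g c Λ) (w : Fin 3 → L)
    (a : (Fin 3 → L) →ₗ[L] L) : ptOf K c w ≤ lnOf K c a ↔ a w = 0 := by
  constructor
  · intro h
    obtain ⟨v, b, hb, hv⟩ := hc.exists_mem_ptOf w
    have h1 := mem_lnOf.1 (h (mem_ptOf.2 ⟨b, hv⟩))
    rw [hv, map_smul, smul_eq_mul] at h1
    exact (mul_eq_zero.1 h1).resolve_left hb
  · intro h v hv
    obtain ⟨b, hb⟩ := mem_ptOf.1 hv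
    rw [mem_lnOf, hb, map_smul, h, smul_zero]

theorem IsCoord.lnOf_eq (hc : IsCoord H g c Λ) : lnOf K c Λ = H := by
  ext v
  rw [mem_lnOf, hc.mem_hyperplane]

theorem IsCoord.ptOf_le (hc : IsCoord H g c Λ) (w : Fin 3 → L) : ptOf K c w ≤ H ↔ Λ w = 0 := by
  rw [← hc.ptOf_le_lnOf, hc.lnOf_eq]

theorem IsCoord.ptOf_affine (hL : finrank K L = 3) (hc : IsCoord H g c Λ) {v : V7 K}
    (hv : v ∉ H) : ptOf K c (c (incl K L v)) = Submodule.span K {v} := by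
  ext u
  rw [mem_ptOf, Submodule.mem_span_singleton]
  constructor
  · rintro ⟨a, ha⟩
    rw [hc.mem_hyperplane] at hv
    obtain ⟨x, hx⟩ := hc.mem_range hL v
    obtain ⟨y, hy⟩ := hc.mem_range hL u
    have h1 : a = algebraMap K L (y / x) := by
      rw [map_div₀, hx, hy, ha, map_smul, smul_eq_mul, mul_div_cancel_right₀ _ hv]
    refine ⟨y / x, hc.injective ?_⟩
    rw [map_smul, ha, h1, ← algebraMap_smul L, map_smul]
  · rintro ⟨k, rfl⟩
    exact ⟨algebraMap K L k, by rw [map_smul, ← algebraMap_smul L, map_smul]⟩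

/-- The element of the spread that belongs to a point of the transversal line. -/
theorem IsCoord.rational_span (hL : finrank K L = 3) (hc : IsCoord H g c Λ) {P : V7 L}
    (hP : P ∈ g) :
    rational K (Submodule.span L {P, frob K 1 P, frob K 2 P}) = ptOf K c (c P) := by
  ext v
  change incl K L v ∈ Submodule.span L _ ↔ _
  rw [mem_ptOf, Submodule.mem_span_triple, frob_one, frob_two]
  have hP' := (hc.mem_line P).1 hP
  constructor
  · rintro ⟨x, y, z, h⟩
    exact ⟨x, by rw [← h]; simp [hP']⟩
  · rintro ⟨a, ha⟩
    refine ⟨a, phi K L a, phi K L (phi K L a), ?_⟩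
    rw [← sub_eq_zero]
    have h0 : c (a • P + phi K L a • fr K P + phi K L (phi K L a) • fr K (fr K P) -
        incl K L v) = 0 := by
      rw [map_sub, ha]; simp [hP']
    have h1 : fr K (a • P + phi K L a • fr K P + phi K L (phi K L a) • fr K (fr K P) -
        incl K L v) = a • P + phi K L a • fr K P + phi K L (phi K L a) • fr K (fr K P) -
        incl K L v := by
      rw [sub_eq_add_neg, ← neg_one_smul L (incl K L v)]
      simp only [fr_add, fr_smul, fr_fr_fr hL, phi_phi_phi hL, fr_incl, map_neg, map_one]
      abel
    exact hc.inj _ h0 (by rw [h1, h0]) (by rw [h1, h1, h0])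

theorem IsCoord.map_eq_zero_of_mem (hc : IsCoord H g c Λ) {P : V7 L} (hP : P ∈ g) :
    Λ (c P) = 0 := by
  have h := hc.map_fr P
  rw [((hc.mem_line P).1 hP).1, map_zero] at h
  exact (map_eq_zero _).1 h.symm

theorem IsCoord.eq_zero_of_mem (hc : IsCoord H g c Λ) {P : V7 L} (hP : P ∈ g) (h : c P = 0) :
    P = 0 :=
  hc.inj P h ((hc.mem_line P).1 hP).1 ((hc.mem_line P).1 hP).2

theorem IsCoord.mem_spread (hL : finrank K L = 3) (hc : IsCoord H g c Λ)
    (hS : IsRegularSpread H S g) (W : Submodule K (V7 K)) :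
    W ∈ S ↔ ∃ w, w ≠ 0 ∧ Λ w = 0 ∧ W = ptOf K c w := by
  rw [hS.mem_iff]
  constructor
  · rintro ⟨P, hP, h0, rfl⟩
    exact ⟨c P, fun h => h0 (hc.eq_zero_of_mem hP h), hc.map_eq_zero_of_mem hP,
      hc.rational_span hL hP⟩
  · rintro ⟨w, h0, hw, rfl⟩
    obtain ⟨P, hP, rfl⟩ := hc.surj_line w hw
    exact ⟨P, hP, by rintro rfl; simp at h0, (hc.rational_span hL hP).symm⟩

theorem IsCoord.mem_points (hL : finrank K L = 3) (hc : IsCoord H g c Λ)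
    (hS : IsRegularSpread H S g) (W : Submodule K (V7 K)) :
    W ∈ points H S ↔ ∃ w, w ≠ 0 ∧ W = ptOf K c w := by
  constructor
  · rintro (⟨h1, h2⟩ | hW)
    · obtain ⟨v, hv, h⟩ := finrank_eq_one_iff'.1 h1
      have hW : W = Submodule.span K {(v : V7 K)} := by
        refine le_antisymm (fun u hu => ?_)
          ((Submodule.span_singleton_le_iff_mem _ _).2 v.2)
        obtain ⟨a, ha⟩ := h ⟨u, hu⟩
        exact Submodule.mem_span_singleton.2 ⟨a, congrArg Subtype.val ha⟩
      have hvH : (v : V7 K) ∉ H := fun h => h2 (by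
        rw [hW]; exact (Submodule.span_singleton_le_iff_mem _ _).2 h)
      refine ⟨c (incl K L v), fun h0 => hv (Subtype.ext (hc.eq_zero h0)), ?_⟩
      rw [hc.ptOf_affine hL hvH]
      exact hW
    · obtain ⟨w, h0, -, rfl⟩ := (hc.mem_spread hL hS W).1 hW
      exact ⟨w, h0, rfl⟩
  · rintro ⟨w, h0, rfl⟩
    by_cases h : Λ w = 0
    · exact Or.inr ((hc.mem_spread hL hS _).2 ⟨w, h0, h, rfl⟩)
    · left
      obtain ⟨v, a, ha, hv⟩ := hc.exists_mem_ptOf w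
      have hvH : v ∉ H := by
        rw [hc.mem_hyperplane, hv, map_smul, smul_eq_mul]
        exact mul_ne_zero ha h
      refine ⟨?_, by rwa [hc.ptOf_le]⟩
      rw [← ptOf_smul ha, ← hv, hc.ptOf_affine hL hvH]
      exact finrank_span_singleton (fun h => hvH (h ▸ H.zero_mem))

theorem IsCoord.lnOf_mem_lines (hL : finrank K L = 3) (hc : IsCoord H g c Λ)
    (hS : IsRegularSpread H S g) {a : (Fin 3 → L) →ₗ[L] L} (ha : a ≠ 0) :
    lnOf K c a ∈ lines H S := by
  have hΛ := hc.ne_zero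
  obtain ⟨w', hw'⟩ : ∃ w', Λ w' = 1 := by
    obtain ⟨w, hw⟩ := DFunLike.ne_iff.1 hΛ
    exact ⟨(Λ w)⁻¹ • w, by simpa using inv_mul_cancel₀ hw⟩
  by_cases h : ∃ w, Λ w = 0 ∧ a w ≠ 0
  · left
    obtain ⟨w, hw, haw⟩ := h
    refine ⟨?_, ?_, ?_⟩
    · have hsurj : Function.Surjective
          ((a.restrictScalars K) ∘ₗ (c.restrictScalars K ∘ₗ incl K L)) := by
        intro x
        obtain ⟨v, hv⟩ := hc.surj ((x / a w) • w) ⟨0, by simp [hw]⟩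
        refine ⟨v, ?_⟩
        change a (c (incl K L v)) = x
        rw [hv, map_smul, smul_eq_mul, div_mul_cancel₀ _ haw]
      have h1 := LinearMap.finrank_range_add_finrank_ker
        ((a.restrictScalars K) ∘ₗ (c.restrictScalars K ∘ₗ incl K L))
      rw [LinearMap.range_eq_top.2 hsurj, finrank_top, hL, finrank_fin_fun] at h1
      have h2 : lnOf K c a =
        LinearMap.ker ((a.restrictScalars K) ∘ₗ (c.restrictScalars K ∘ₗ incl K L)) := rfl
      rw [h2]
      omega
    · obtain ⟨v, hv⟩ := hc.surj (w' - (a w' / a w) • w) ⟨1, by simp [hw', hw]⟩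
      intro hle
      have h1 : v ∈ lnOf K c a := by
        rw [mem_lnOf, hv, map_sub, map_smul, smul_eq_mul, div_mul_cancel₀ _ haw, sub_self]
      have h2 := (hc.mem_hyperplane v).1 (hle h1)
      rw [hv] at h2
      simp [hw', hw] at h2
    · obtain ⟨u, hu, h1, h2⟩ := exists_common_zero Λ a
      exact ⟨ptOf K c u, (hc.mem_spread hL hS _).2 ⟨u, hu, h1, rfl⟩,
        (hc.ptOf_le_lnOf u a).2 h2⟩
  · right
    push Not at h
    have h1 : ∀ w, a w = a w' * Λ w := by
      intro w
      have := h (w - Λ w • w') (by simp [hw'])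
      rw [map_sub, map_smul, smul_eq_mul, sub_eq_zero] at this
      rw [this, mul_comm]
    have h2 : a w' ≠ 0 := fun h2 =>
      ha (LinearMap.ext fun w => by rw [h1, h2, zero_mul, LinearMap.zero_apply])
    rw [← hc.lnOf_eq]
    ext v
    rw [mem_lnOf, mem_lnOf, h1, mul_eq_zero]
    simp [h2]

theorem IsCoord.mem_lines (hL : finrank K L = 3) (hc : IsCoord H g c Λ)
    (hS : IsRegularSpread H S g) (M : Submodule K (V7 K)) :
    M ∈ lines H S ↔ ∃ a, a ≠ 0 ∧ M = lnOf K c a := by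
  constructor
  · rintro (⟨h4, hMH, W, hW, hWM⟩ | rfl)
    · obtain ⟨hWH, h3⟩ := hS.plane W hW
      obtain ⟨t, htM, htH⟩ := SetLike.not_le_iff_exists.1 hMH
      obtain ⟨w, -, -, rfl⟩ := (hc.mem_spread hL hS W).1 hW
      obtain ⟨a, ha, haw, hat⟩ :=
        exists_functional (F := L) (by rw [finrank_fin_fun]) w (c (incl K L t))
      have hle : M ≤ lnOf K c a := by
        intro v hv
        obtain ⟨k, hk⟩ := exists_smul_sub_mem hWM (by omega) htM (fun h => htH (hWH h)) hv
        have h1 := (hc.ptOf_le_lnOf w a).2 haw hk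
        have h2 : k • t ∈ lnOf K c a := Submodule.smul_mem _ _ hat
        simpa using Submodule.add_mem _ h1 h2
      refine ⟨a, ha, Submodule.eq_of_le_of_finrank_le hle ?_⟩
      rcases hc.lnOf_mem_lines hL hS ha with h | h
      · rw [h.1, h4]
      · exact absurd (h ▸ hle) hMH
    · exact ⟨Λ, hc.ne_zero, hc.lnOf_eq.symm⟩
  · rintro ⟨a, ha, rfl⟩
    exact hc.lnOf_mem_lines hL hS ha

theorem two_le_finrank_of_ne (hc : IsCoord H g c Λ) {a : (Fin 3 → L) →ₗ[L] L}
    {P Q : Submodule K (V7 K)} (hP : P ∈ stdSubplane K c) (hQ : Q ∈ stdSubplane K c)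
    (hPQ : P ≠ Q) (hPa : P ≤ lnOf K c a) (hQa : Q ≤ lnOf K c a) :
    2 ≤ finrank K (((LinearMap.ker a).restrictScalars K).comap
      ((Algebra.linearMap K L).compLeft (Fin 3))) := by
  obtain ⟨z, hz, rfl⟩ := hP
  obtain ⟨z', hz', rfl⟩ := hQ
  rw [hc.ptOf_le_lnOf] at hPa hQa
  have hli : LinearIndependent K ![z, z'] := by
    rw [LinearIndependent.pair_iff' hz]
    rintro k rfl
    apply hPQ
    have hk : algebraMap K L k ≠ 0 := by
      intro h
      apply hz'
      rw [(map_eq_zero _).1 h, zero_smul]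
    rw [emb_smul, ptOf_smul hk]
  have h1 : Submodule.span K (Set.range ![z, z']) ≤
      ((LinearMap.ker a).restrictScalars K).comap
      ((Algebra.linearMap K L).compLeft (Fin 3)) := by
    rw [Submodule.span_le]
    rintro _ ⟨i, rfl⟩
    fin_cases i
    · exact hPa
    · exact hQa
  have h2 := Submodule.finrank_mono h1
  rwa [finrank_span_eq_card hli, Fintype.card_fin] at h2

theorem ncard_stdSubplane (hc : IsCoord H g c Λ) :
    (stdSubplane K c).ncard = Nat.card K ^ 2 + Nat.card K + 1 := by
  let f : ℙ K (Fin 3 → K) → Submodule K (V7 K) := fun p => ptOf K c (emb L p.rep)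
  have hf : Function.Injective f := by
    intro p p' h
    obtain ⟨a, -, h'⟩ := (hc.ptOf_eq_iff (emb_ne_zero p'.rep_nonzero)).1 h
    obtain ⟨k, -, hk⟩ := exists_of_emb_eq_smul p.rep_nonzero h'
    rw [← p.mk_rep, ← p'.mk_rep]
    exact ((Projectivization.mk_eq_mk_iff' K _ _ _ _).2 ⟨k, hk.symm⟩).symm
  have hr : stdSubplane K c = Set.range f := by
    ext W
    constructor
    · rintro ⟨z, hz, rfl⟩
      refine ⟨Projectivization.mk K z hz, ?_⟩
      obtain ⟨k, hk⟩ := Projectivization.exists_smul_eq_mk_rep K z hz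
      change ptOf K c (emb L (Projectivization.mk K z hz).rep) = _
      rw [← hk, Units.smul_def, emb_smul, ptOf_smul (by simp)]
    · rintro ⟨p, rfl⟩
      exact ⟨p.rep, p.rep_nonzero, rfl⟩
  rw [hr, Set.ncard_range_of_injective hf,
    Projectivization.card_of_finrank K (Fin 3 → K) (n := 3) (by simp)]
  simp [Finset.sum_range_succ]
  ring

theorem isSubplane_stdSubplane (hL : finrank K L = 3) (hc : IsCoord H g c Λ)
    (hS : IsRegularSpread H S g) : IsSubplane H S (Nat.card K) (stdSubplane K c) where
  subset := by
    rintro _ ⟨z, hz, rfl⟩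
    exact (hc.mem_points hL hS _).2 ⟨_, emb_ne_zero hz, rfl⟩
  quadrangle := by
    let z : Fin 4 → Fin 3 → K := ![Pi.single 0 1, Pi.single 1 1, Pi.single 2 1, 1]
    refine ⟨fun i => ptOf K c (emb L (z i)), fun i => ⟨z i, ?_, rfl⟩, ?_⟩
    · fin_cases i <;> simp [z]
    · intro i j k hij hjk hik l hl
      obtain ⟨a, ha, rfl⟩ := (hc.mem_lines hL hS l).1 hl
      simp only [hc.ptOf_le_lnOf]
      have h : ∀ i, a (emb L (z i)) = ![a (Pi.single 0 1), a (Pi.single 1 1),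
          a (Pi.single 2 1), a (Pi.single 0 1) + a (Pi.single 1 1) + a (Pi.single 2 1)] i := by
        have he : ∀ j : Fin 3, emb L (Pi.single j (1 : K)) = Pi.single j 1 := by
          intro j
          ext m
          by_cases hm : m = j <;> simp [hm]
        intro i
        fin_cases i
        · simp [z, he]
        · simp [z, he]
        · simp [z, he]
        · simp only [z]
          simp only [← map_add]
          congr 1
          ext m
          fin_cases m <;> simp
      rw [h, h, h]
      rintro ⟨h1, h2, h3⟩
      have : a (Pi.single 0 1) = 0 ∧ a (Pi.single 1 1) = 0 ∧ a (Pi.single 2 1) = 0 := by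
        fin_cases i <;> fin_cases j <;> fin_cases k <;> simp_all
      apply ha
      ext m
      fin_cases m <;> simp [this]
  meet := by
    rintro l hl m hm - ⟨P, hP, Q, hQ, hPQ, hPl, hQl⟩ ⟨P', hP', Q', hQ', hPQ', hPm, hQm⟩
    obtain ⟨a, -, rfl⟩ := (hc.mem_lines hL hS l).1 hl
    obtain ⟨b, -, rfl⟩ := (hc.mem_lines hL hS m).1 hm
    have h1 := two_le_finrank_of_ne hc hP hQ hPQ hPl hQl
    have h2 := two_le_finrank_of_ne hc hP' hQ' hPQ' hPm hQm
    have h3 := Submodule.finrank_sup_add_finrank_inf_eq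
      (((LinearMap.ker a).restrictScalars K).comap ((Algebra.linearMap K L).compLeft (Fin 3)))
      (((LinearMap.ker b).restrictScalars K).comap ((Algebra.linearMap K L).compLeft (Fin 3)))
    have h4 := Submodule.finrank_le
      ((((LinearMap.ker a).restrictScalars K).comap ((Algebra.linearMap K L).compLeft (Fin 3))) ⊔
      (((LinearMap.ker b).restrictScalars K).comap ((Algebra.linearMap K L).compLeft (Fin 3))))
    rw [finrank_fin_fun] at h4
    obtain ⟨z, hz, h0⟩ := (Submodule.ne_bot_iff _).1
      (Submodule.one_le_finrank_iff.1 (by omega : 1 ≤ finrank K ↥(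
      (((LinearMap.ker a).restrictScalars K).comap ((Algebra.linearMap K L).compLeft (Fin 3))) ⊓
      (((LinearMap.ker b).restrictScalars K).comap ((Algebra.linearMap K L).compLeft (Fin 3))))))
    exact ⟨_, ⟨z, h0, rfl⟩, (hc.ptOf_le_lnOf _ a).2 hz.1, (hc.ptOf_le_lnOf _ b).2 hz.2⟩
  card := ncard_stdSubplane hc

end Geometry

/-! ### Subplanes of order `q` -/

section Subplanes

open Matrix

variable {K L : Type*} [Field K] [Finite K] [Field L] [Algebra K L]
  {c : V7 L →ₗ[L] (Fin 3 → L)} {Λ : (Fin 3 → L) →ₗ[L] L}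
  {H : Submodule K (V7 K)} {S : Set (Submodule K (V7 K))} {g : Submodule L (V7 L)}
  {B : Set (Submodule K (V7 K))}

theorem ptOf_trans {K L : Type*} [Field K] [Field L] [Algebra K L]
    {c : V7 L →ₗ[L] (Fin 3 → L)} (M : (Fin 3 → L) ≃ₗ[L] (Fin 3 → L)) (w : Fin 3 → L) :
    ptOf K (M.symm.toLinearMap ∘ₗ c) w = ptOf K c (M w) := by
  ext v
  rw [mem_ptOf, mem_ptOf]
  refine exists_congr fun a => ?_
  rw [← map_smul]
  exact M.symm_apply_eq

/-- The vertices of a quadrangle can be given the coordinates of the standard frame. -/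
theorem exists_isCoord_frame (hL : finrank K L = 3) (hc : IsCoord H g c Λ)
    (hS : IsRegularSpread H S g) {n : ℕ} (hB : IsSubplane H S n B) :
    ∃ (c' : V7 L →ₗ[L] (Fin 3 → L)) (Λ' : (Fin 3 → L) →ₗ[L] L), IsCoord H g c' Λ' ∧
      (∀ i, ptOf K c' (Pi.single i 1) ∈ B) ∧ ptOf K c' 1 ∈ B := by
  obtain ⟨A, hAB, hA⟩ := hB.quadrangle
  have h1 : ∀ i, ∃ w, w ≠ 0 ∧ A i = ptOf K c w := fun i =>
    (hc.mem_points hL hS _).1 (hB.subset (hAB i))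
  choose w hw0 hw using h1
  have hno : ∀ i j k, i ≠ j → j ≠ k → i ≠ k → ∀ a : (Fin 3 → L) →ₗ[L] L,
      a (w i) = 0 → a (w j) = 0 → a (w k) = 0 → a = 0 := by
    intro i j k hij hjk hik a hi hj hk
    by_contra ha
    apply hA i j k hij hjk hik _ (hc.lnOf_mem_lines hL hS ha)
    simp only [hw, hc.ptOf_le_lnOf]
    exact ⟨hi, hj, hk⟩
  have hspan : ⊤ ≤ Submodule.span L (Set.range ![w 0, w 1, w 2]) := by
    by_contra h
    obtain ⟨a, ha, hle⟩ := Submodule.exists_le_ker_of_lt_top _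
      (lt_top_iff_ne_top.2 fun h' => h h'.ge)
    exact ha (hno 0 1 2 (by decide) (by decide) (by decide) a
      (hle (Submodule.subset_span ⟨0, rfl⟩)) (hle (Submodule.subset_span ⟨1, rfl⟩))
      (hle (Submodule.subset_span ⟨2, rfl⟩)))
  let b : Basis (Fin 3) L (Fin 3 → L) := basisOfTopLeSpanOfCardEqFinrank _ hspan (by simp)
  have hb : ∀ i, b i = ![w 0, w 1, w 2] i := fun i => by simp [b]
  have hr : ∀ i, b.repr (w 3) i ≠ 0 := by
    intro i hi
    have h0 : b.coord i = 0 := by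
      have hb0 : b 0 = w 0 := hb 0
      have hb1 : b 1 = w 1 := hb 1
      have hb2 : b 2 = w 2 := hb 2
      fin_cases i
      · exact hno 1 2 3 (by decide) (by decide) (by decide) _ (by rw [← hb1]; simp)
          (by rw [← hb2]; simp) hi
      · exact hno 0 2 3 (by decide) (by decide) (by decide) _ (by rw [← hb0]; simp)
          (by rw [← hb2]; simp) hi
      · exact hno 0 1 3 (by decide) (by decide) (by decide) _ (by rw [← hb0]; simp)
          (by rw [← hb1]; simp) hi
    have h1 := LinearMap.congr_fun h0 (b i)
    simp at h1
  let b' := b.isUnitSMul (w := fun i => b.repr (w 3) i) fun i => IsUnit.mk0 _ (hr i)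
  let M : (Fin 3 → L) ≃ₗ[L] (Fin 3 → L) := b'.equivFun.symm
  have hM : ∀ i, M (Pi.single i 1) = b.repr (w 3) i • b i := by
    intro i
    simp only [M, Basis.equivFun_symm_apply]
    rw [Finset.sum_eq_single i]
    · simp [b', Basis.isUnitSMul_apply]
    · intro j _ hj
      simp [hj]
    · simp
  refine ⟨_, _, hc.trans M, fun i => ?_, ?_⟩
  · rw [ptOf_trans, hM, ptOf_smul (hr i), hb]
    fin_cases i
    · exact hw 0 ▸ hAB 0
    · exact hw 1 ▸ hAB 1
    · exact hw 2 ▸ hAB 2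
  · have : M 1 = w 3 := by
      simp only [M, Basis.equivFun_symm_apply, b', Basis.isUnitSMul_apply, Pi.one_apply, one_smul]
      exact b.sum_repr (w 3)
    rw [ptOf_trans, this, ← hw]
    exact hAB 3

theorem dotProduct_cross_self_left {R : Type*} [CommRing R] (v w : Fin 3 → R) :
    (v ⨯₃ w) ⬝ᵥ v = 0 := by
  rw [dotProduct_comm, dot_self_cross]

theorem dotProduct_cross_self_right {R : Type*} [CommRing R] (v w : Fin 3 → R) :
    (v ⨯₃ w) ⬝ᵥ w = 0 := by
  rw [dotProduct_comm, dot_cross_self]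

/-- A subplane contains the intersection of two joins of its points, as given by cross products. -/
theorem ptOf_mem_of_cross (hL : finrank K L = 3) (hc : IsCoord H g c Λ)
    (hS : IsRegularSpread H S g) {n : ℕ} (hB : IsSubplane H S n B) {z₁ z₂ z₃ z₄ z : Fin 3 → L}
    (h₁ : ptOf K c z₁ ∈ B) (h₂ : ptOf K c z₂ ∈ B) (h₃ : ptOf K c z₃ ∈ B) (h₄ : ptOf K c z₄ ∈ B)
    {a : L} (ha : a ≠ 0) (hz : z ≠ 0) (h : (z₁ ⨯₃ z₂) ⨯₃ (z₃ ⨯₃ z₄) = a • z) :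
    ptOf K c z ∈ B := by
  have hne : (z₁ ⨯₃ z₂) ⨯₃ (z₃ ⨯₃ z₄) ≠ 0 := by
    rw [h]
    exact smul_ne_zero ha hz
  have key : ∀ {x y : Fin 3 → L}, x ⨯₃ y ≠ 0 → x ≠ 0 ∧ y ≠ 0 ∧ ptOf K c x ≠ ptOf K c y := by
    intro x y hxy
    have hx : x ≠ 0 := by rintro rfl; simp at hxy
    have hy : y ≠ 0 := by rintro rfl; simp at hxy
    refine ⟨hx, hy, fun h => ?_⟩
    obtain ⟨a, -, rfl⟩ := (hc.ptOf_eq_iff hy).1 h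
    rw [map_smul, cross_self, smul_zero] at hxy
    exact hxy rfl
  have h12 : z₁ ⨯₃ z₂ ≠ 0 := by intro h0; rw [h0] at hne; simp at hne
  have h34 : z₃ ⨯₃ z₄ ≠ 0 := by intro h0; rw [h0] at hne; simp at hne
  have hfun : ∀ {x : Fin 3 → L}, x ≠ 0 → (dotProductBilin L L x : (Fin 3 → L) →ₗ[L] L) ≠ 0 := by
    intro x hx h
    apply hx
    ext i
    have := LinearMap.congr_fun h (Pi.single i 1)
    simpa using this
  have hl : ∀ x y : Fin 3 → L, ptOf K c y ≤ lnOf K c (dotProductBilin L L x) ↔ x ⬝ᵥ y = 0 :=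
    fun x y => hc.ptOf_le_lnOf _ _
  obtain ⟨P, hP, hPl, hPm⟩ := hB.meet _ (hc.lnOf_mem_lines hL hS (hfun h12)) _
    (hc.lnOf_mem_lines hL hS (hfun h34)) (by
      intro heq
      have hab := key hne
      -- the two lines are distinct, since otherwise every point of one is on the other
      have hall : ∀ y, (z₁ ⨯₃ z₂) ⬝ᵥ y = 0 ↔ (z₃ ⨯₃ z₄) ⬝ᵥ y = 0 := fun y => by
        rw [← hl, ← hl, heq]
      rcases Configuration.ofField.crossProduct_eq_zero_of_dotProduct_eq_zero ((hall z₁).1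
        (dotProduct_cross_self_left _ _)) (dotProduct_cross_self_left z₁ z₂)
        ((hall z₂).1 (dotProduct_cross_self_right _ _)) (dotProduct_cross_self_right z₁ z₂)
        with h0 | h0
      · rw [← cross_anticomm, h0, neg_zero] at hne
        exact hne rfl
      · exact h12 h0)
    ⟨_, h₁, _, h₂, (key h12).2.2, (hl _ _).2 (dotProduct_cross_self_left _ _),
      (hl _ _).2 (dotProduct_cross_self_right _ _)⟩
    ⟨_, h₃, _, h₄, (key h34).2.2, (hl _ _).2 (dotProduct_cross_self_left _ _),
      (hl _ _).2 (dotProduct_cross_self_right _ _)⟩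
  obtain ⟨y, hy0, rfl⟩ := (hc.mem_points hL hS P).1 (hB.subset hP)
  rw [hl] at hPl hPm
  have h0 : ((z₁ ⨯₃ z₂) ⨯₃ (z₃ ⨯₃ z₄)) ⨯₃ y = 0 := by
    refine (Configuration.ofField.crossProduct_eq_zero_of_dotProduct_eq_zero
      (a := z₁ ⨯₃ z₂) (b := z₃ ⨯₃ z₄) ?_ ?_ hPl hPm).resolve_left hne
    · exact dot_self_cross _ _
    · exact dot_cross_self _ _
  rw [h] at h0
  by_cases hyz : ptOf K c z = ptOf K c y
  · rw [hyz]; exact hP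
  · exfalso
    rw [map_smul, LinearMap.smul_apply, smul_eq_zero] at h0
    have h1 : ¬ LinearIndependent L ![z, y] := fun h2 =>
      crossProduct_ne_zero_iff_linearIndependent.2 h2 (h0.resolve_left ha)
    rw [LinearIndependent.pair_iff' hz] at h1
    push Not at h1
    obtain ⟨b, rfl⟩ := h1
    exact hyz (ptOf_smul (by rintro rfl; simp at hy0) z).symm

/-- A finite set of field elements that is closed under multiplication consists of zeros of
`x ^ n - x`, where `n` is its size: multiplication by a nonzero element permutes the nonzero
elements. -/
theorem pow_card_of_mul_closed {F : Finset L} (h0 : (0 : L) ∈ F)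
    (hmul : ∀ s ∈ F, ∀ t ∈ F, s * t ∈ F) {t : L} (ht : t ∈ F) : t ^ F.card = t := by
  classical
  by_cases ht0 : t = 0
  · rw [ht0, zero_pow (Finset.card_pos.2 ⟨0, h0⟩).ne']
  have himg : (F.erase 0).image (fun x => t * x) = F.erase 0 := by
    apply Finset.eq_of_subset_of_card_le
    · intro x hx
      obtain ⟨y, hy, rfl⟩ := Finset.mem_image.1 hx
      rw [Finset.mem_erase] at hy ⊢
      exact ⟨mul_ne_zero ht0 hy.1, hmul _ ht _ hy.2⟩
    · rw [Finset.card_image_of_injective _ (mul_right_injective₀ ht0)]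
  have hprod : ∏ x ∈ F.erase 0, x = t ^ (F.erase 0).card * ∏ x ∈ F.erase 0, x := by
    conv_lhs => rw [← himg, Finset.prod_image fun x _ y _ h => mul_right_injective₀ ht0 h]
    rw [Finset.prod_mul_distrib, Finset.prod_const]
  have hne : ∏ x ∈ F.erase 0, x ≠ 0 := Finset.prod_ne_zero_iff.2 fun x hx =>
    Finset.ne_of_mem_erase hx
  have h1 : t ^ (F.erase 0).card = 1 := by
    have := mul_right_cancel₀ hne ((one_mul _).trans hprod)
    exact this.symm
  rw [← Finset.card_erase_add_one h0, pow_succ, h1, one_mul]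

/-- The vectors of the points with entries in `F`, in normal form. -/
def frameVec (F : Set L) : Option (F ⊕ F × F) → Fin 3 → L
  | none => ![0, 0, 1]
  | some (Sum.inl t) => ![0, 1, t]
  | some (Sum.inr (s, t)) => ![1, s, t]

theorem frameVec_ne_zero (F : Set L) (x : Option (F ⊕ F × F)) : frameVec F x ≠ 0 := by
  intro h
  have h0 := congrFun h 0
  have h1 := congrFun h 1
  have h2 := congrFun h 2
  rcases x with _ | t | ⟨s, t⟩ <;> simp_all [frameVec]

theorem frameVec_injective (F : Set L) {x y : Option (F ⊕ F × F)} {a : L}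
    (h : frameVec F y = a • frameVec F x) : x = y := by
  have h0 := congrFun h 0
  have h1 := congrFun h 1
  have h2 := congrFun h 2
  rcases x with _ | t | ⟨s, t⟩ <;> rcases y with _ | t' | ⟨s', t'⟩ <;>
    simp only [frameVec, Pi.smul_apply, smul_eq_mul, Matrix.cons_val_zero, Matrix.cons_val_one,
      Matrix.cons_val, mul_zero, mul_one] at h0 h1 h2
  all_goals
    first
    | rfl
    | exact absurd h0 one_ne_zero
    | exact absurd h1 one_ne_zero
    | (subst h0; rw [zero_mul] at h1; exact absurd h1 one_ne_zero)
    | (subst h0; rw [zero_mul] at h2; exact absurd h2 one_ne_zero)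
    | (subst h1; rw [zero_mul] at h2; exact absurd h2 one_ne_zero)
    | (subst h0; rw [one_mul] at h1 h2; rw [Subtype.ext h1, Subtype.ext h2])
    | (subst h1; rw [one_mul] at h2; rw [Subtype.ext h2])

/-- A subplane of order `q` that contains the standard frame is `PG(2, K)`: the coordinates of its
points form a set `F` closed under multiplication; counting points gives `|F| = q`, hence
`F = K`. -/
theorem eq_stdSubplane (hL : finrank K L = 3) (hc : IsCoord H g c Λ)
    (hS : IsRegularSpread H S g) (hB : IsSubplane H S (Nat.card K) B)
    (he : ∀ i, ptOf K c (Pi.single i 1) ∈ B) (hu : ptOf K c 1 ∈ B) : B = stdSubplane K c := by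
  classical
  have : Finite L := finite_of_finrank_eq_three hL
  let := Fintype.ofFinite L
  have e0 : ptOf K c ![1, 0, 0] ∈ B := by
    convert he 0 using 2; ext i; fin_cases i <;> simp
  have e1 : ptOf K c ![0, 1, 0] ∈ B := by
    convert he 1 using 2; ext i; fin_cases i <;> simp
  have e2 : ptOf K c ![0, 0, 1] ∈ B := by
    convert he 2 using 2; ext i; fin_cases i <;> simp
  have eu : ptOf K c ![1, 1, 1] ∈ B := by
    convert hu using 2; ext i; fin_cases i <;> simp
  have meet : ∀ {z₁ z₂ z₃ z₄ : Fin 3 → L} (z : Fin 3 → L), ptOf K c z₁ ∈ B → ptOf K c z₂ ∈ B →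
      ptOf K c z₃ ∈ B → ptOf K c z₄ ∈ B → z ≠ 0 →
      ((z₁ ⨯₃ z₂) ⨯₃ (z₃ ⨯₃ z₄) = z ∨ (z₁ ⨯₃ z₂) ⨯₃ (z₃ ⨯₃ z₄) = -z) →
      ptOf K c z ∈ B := by
    rintro z₁ z₂ z₃ z₄ z h₁ h₂ h₃ h₄ hz (h | h)
    · exact ptOf_mem_of_cross hL hc hS hB h₁ h₂ h₃ h₄ one_ne_zero hz (by rw [h, one_smul])
    · exact ptOf_mem_of_cross hL hc hS hB h₁ h₂ h₃ h₄ (neg_ne_zero.2 one_ne_zero) hz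
        (by rw [h, neg_one_smul])
  -- `F` is the affine part of the side `x 2 = 0` of the frame
  let F : Set L := {t | ptOf K c ![1, t, 0] ∈ B}
  have hy : ∀ {t}, t ∈ F → ptOf K c ![1, 0, t] ∈ B := fun {t} ht =>
    meet _ e1 (meet ![1, t, t] e2 ht e0 eu (by simp) (by simp [cross_apply])) e0 e2
      (by simp) (by simp [cross_apply])
  have hst : ∀ {s t}, s ∈ F → t ∈ F → ptOf K c ![1, s, t] ∈ B := fun {s t} hs ht =>
    meet _ e2 hs e1 (hy ht) (by simp) (by simp [cross_apply])
  have hs : ∀ {s t}, ptOf K c ![1, s, t] ∈ B → s ∈ F := fun {s t} h =>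
    meet _ e2 h e0 e1 (by simp) (by simp [cross_apply])
  have ht : ∀ {s t}, ptOf K c ![1, s, t] ∈ B → t ∈ F := fun {s t} h =>
    hs (meet ![1, t, t] e1 h e0 eu (by simp) (by simp [cross_apply]))
  have h0 : (0 : L) ∈ F := e0
  have h1 : (1 : L) ∈ F := hs eu
  have hinf : ∀ {t}, t ∈ F → ptOf K c ![0, 1, t] ∈ B := fun {t} ht =>
    meet _ e0 (hst h1 ht) e1 e2 (by simp) (by simp [cross_apply])
  have hinf' : ∀ {t}, ptOf K c ![0, 1, t] ∈ B → t ∈ F := fun {t} h =>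
    ht (meet ![1, 1, t] e0 h e2 h1 (by simp) (by simp [cross_apply]))
  have hmul : ∀ {s t}, s ∈ F → t ∈ F → s * t ∈ F := fun {s t} hs ht' =>
    ht (meet ![1, s, s * t] e0 (hinf ht') e2 hs (by simp)
      (by simp [cross_apply, mul_comm]))
  have hBF : B = Set.range fun x => ptOf K c (frameVec F x) := by
    apply Set.Subset.antisymm
    · intro W hW
      obtain ⟨z, hz, rfl⟩ := (hc.mem_points hL hS W).1 (hB.subset hW)
      by_cases hz0 : z 0 = 0
      · by_cases hz1 : z 1 = 0
        · have hz2 : z 2 ≠ 0 := fun hz2 => hz (by ext i; fin_cases i <;> simp [hz0, hz1, hz2])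
          have h : z = z 2 • ![0, 0, 1] := by ext i; fin_cases i <;> simp [hz0, hz1]
          rw [h, ptOf_smul hz2]
          exact ⟨none, rfl⟩
        · have h : z = z 1 • ![0, 1, z 2 / z 1] := by
            ext i; fin_cases i <;> simp [hz0]; field_simp
          rw [h, ptOf_smul hz1] at hW ⊢
          exact ⟨some (Sum.inl ⟨_, hinf' hW⟩), rfl⟩
      · have h : z = z 0 • ![1, z 1 / z 0, z 2 / z 0] := by
          ext i; fin_cases i <;> simp <;> field_simp
        rw [h, ptOf_smul hz0] at hW ⊢
        exact ⟨some (Sum.inr (⟨_, hs hW⟩, ⟨_, ht hW⟩)), rfl⟩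
    · rintro _ ⟨_ | t | ⟨s, t⟩, rfl⟩
      · exact e2
      · exact hinf t.2
      · exact hst s.2 t.2
  have hcard := hB.card
  rw [hBF, Set.ncard_range_of_injective (fun x y h => by
    obtain ⟨a, -, h⟩ := (hc.ptOf_eq_iff (frameVec_ne_zero F y)).1 h
    exact frameVec_injective F h)] at hcard
  rw [Nat.card_eq_fintype_card, Fintype.card_option, Fintype.card_sum, Fintype.card_prod] at hcard
  have hq : F.toFinset.card = Nat.card K := by
    rw [Set.toFinset_card]
    nlinarith
  have hFK : ∀ t ∈ F, ∃ k : K, algebraMap K L k = t := by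
    intro t ht
    refine (phi_eq_self_iff (K := K) hL).1 ?_
    rw [phi_apply, ← hq]
    exact pow_card_of_mul_closed (by simpa using h0)
      (fun s hs t ht => by simpa using hmul (by simpa using hs) (by simpa using ht))
      (by simpa using ht)
  have hfin : (stdSubplane K c).Finite := Set.finite_of_ncard_ne_zero (by
    rw [ncard_stdSubplane hc]; omega)
  refine Set.eq_of_subset_of_ncard_le ?_ (by rw [ncard_stdSubplane hc, hB.card]) hfin
  rw [hBF]
  rintro _ ⟨_ | ⟨t, ht⟩ | ⟨⟨s, hs⟩, ⟨t, ht⟩⟩, rfl⟩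
  · refine ⟨![0, 0, 1], by simp, congrArg _ ?_⟩
    ext i; fin_cases i <;> simp [frameVec]
  · obtain ⟨k, rfl⟩ := hFK t ht
    refine ⟨![0, 1, k], by simp, congrArg _ ?_⟩
    ext i; fin_cases i <;> simp [frameVec]
  · obtain ⟨k, rfl⟩ := hFK t ht
    obtain ⟨l, rfl⟩ := hFK s hs
    refine ⟨![1, l, k], by simp, congrArg _ ?_⟩
    ext i; fin_cases i <;> simp [frameVec]

/-- Every subplane of order `q` is `PG(2, K)` in suitable coordinates. -/
theorem exists_isCoord_eq_stdSubplane (hL : finrank K L = 3) (hc : IsCoord H g c Λ)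
    (hS : IsRegularSpread H S g) (hB : IsSubplane H S (Nat.card K) B) :
    ∃ (c' : V7 L →ₗ[L] (Fin 3 → L)) (Λ' : (Fin 3 → L) →ₗ[L] L), IsCoord H g c' Λ' ∧
      B = stdSubplane K c' := by
  obtain ⟨c', Λ', hc', he, hu⟩ := exists_isCoord_frame hL hc hS hB
  exact ⟨c', Λ', hc', eq_stdSubplane hL hc' hS hB he hu⟩

/-- Any point of `PG(2, K)` can be given the coordinates `(0, 0, 1)`. -/
theorem exists_isCoord_point (hc : IsCoord H g c Λ) {z : Fin 3 → K} (hz : z ≠ 0) :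
    ∃ (c' : V7 L →ₗ[L] (Fin 3 → L)) (Λ' : (Fin 3 → L) →ₗ[L] L), IsCoord H g c' Λ' ∧
      stdSubplane K c' = stdSubplane K c ∧ ptOf K c' ![0, 0, 1] = ptOf K c (emb L z) ∧
      Λ' ![0, 0, 1] = Λ (emb L z) := by
  obtain ⟨j, hj⟩ := Function.ne_iff.1 hz
  have hj : z j ≠ 0 := hj
  have hj' : algebraMap K L (z j) ≠ 0 := by simpa using hj
  -- the linear map that fixes the unit vectors other than `e j` and `e 2`, and takes `e 2` to `z`
  -- and `e j` to `e 2` (if `j ≠ 2`)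
  let f : (Fin 3 → L) →ₗ[L] (Fin 3 → L) :=
    { toFun := fun x => (fun i => x (Equiv.swap 2 j i)) + x 2 • (emb L z - Pi.single j 1)
      map_add' := fun x y => by ext i; simp; ring
      map_smul' := fun a x => by ext i; simp; ring }
  have hf : ∀ x i, f x i = x (Equiv.swap 2 j i) +
      x 2 * (algebraMap K L (z i) - (Pi.single j 1 : Fin 3 → L) i) := fun x i => rfl
  have hinj : Function.Injective f := by
    rw [injective_iff_map_eq_zero]
    intro x hx
    have h2 : x 2 = 0 := by
      have := congrFun hx j
      rw [hf, Equiv.swap_apply_right, Pi.single_eq_same, Pi.zero_apply] at this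
      have h : x 2 * algebraMap K L (z j) = 0 := by linear_combination this
      exact (mul_eq_zero.1 h).resolve_right hj'
    ext i
    have := congrFun hx (Equiv.swap 2 j i)
    rw [hf, h2, zero_mul, add_zero, Equiv.swap_apply_self] at this
    exact this
  let M : (Fin 3 → L) ≃ₗ[L] (Fin 3 → L) := LinearEquiv.ofInjectiveEndo f hinj
  have hM : ∀ x, M x = f x := fun x => rfl
  have hM2 : M ![0, 0, 1] = emb L z := by
    rw [hM]
    ext i
    rw [hf]
    fin_cases j <;> fin_cases i <;> simp [Equiv.swap_apply_def]
  refine ⟨_, _, hc.trans M, ?_, ?_, ?_⟩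
  · have hle : stdSubplane K (M.symm.toLinearMap ∘ₗ c) ⊆ stdSubplane K c := by
      rintro _ ⟨y, hy, rfl⟩
      let y' : Fin 3 → K := fun i => y (Equiv.swap 2 j i) +
        y 2 * (z i - (Pi.single j 1 : Fin 3 → K) i)
      have h1 : M (emb L y) = emb L y' := by
        rw [hM]
        ext i
        rw [hf]
        by_cases hi : i = j <;> simp [y', hi]
      refine ⟨y', fun h => ?_, ?_⟩
      · rw [h, emb_zero] at h1
        exact emb_ne_zero hy (M.map_eq_zero_iff.1 h1)
      · rw [ptOf_trans, h1]
    refine Set.eq_of_subset_of_ncard_le hle ?_ (Set.finite_of_ncard_ne_zero ?_)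
    · rw [ncard_stdSubplane hc, ncard_stdSubplane (hc.trans M)]
    · rw [ncard_stdSubplane hc]; omega
  · rw [ptOf_trans, hM2]
  · simp only [LinearMap.comp_apply]
    exact congrArg Λ hM2

end Subplanes

/-! ### Extension of subspaces and curves -/

section Extension

variable {K L : Type*} [Field K] [Field L] [Algebra K L]

theorem exists_extend_functional (f : V7 K →ₗ[K] K) :
    ∃ F : V7 L →ₗ[L] L, ∀ v, F (incl K L v) = algebraMap K L (f v) := by
  refine ⟨∑ i, algebraMap K L (f (Pi.single i 1)) • LinearMap.proj i, fun v => ?_⟩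
  conv_rhs => rw [LinearMap.pi_apply_eq_sum_univ f v]
  simp only [LinearMap.coe_sum, Finset.sum_apply, LinearMap.smul_apply, LinearMap.proj_apply,
    smul_eq_mul, map_sum, map_mul]
  refine Finset.sum_congr rfl fun i _ => ?_
  have h : (fun j => if i = j then (1 : K) else 0) = Pi.single i 1 := by
    ext j
    simp [Pi.single_apply, eq_comm]
  rw [mul_comm, h]
  rfl

theorem mem_of_incl_mem_extend {T : Submodule K (V7 K)} {v : V7 K}
    (h : incl K L v ∈ extend L T) : v ∈ T := by
  by_contra hv
  obtain ⟨f, hf, hT⟩ := Submodule.exists_le_ker_of_notMem hv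
  obtain ⟨F, hF⟩ := exists_extend_functional (L := L) f
  have hle : extend L T ≤ LinearMap.ker F := by
    rw [extend, Submodule.span_le]
    rintro _ ⟨u, hu, rfl⟩
    rw [SetLike.mem_coe, LinearMap.mem_ker, hF, LinearMap.mem_ker.1 (hT hu), map_zero]
  have := hle h
  rw [LinearMap.mem_ker, hF] at this
  exact hf ((map_eq_zero _).1 this)

theorem incl_mem_extend {T : Submodule K (V7 K)} {v : V7 K} (h : v ∈ T) :
    incl K L v ∈ extend L T := Submodule.subset_span ⟨v, h, rfl⟩

theorem map_mem_span_of_mem_extend {c : V7 L →ₗ[L] (Fin 3 → L)} {w : Fin 3 → L} {p : V7 L}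
    (h : p ∈ extend L (ptOf K c w)) : ∃ a : L, c p = a • w := by
  have hle : extend L (ptOf K c w) ≤ (Submodule.span L {w}).comap c := by
    rw [extend, Submodule.span_le]
    rintro _ ⟨v, hv, rfl⟩
    exact hv
  obtain ⟨a, ha⟩ := Submodule.mem_span_singleton.1 (hle h)
  exact ⟨a, ha.symm⟩

theorem curve_mem {F : Type*} [Field F] {d : ℕ} {a : Fin (d + 1) → V7 F}
    {U : Submodule F (V7 F)} (h : ∀ i, a i ∈ U) (x : Fin 2 → F) : curve a x ∈ U :=
  Submodule.sum_mem _ fun i _ => Submodule.smul_mem _ _ (h i)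

theorem curve_smul {F : Type*} [Field F] {d : ℕ} (a : Fin (d + 1) → V7 F) (r : F)
    (x : Fin 2 → F) : curve a (r • x) = r ^ d • curve a x := by
  simp only [curve, Finset.smul_sum, smul_smul, Pi.smul_apply, smul_eq_mul]
  refine Finset.sum_congr rfl fun i _ => ?_
  congr 1
  have h : r ^ d = r ^ (d - (i : ℕ)) * r ^ (i : ℕ) := by
    rw [← pow_add, Nat.sub_add_cancel (Nat.lt_succ_iff.1 i.2)]
  rw [h]
  ring

theorem incl_curve {d : ℕ} (a : Fin (d + 1) → V7 K) (x : Fin 2 → K) :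
    incl K L (curve a x) = curve (fun i => incl K L (a i)) (emb L x) := by
  simp only [curve, map_sum, map_smul]
  refine Finset.sum_congr rfl fun i _ => ?_
  rw [← algebraMap_smul L]
  simp

theorem emb_mulVec (A : Matrix (Fin 2) (Fin 2) K) (x : Fin 2 → K) :
    emb L (A.mulVec x) = (A.map (algebraMap K L)).mulVec (emb L x) := by
  ext i
  fin_cases i <;> simp [Matrix.mulVec, dotProduct]

variable [Finite K]

theorem iterate_fr_smul {ι : Type*} (i : ℕ) (a : L) (v : ι → L) :
    (fr K)^[i] (a • v) = (phi K L)^[i] a • (fr K)^[i] v := by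
  induction i generalizing a v with
  | zero => rfl
  | succ i ih => rw [Function.iterate_succ_apply, fr_smul, ih]; rfl

theorem iterate_fr_add {ι : Type*} (i : ℕ) (v w : ι → L) :
    (fr K)^[i] (v + w) = (fr K)^[i] v + (fr K)^[i] w := by
  induction i generalizing v w with
  | zero => rfl
  | succ i ih => rw [Function.iterate_succ_apply, fr_add, ih]; rfl

theorem frob_eq_iterate (i : ℕ) (v : V7 L) : frob K i v = (fr K)^[i] v := by
  induction i generalizing v with
  | zero => exact frob_zero v
  | succ i ih =>
    rw [Function.iterate_succ_apply, ← ih]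
    ext j
    simp [frob, phi_apply, ← pow_mul, pow_succ, mul_comm]

theorem mem_conj {g : Submodule L (V7 L)} {i : ℕ} (hL : finrank K L = 3) {p : V7 L} :
    p ∈ conj K i g ↔ ∃ p₀ ∈ g, p = (fr K)^[i] p₀ := by
  have hsurj : Function.Surjective (phi K L)^[i] :=
    Function.Surjective.iterate (fun x => ⟨_, phi_phi_phi hL x⟩) i
  constructor
  · intro h
    induction h using Submodule.span_induction with
    | mem x hx =>
      obtain ⟨p₀, hp₀, rfl⟩ := hx
      exact ⟨p₀, hp₀, frob_eq_iterate i p₀⟩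
    | zero => exact ⟨0, g.zero_mem, by rw [Function.iterate_fixed fr_zero]⟩
    | add x y _ _ hx hy =>
      obtain ⟨x, hx, rfl⟩ := hx
      obtain ⟨y, hy, rfl⟩ := hy
      exact ⟨x + y, g.add_mem hx hy, (iterate_fr_add i x y).symm⟩
    | smul a x _ hx =>
      obtain ⟨x, hx, rfl⟩ := hx
      obtain ⟨b, rfl⟩ := hsurj a
      exact ⟨b • x, g.smul_mem _ hx, (iterate_fr_smul i b x).symm⟩
  · rintro ⟨p₀, hp₀, rfl⟩
    exact Submodule.subset_span ⟨p₀, hp₀, frob_eq_iterate i p₀⟩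

theorem fr_curve {d : ℕ} (a : Fin (d + 1) → V7 K) (x : Fin 2 → L) :
    fr K (curve (fun i => incl K L (a i)) x) = curve (fun i => incl K L (a i)) (fr K x) := by
  simp [curve]

theorem iterate_fr_curve {d : ℕ} (a : Fin (d + 1) → V7 K) (i : ℕ) (x : Fin 2 → L) :
    (fr K)^[i] (curve (fun i => incl K L (a i)) x) =
      curve (fun i => incl K L (a i)) ((fr K)^[i] x) := by
  induction i generalizing x with
  | zero => rfl
  | succ i ih => rw [Function.iterate_succ_apply, fr_curve, ih]; rfl

theorem fr_mulVec (A : Matrix (Fin 2) (Fin 2) K) (x : Fin 2 → L) :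
    fr K ((A.map (algebraMap K L)).mulVec x) = (A.map (algebraMap K L)).mulVec (fr K x) := by
  ext i
  fin_cases i <;> simp [Matrix.mulVec, dotProduct]

theorem iterate_fr_mulVec (A : Matrix (Fin 2) (Fin 2) K) (i : ℕ) (x : Fin 2 → L) :
    (fr K)^[i] ((A.map (algebraMap K L)).mulVec x) =
      (A.map (algebraMap K L)).mulVec ((fr K)^[i] x) := by
  induction i generalizing x with
  | zero => rfl
  | succ i ih => rw [Function.iterate_succ_apply, fr_mulVec, ih]; rfl

theorem fr_mem_extend {T : Submodule K (V7 K)} {p : V7 L} (h : p ∈ extend L T) :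
    fr K p ∈ extend L T := by
  induction h using Submodule.span_induction with
  | mem x hx =>
    obtain ⟨v, hv, rfl⟩ := hx
    rw [fr_incl]
    exact incl_mem_extend hv
  | zero => simp
  | add x y _ _ hx hy => rw [fr_add]; exact Submodule.add_mem _ hx hy
  | smul a x _ hx => rw [fr_smul]; exact Submodule.smul_mem _ _ hx

theorem iterate_fr_mem_extend {T : Submodule K (V7 K)} (i : ℕ) {p : V7 L}
    (h : p ∈ extend L T) : (fr K)^[i] p ∈ extend L T := by
  induction i generalizing p with
  | zero => exact h
  | succ i ih => exact ih (fr_mem_extend h)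

theorem exists_phi_ne (hL : finrank K L = 3) : ∃ a : L, phi K L a ≠ a := by
  by_contra h
  push Not at h
  have hsurj : Function.Surjective (Algebra.linearMap K L) := fun a =>
    (phi_eq_self_iff hL).1 (h a)
  have h1 := LinearMap.finrank_le_finrank_of_injective
    (f := (LinearEquiv.ofBijective (Algebra.linearMap K L)
      ⟨(algebraMap K L).injective, hsurj⟩).symm.toLinearMap) (LinearEquiv.injective _)
  rw [hL, finrank_self] at h1
  omega

variable {c : V7 L →ₗ[L] (Fin 3 → L)} {Λ : (Fin 3 → L) →ₗ[L] L}
  {H : Submodule K (V7 K)} {S : Set (Submodule K (V7 K))} {g : Submodule L (V7 L)}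

/-- The extension of the spread element that belongs to the point `P` of `g` contains `P`: it
contains the vectors `a P + a^q P^q + a^(q^2) P^(q^2)`, and two of the three terms can be eliminated
with the help of an element of `L` outside `K`. -/
theorem IsCoord.mem_extend_ptOf (hL : finrank K L = 3) (hc : IsCoord H g c Λ) {P : V7 L}
    (hP : P ∈ g) : P ∈ extend L (ptOf K c (c P)) := by
  have h : ∀ a : L, a • P + phi K L a • fr K P + phi K L (phi K L a) • fr K (fr K P) ∈
      extend L (ptOf K c (c P)) := by
    intro a
    obtain ⟨v, hv⟩ := exists_incl_eq (K := K) hL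
      (p := a • P + phi K L a • fr K P + phi K L (phi K L a) • fr K (fr K P)) (by
        simp only [fr_add, fr_smul, fr_fr_fr hL, phi_phi_phi hL]
        abel)
    rw [← hv]
    refine incl_mem_extend (mem_ptOf.2 ⟨a, ?_⟩)
    rw [hv]
    simp [(hc.mem_line P).1 hP]
  obtain ⟨a, ha⟩ := exists_phi_ne (K := K) hL
  have ha2 : phi K L (phi K L a) ≠ a := fun h =>
    ha ((phi_eq_self_iff hL).2 ((phi_phi_eq_self_iff hL).1 h))
  have key : ((a - phi K L (phi K L a)) * (a - phi K L a)) • P ∈ extend L (ptOf K c (c P)) := by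
    have h1 := h 1
    have h2 := h a
    have h3 := h (a * a)
    have h4 := Submodule.sub_mem _ (Submodule.sub_mem _ h3
      (Submodule.smul_mem _ (phi K L (phi K L a)) h2))
      (Submodule.smul_mem _ (phi K L a) (Submodule.sub_mem _ h2
      (Submodule.smul_mem _ (phi K L (phi K L a)) h1)))
    convert h4 using 1
    simp only [map_mul, map_one]
    module
  have h5 := Submodule.smul_mem _ ((a - phi K L (phi K L a)) * (a - phi K L a))⁻¹ key
  rwa [smul_smul, inv_mul_cancel₀, one_smul] at h5
  exact mul_ne_zero (sub_ne_zero.2 ha2.symm) (sub_ne_zero.2 ha.symm)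

theorem IsCoord.exists_smul_of_mem (hc : IsCoord H g c Λ) {P Q : V7 L} (hP : P ∈ g) (hQ : Q ∈ g)
    {a : L} (h : c Q = a • c P) : Q = a • P := by
  rw [← sub_eq_zero]
  refine hc.eq_zero_of_mem (g.sub_mem hQ (g.smul_mem _ hP)) ?_
  rw [map_sub, map_smul, h, sub_self]

/-- The extension of a spread element meets the transversal lines in conjugate points. -/
theorem IsCoord.extend_inf_conj (hL : finrank K L = 3) (hc : IsCoord H g c Λ) {P : V7 L}
    (hP : P ∈ g) (i : Fin 3) :
    Submodule.span L {(fr K)^[i] P} = extend L (ptOf K c (c P)) ⊓ conj K i g := by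
  apply le_antisymm
  · rw [Submodule.span_singleton_le_iff_mem]
    exact ⟨iterate_fr_mem_extend _ (hc.mem_extend_ptOf hL hP), (mem_conj hL).2 ⟨P, hP, rfl⟩⟩
  · rintro p ⟨h1, h2⟩
    obtain ⟨Q, hQ, rfl⟩ := (mem_conj hL).1 h2
    have h3 : Q ∈ extend L (ptOf K c (c P)) := by
      have h4 := iterate_fr_mem_extend (3 - (i : ℕ)) h1
      rw [← Function.iterate_add_apply, Nat.sub_add_cancel i.2.le] at h4
      have h5 : (fr K)^[3] Q = Q := fr_fr_fr hL Q
      rwa [h5] at h4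
    obtain ⟨a, ha⟩ := map_mem_span_of_mem_extend h3
    rw [hc.exists_smul_of_mem hP hQ ha, iterate_fr_smul]
    exact Submodule.mem_span_singleton.2 ⟨_, rfl⟩

/-- A criterion for a ruled surface to be special: one parameter over `L` gives a point of the
conic and a point of the normal rational curve that span `g`. -/
theorem RuledSurface.isSpecial_of_mem (hL : finrank K L = 3) (hc : IsCoord H g c Λ)
    (hS : IsRegularSpread H S g) (R : RuledSurface K) {W : Submodule K (V7 K)} (hW : W ∈ S)
    (hcW : ∀ i, R.conic i ∈ W) (hn : ∃ i, R.nrc i ∉ H) {x : Fin 2 → L}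
    (h1 : curve (fun i => incl K L (R.conic i)) x ∈ g)
    (h2 : curve (fun i => incl K L (R.nrc i))
      ((R.proj.val.map (algebraMap K L)).mulVec x) ∈ g)
    (hli : LinearIndependent L ![curve (fun i => incl K L (R.conic i)) x,
      curve (fun i => incl K L (R.nrc i)) ((R.proj.val.map (algebraMap K L)).mulVec x)]) :
    R.IsSpecial H S g := by
  set P := curve (fun i => incl K L (R.conic i)) x with hP
  set Q := curve (fun i => incl K L (R.nrc i))
    ((R.proj.val.map (algebraMap K L)).mulVec x) with hQ
  have hP0 : P ≠ 0 := hli.ne_zero 0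
  have hQ0 : Q ≠ 0 := hli.ne_zero 1
  have hcP0 : c P ≠ 0 := fun h => hP0 (hc.eq_zero_of_mem h1 h)
  have hcQ0 : c Q ≠ 0 := fun h => hQ0 (hc.eq_zero_of_mem h2 h)
  have hy0 : (R.proj.val.map (algebraMap K L)).mulVec x ≠ 0 := by
    intro h
    rw [hQ, h, ← zero_smul L (0 : Fin 2 → L), curve_smul] at hQ0
    simp at hQ0
  have hx0 : x ≠ 0 := by
    rintro rfl
    simp at hy0
  have hit : ∀ (i : ℕ) {y : Fin 2 → L}, y ≠ 0 → (fr K)^[i] y ≠ 0 := by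
    intro i y hy h
    rw [← Function.iterate_fixed (f := fr K) fr_zero i] at h
    exact hy (fr_injective.iterate i h)
  have hWP : W = ptOf K c (c P) := by
    obtain ⟨w, -, -, rfl⟩ := (hc.mem_spread hL hS W).1 hW
    have hPW : P ∈ extend L (ptOf K c w) := curve_mem (fun i => incl_mem_extend (hcW i)) x
    obtain ⟨a, ha⟩ := map_mem_span_of_mem_extend hPW
    have ha0 : a ≠ 0 := by
      rintro rfl
      rw [zero_smul] at ha
      exact hcP0 ha
    rw [ha, ptOf_smul ha0]
  have hgPQ : ∀ p ∈ g, ∃ a b : L, a • P + b • Q = p := by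
    have hle : Submodule.span L (Set.range ![P, Q]) ≤ g := by
      rw [Submodule.span_le]
      rintro _ ⟨i, rfl⟩
      fin_cases i
      · exact h1
      · exact h2
    have heq := Submodule.eq_of_le_of_finrank_le hle
      (by rw [hS.line, finrank_span_eq_card hli, Fintype.card_fin])
    intro p hp
    rw [← heq, Matrix.range_cons_cons_empty, Submodule.mem_span_pair] at hp
    exact hp
  refine ⟨⟨W, hW, ⟨hcW, fun i => ⟨(fr K)^[i] x, hit i hx0, ?_⟩⟩, ptOf K c (c Q), ?_, ?_,
    Submodule.span K (Set.range R.nrc), ?_, ?_, ?_, ?_, fun i => ⟨(fr K)^[i]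
      ((R.proj.val.map (algebraMap K L)).mulVec x), hit i hy0, ?_⟩⟩, ?_⟩
  · rw [← iterate_fr_curve, hWP]
    exact hc.extend_inf_conj hL h1 i
  · exact (hc.mem_spread hL hS _).2 ⟨_, hcQ0, hc.map_eq_zero_of_mem h2, rfl⟩
  · rw [hWP]
    intro h
    obtain ⟨a, -, ha⟩ := (hc.ptOf_eq_iff hcP0).1 h
    have h3 := hc.exists_smul_of_mem h2 h1 ha
    have h4 := (LinearIndependent.pair_iff.1 hli) 1 (-a)
      (by rw [one_smul, neg_smul, ← h3, add_neg_cancel])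
    exact one_ne_zero h4.1
  · rw [finrank_span_eq_card R.nrc_indep, Fintype.card_fin]
  · intro hle
    obtain ⟨i, hi⟩ := hn
    exact hi (hle (Submodule.subset_span ⟨i, rfl⟩))
  · intro v hv
    rw [← hc.rational_span hL h2] at hv
    apply mem_of_incl_mem_extend (L := L)
    have hQT : Q ∈ extend L (Submodule.span K (Set.range R.nrc)) :=
      curve_mem (fun i => incl_mem_extend (Submodule.subset_span (Set.mem_range_self i))) _
    have hle : Submodule.span L {Q, frob K 1 Q, frob K 2 Q} ≤
        extend L (Submodule.span K (Set.range R.nrc)) := by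
      rw [Submodule.span_le, frob_one, frob_two]
      rintro _ (rfl | rfl | rfl)
      · exact hQT
      · exact fr_mem_extend hQT
      · exact fr_mem_extend (fr_mem_extend hQT)
    exact hle hv
  · exact fun i => Submodule.subset_span (Set.mem_range_self i)
  · rw [← iterate_fr_curve]
    exact hc.extend_inf_conj hL h2 i
  · intro i p hp
    refine ⟨(fr K)^[i] x, hit i hx0, hp.trans fun u hu => ?_⟩
    obtain ⟨p₀, hp₀, rfl⟩ := (mem_conj hL).1 hu
    obtain ⟨a, b, rfl⟩ := hgPQ p₀ hp₀
    rw [join, ← iterate_fr_mulVec, ← iterate_fr_curve, ← iterate_fr_curve, iterate_fr_add,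
      iterate_fr_smul, iterate_fr_smul]
    exact Submodule.mem_span_pair.2 ⟨_, _, rfl⟩

end Extension

/-! ### Special surfaces give tangent subplanes -/

section Special

variable {K L : Type*} [Field K] [Finite K] [Field L] [Algebra K L]
  {c : V7 L →ₗ[L] (Fin 3 → L)} {Λ : (Fin 3 → L) →ₗ[L] L}
  {H : Submodule K (V7 K)} {S : Set (Submodule K (V7 K))} {g : Submodule L (V7 L)}

theorem incl_smul {K L : Type*} [Field K] [Field L] [Algebra K L] (k : K) (v : V7 K) :
    incl K L (k • v) = algebraMap K L k • incl K L v := by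
  rw [map_smul, algebraMap_smul]

/-- The coordinates are adapted to a tangent subplane and a ruled surface: the point at infinity of
the subplane `PG(2, K)` is `(0, 0, 1)`, and the generator with parameter `x` joins this point to
`(x 0, x 1, 0)`. The factors by which the vectors of the surface differ from these representatives
agree for the two directrices. -/
structure IsStdSurface (c : V7 L →ₗ[L] (Fin 3 → L)) (Λ : (Fin 3 → L) →ₗ[L] L)
    (R : RuledSurface K) : Prop where
  inf : Λ ![0, 0, 1] = 0
  aff : ∀ x : Fin 2 → K, x ≠ 0 → Λ ![algebraMap K L (x 0), algebraMap K L (x 1), 0] ≠ 0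
  gen : ∀ x : Fin 2 → K, x ≠ 0 → ∃ a : L, a ≠ 0 ∧
    c (incl K L (curve R.conic x)) = a • ![0, 0, 1] ∧
    c (incl K L (curve R.nrc (R.proj.val.mulVec x))) =
      a • ![algebraMap K L (x 0), algebraMap K L (x 1), 0]

theorem map_vec_eq (hinf : Λ ![0, 0, 1] = 0) (x y z : L) : Λ ![x, y, z] = Λ ![x, y, 0] := by
  have h : ![x, y, z] = ![x, y, 0] + z • ![0, 0, 1] := by
    ext i
    fin_cases i <;> simp
  rw [h, map_add, map_smul, hinf, smul_zero, add_zero]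

theorem exists_isCoord' (hL : finrank K L = 3) (hH : finrank K H = 6)
    (hS : IsRegularSpread H S g) :
    ∃ (c : V7 L →ₗ[L] (Fin 3 → L)) (Λ : (Fin 3 → L) →ₗ[L] L), IsCoord H g c Λ := by
  have hne : H < ⊤ := by
    refine lt_top_iff_ne_top.2 fun h => ?_
    rw [h, finrank_top, finrank_fin_fun] at hH
    omega
  obtain ⟨t, -, ht⟩ := SetLike.exists_of_lt hne
  let b := finBasisOfFinrankEq L g hS.line
  have hb : Submodule.span L (Set.range fun i => (b i : V7 L)) = g := by
    have h := congrArg (Submodule.map g.subtype) b.span_eq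
    rw [Submodule.map_span, Submodule.map_top, Submodule.range_subtype, ← Set.range_comp] at h
    exact h
  obtain ⟨c, hc, -⟩ := exists_isCoord hL hH hS ht hb
  exact ⟨c, _, hc⟩

theorem map_comb {K L : Type*} [Field K] [Field L] [Algebra K L]
    {c : V7 L →ₗ[L] (Fin 3 → L)} {u v : V7 K} {x : Fin 2 → K} {a : L}
    (hu : c (incl K L u) = a • ![0, 0, 1])
    (hv : c (incl K L v) = a • ![algebraMap K L (x 0), algebraMap K L (x 1), 0]) (s t : K) :
    c (incl K L (s • u + t • v)) = a • emb L ![t * x 0, t * x 1, s] := by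
  rw [map_add, incl_smul, incl_smul, map_add, map_smul, map_smul, hu, hv]
  ext i
  fin_cases i <;> simp [Algebra.smul_def] <;> ring

theorem IsStdSurface.mem_join (hc : IsCoord H g c Λ) {R : RuledSurface K}
    (hR : IsStdSurface c Λ R) {x : Fin 2 → K} (hx : x ≠ 0) :
    ∃ a : L, a ≠ 0 ∧ ∀ v, v ∈ join R.conic R.nrc R.proj.val x ↔
      ∃ s t : K, c (incl K L v) = a • emb L ![t * x 0, t * x 1, s] := by
  obtain ⟨a, ha, hC, hN⟩ := hR.gen x hx
  refine ⟨a, ha, fun w => ?_⟩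
  rw [join, Submodule.mem_span_pair]
  refine exists_congr fun s => exists_congr fun t => ?_
  rw [← map_comb hC hN]
  exact ⟨fun h => by rw [h], fun h => (hc.injective h).symm⟩

theorem IsStdSurface.correspondsTo (hL : finrank K L = 3) (hc : IsCoord H g c Λ)
    (hS : IsRegularSpread H S g) {R : RuledSurface K} (hR : IsStdSurface c Λ R) :
    CorrespondsTo H S R.points (stdSubplane K c) := by
  have key : ∀ {z : Fin 3 → K} {x : Fin 2 → K} {s t : K}, z ≠ 0 → x ≠ 0 →
      z = ![t * x 0, t * x 1, s] → ∃ p ∈ R.points, p.submodule ≤ ptOf K c (emb L z) := by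
    rintro z x s t hz hx rfl
    obtain ⟨b, hb, hC, hN⟩ := hR.gen x hx
    obtain ⟨v, hvj, hv⟩ : ∃ v ∈ join R.conic R.nrc R.proj.val x,
        c (incl K L v) = b • emb L ![t * x 0, t * x 1, s] :=
      ⟨_, Submodule.mem_span_pair.2 ⟨s, t, rfl⟩, map_comb hC hN s t⟩
    have hv0 : v ≠ 0 := by
      rintro rfl
      rw [map_zero, map_zero] at hv
      exact smul_ne_zero hb (emb_ne_zero hz) hv.symm
    refine ⟨Projectivization.mk K v hv0, ⟨x, hx, ?_⟩, ?_⟩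
    · rwa [Projectivization.submodule_mk, Submodule.span_singleton_le_iff_mem]
    · rw [Projectivization.submodule_mk, Submodule.span_singleton_le_iff_mem]
      exact mem_ptOf.2 ⟨b, hv⟩
  apply Set.Subset.antisymm
  · rintro _ ⟨z, hz, rfl⟩
    refine ⟨(hc.mem_points hL hS _).2 ⟨_, emb_ne_zero hz, rfl⟩, ?_⟩
    by_cases hx : ![z 0, z 1] = 0
    · have h0 : z 0 = 0 := congrFun hx 0
      have h1 : z 1 = 0 := congrFun hx 1
      refine key (x := ![1, 0]) (s := z 2) (t := 0) hz (by simp) ?_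
      ext i
      fin_cases i <;> simp [h0, h1]
    · refine key (x := ![z 0, z 1]) (s := z 2) (t := 1) hz hx ?_
      ext i
      fin_cases i <;> simp
  · rintro W ⟨hW, p, ⟨x, hx, hpx⟩, hpW⟩
    obtain ⟨w, hw, rfl⟩ := (hc.mem_points hL hS W).1 hW
    obtain ⟨a, ha, hj⟩ := hR.mem_join hc hx
    rw [p.submodule_eq, Submodule.span_singleton_le_iff_mem] at hpx hpW
    obtain ⟨s, t, hst⟩ := (hj _).1 hpx
    rw [hc.ptOf_eq_of_mem p.rep_nonzero hpW, hst, ptOf_smul ha]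
    refine ⟨_, fun h => p.rep_nonzero (hc.eq_zero ?_), rfl⟩
    rw [hst, h, emb_zero, smul_zero]

theorem IsStdSurface.isTangent (hc : IsCoord H g c Λ) {R : RuledSurface K}
    (hR : IsStdSurface c Λ R) : IsTangent H (stdSubplane K c) := by
  have he : emb L ![(0 : K), 0, 1] = ![0, 0, 1] := by
    ext i
    fin_cases i <;> simp
  refine ⟨ptOf K c (emb L ![0, 0, 1]), ⟨⟨_, by simp, rfl⟩, ?_⟩, ?_⟩
  · rw [hc.ptOf_le, he]
    exact hR.inf
  · rintro _ ⟨⟨z, hz, rfl⟩, hle⟩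
    rw [hc.ptOf_le] at hle
    have hz' : emb L z = ![algebraMap K L (z 0), algebraMap K L (z 1), algebraMap K L (z 2)] := by
      ext i
      fin_cases i <;> simp
    have h0 : ![z 0, z 1] = 0 := by
      by_contra h0
      rw [hz', map_vec_eq hR.inf] at hle
      exact hR.aff _ h0 hle
    have h1 : z 0 = 0 := congrFun h0 0
    have h2 : z 1 = 0 := congrFun h0 1
    have h3 : z 2 ≠ 0 := fun h3 => hz (by ext i; fin_cases i <;> simp [h1, h2, h3])
    have h4 : z = z 2 • ![0, 0, 1] := by
      ext i
      fin_cases i <;> simp [h1, h2]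
    rw [h4, emb_smul, ptOf_smul (by simpa using h3)]

/-! The zeros of the forms that belong to special curves are a point outside `PG(1, K)` and its
conjugates. -/

theorem bracket_fr (x y : Fin 2 → L) :
    bracket (fr K x) (fr K y) = phi K L (bracket x y) := by
  simp [bracket]

theorem bracket_fr_fr_ne_zero (hL : finrank K L = 3) {y : Fin 2 → L}
    (hy : bracket y (fr K y) ≠ 0) : bracket y (fr K (fr K y)) ≠ 0 := by
  intro h
  apply hy
  have h1 := congrArg (phi K L) h
  rw [← bracket_fr, fr_fr_fr hL, map_zero, bracket_swap, neg_eq_zero] at h1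
  exact h1

theorem bracket_emb_ne_zero {y : Fin 2 → L} (hy : bracket y (fr K y) ≠ 0) {x : Fin 2 → K}
    (hx : x ≠ 0) : bracket (emb L x) y ≠ 0 := by
  intro h
  have hy0 : y ≠ 0 := by
    rintro rfl
    simp [bracket] at hy
  obtain ⟨a, ha⟩ := (bracket_eq_zero_iff hy0).1 h
  have ha0 : a ≠ 0 := by
    rintro rfl
    rw [zero_smul] at ha
    exact emb_ne_zero hx ha
  have h1 : emb L x = phi K L a • fr K y := by
    rw [← fr_smul, ← ha]
    exact (fr_algebraMap x).symm
  apply hy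
  rw [bracket_eq_zero_iff (fun h => hy0 (fr_eq_zero_iff.1 h))]
  refine ⟨a⁻¹ * phi K L a, ?_⟩
  rw [mul_smul, ← h1, ha, smul_smul, inv_mul_cancel₀ ha0, one_smul]

theorem bracket_emb_fr (x : Fin 2 → K) (y : Fin 2 → L) :
    bracket (emb L x) (fr K y) = phi K L (bracket (emb L x) y) := by
  rw [← bracket_fr]
  congr 1
  exact (fr_algebraMap x).symm

theorem ne_zero_of_bracket {x y : Fin 2 → L} (h : bracket x y ≠ 0) : y ≠ 0 := by
  rintro rfl
  simp [bracket] at h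

/-- A form that vanishes at `y^q` and `y^(q^2)` is divisible by the two linear forms with these
zeros. -/
theorem forms_factor_two {y : Fin 2 → L} (hy : bracket y (fr K y) ≠ 0) {d : ℕ}
    {F : (Fin 2 → L) → L} (hF : F ∈ linForms L ^ (d + 2)) (h1 : F (fr K y) = 0)
    (h2 : F (fr K (fr K y)) = 0) :
    ∃ G ∈ linForms L ^ d, ∀ x, F x = bracket x (fr K y) * bracket x (fr K (fr K y)) * G x := by
  obtain ⟨G, hG, hFG⟩ := forms_factor (ne_zero_of_bracket hy) hF h1
  have h12 : bracket (fr K y) (fr K (fr K y)) ≠ 0 := by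
    rw [bracket_fr]
    simpa using hy
  have h3 : G (fr K (fr K y)) = 0 := by
    have h := hFG (fr K (fr K y))
    rw [h2] at h
    refine (mul_eq_zero.1 h.symm).resolve_left ?_
    rw [bracket_swap]
    exact neg_ne_zero.2 h12
  obtain ⟨G', hG', hGG'⟩ := forms_factor (ne_zero_of_bracket h12) hG h3
  exact ⟨G', hG', fun x => by rw [hFG, hGG', mul_assoc]⟩

/-- A special ruled surface is standard in suitable coordinates. If `y` is the common parameter of
the points of the conic and of the normal rational curve on `g`, then the coordinates of the conic
and the second coordinate of the normal rational curve are divisible by the linear forms with the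
zeros `y^q`, `y^(q^2)`, and the first coordinate of the normal rational curve also by the linear
form with the zero `y`. What remains after cancellation is linear. -/
theorem RuledSurface.IsSpecial.exists_isStdSurface (hL : finrank K L = 3) (hH : finrank K H = 6)
    (hS : IsRegularSpread H S g) {R : RuledSurface K} (hR : R.IsSpecial H S g) :
    ∃ (c : V7 L →ₗ[L] (Fin 3 → L)) (Λ : (Fin 3 → L) →ₗ[L] L), IsCoord H g c Λ ∧
      IsStdSurface c Λ R := by
  obtain ⟨⟨W, hW, ⟨hcW, -⟩, W', hW', hWW', T, hT4, hTH, hWT, hnT, -⟩, hext⟩ := hR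
  obtain ⟨P, hP, hP0, hWP⟩ := (hS.mem_iff W).1 hW
  obtain ⟨Q, hQ, hQ0, hWQ⟩ := (hS.mem_iff W').1 hW'
  have hPQ : LinearIndependent L ![Q, P] := by
    obtain ⟨c, Λ, hc⟩ := exists_isCoord' hL hH hS
    rw [hc.rational_span hL hP] at hWP
    rw [hc.rational_span hL hQ] at hWQ
    rw [LinearIndependent.pair_iff' hQ0]
    rintro a rfl
    apply hWW'
    rw [hWP, hWQ, map_smul, ptOf_smul]
    rintro rfl
    simp at hP0
  have hspan : Submodule.span L (Set.range ![Q, P]) = g := by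
    refine Submodule.eq_of_le_of_finrank_le ?_ ?_
    · rw [Submodule.span_le]
      rintro _ ⟨i, rfl⟩
      fin_cases i
      · exact hQ
      · exact hP
    · rw [hS.line, finrank_span_eq_card hPQ, Fintype.card_fin]
  obtain ⟨t, htT, htH⟩ := SetLike.not_le_iff_exists.1 hTH
  obtain ⟨c, hc, hct, hcQ, hcP⟩ := exists_isCoord hL hH hS htH hspan
  replace hcQ : c Q = ![0, 1, 0] := hcQ
  replace hcP : c P = ![0, 0, 1] := hcP
  rw [hc.rational_span hL hP, hcP] at hWP
  rw [hc.rational_span hL hQ, hcQ] at hWQ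
  have hW'3 := hS.plane W' hW'
  have hT2 : ∀ v ∈ T, c (incl K L v) 2 = 0 := by
    intro v hv
    obtain ⟨k, hk⟩ := exists_smul_sub_mem hWT (by rw [hT4, hW'3.2]) htT
      (fun h => htH (hW'3.1 h)) hv
    rw [hWQ] at hk
    obtain ⟨a, ha⟩ := mem_ptOf.1 hk
    have h := congrFun ha 2
    rw [map_sub, map_smul, ← algebraMap_smul L k, map_sub, map_smul, hct] at h
    simpa using h
  -- coordinates of the points of the two curves
  have hC : ∀ x, ∃ a, c (curve (fun i => incl K L (R.conic i)) x) =
      a • (![0, 0, 1] : Fin 3 → L) := fun x =>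
    map_mem_span_of_mem_extend (K := K)
      (curve_mem (fun i => incl_mem_extend (hWP ▸ hcW i)) x)
  choose f hf using hC
  have hN : ∀ x, c (curve (fun i => incl K L (R.nrc i)) x) 2 = 0 := fun x =>
    curve_mem (U := LinearMap.ker (LinearMap.proj 2 ∘ₗ c)) (fun i => hT2 _ (hnT i)) x
  have hfform : f ∈ linForms L ^ 2 := by
    have h := curve_mem_forms (LinearMap.proj 2 ∘ₗ c) (fun i => incl K L (R.conic i)) 1
    simp only [Matrix.one_mulVec, LinearMap.comp_apply, LinearMap.proj_apply, hf] at h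
    convert h using 2 with x
    simp
  let A := R.proj.val.map (algebraMap K L)
  let m : (Fin 2 → L) → L := fun x => c (curve (fun i => incl K L (R.nrc i)) (A.mulVec x)) 0
  let h : (Fin 2 → L) → L := fun x => c (curve (fun i => incl K L (R.nrc i)) (A.mulVec x)) 1
  have hmform : m ∈ linForms L ^ 3 :=
    curve_mem_forms (LinearMap.proj 0 ∘ₗ c) (fun i => incl K L (R.nrc i)) A
  have hhform : h ∈ linForms L ^ 3 :=
    curve_mem_forms (LinearMap.proj 1 ∘ₗ c) (fun i => incl K L (R.nrc i)) A
  have hmh : ∀ x, c (curve (fun i => incl K L (R.nrc i)) (A.mulVec x)) = ![m x, h x, 0] := by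
    intro x
    ext i
    fin_cases i
    · rfl
    · rfl
    · exact hN _
  -- the generator through the point `P + Q` of `g`
  obtain ⟨y, hy0, hy⟩ := hext 0 (Projectivization.mk L (P + Q) (by
    intro h0
    have := congrArg c h0
    rw [map_add, hcP, hcQ, map_zero] at this
    simpa using congrFun this 1)) (by
    rw [Projectivization.submodule_mk, Submodule.span_singleton_le_iff_mem, mem_conj hL]
    exact ⟨P + Q, g.add_mem hP hQ, rfl⟩)
  rw [Projectivization.submodule_mk, Submodule.span_singleton_le_iff_mem, join,
    Submodule.mem_span_pair] at hy
  obtain ⟨a, b, hab⟩ := hy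
  have h0 : a • f y • ![0, 0, 1] + b • ![m y, h y, 0] = ![0, 1, 1] := by
    have := congrArg c hab
    rw [map_add, map_smul, map_smul, hf, hmh, map_add, hcP, hcQ] at this
    rw [this]
    ext i
    fin_cases i <;> simp
  have hPQg := (hc.mem_line _).1 (g.add_mem hP hQ)
  have h1 : phi K L a • f (fr K y) • ![0, 0, 1] + phi K L b • ![m (fr K y), h (fr K y), 0] =
      0 := by
    rw [← hf, ← hmh, ← fr_mulVec, ← fr_curve, ← fr_curve, ← map_smul, ← map_smul, ← map_add,
      ← fr_smul, ← fr_smul, ← fr_add, hab]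
    exact hPQg.1
  have h2 : phi K L (phi K L a) • f (fr K (fr K y)) • ![0, 0, 1] +
      phi K L (phi K L b) • ![m (fr K (fr K y)), h (fr K (fr K y)), 0] = 0 := by
    rw [← hf, ← hmh, ← fr_mulVec, ← fr_mulVec, ← fr_curve, ← fr_curve, ← fr_curve, ← fr_curve,
      ← map_smul, ← map_smul, ← map_add, ← fr_smul, ← fr_smul, ← fr_smul, ← fr_smul, ← fr_add,
      ← fr_add, hab]
    exact hPQg.2
  have e00 := congrFun h0 0
  have e01 := congrFun h0 1
  have e02 := congrFun h0 2
  have e10 := congrFun h1 0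
  have e11 := congrFun h1 1
  have e12 := congrFun h1 2
  have e20 := congrFun h2 0
  have e21 := congrFun h2 1
  have e22 := congrFun h2 2
  simp only [Pi.add_apply, Pi.smul_apply, smul_eq_mul, Matrix.cons_val_zero, Matrix.cons_val_one,
    Matrix.cons_val, Pi.zero_apply, mul_zero, zero_add, add_zero, mul_one]
    at e00 e01 e02 e10 e11 e12 e20 e21 e22
  have ha : a ≠ 0 := left_ne_zero_of_mul (e02 ▸ one_ne_zero)
  have hb : b ≠ 0 := left_ne_zero_of_mul (e01 ▸ one_ne_zero)
  have hfy : f y ≠ 0 := right_ne_zero_of_mul (e02 ▸ one_ne_zero)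
  have hhy : h y ≠ 0 := right_ne_zero_of_mul (e01 ▸ one_ne_zero)
  simp only [mul_eq_zero, map_eq_zero, ha, hb, false_or] at e00 e10 e11 e12 e20 e21 e22
  have hbr : bracket y (fr K y) ≠ 0 := by
    intro hbr
    obtain ⟨r, hr⟩ := (bracket_eq_zero_iff (fun h => hy0 (fr_eq_zero_iff.1 h))).1 hbr
    have h4 := hf y
    rw [hr, curve_smul, map_smul, hf, e12, zero_smul, smul_zero, ← hr] at h4
    have := congrFun h4 2
    simp at this
    exact hfy this.symm
  obtain ⟨f', hf', hff'⟩ := forms_factor_two hbr hfform e12 e22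
  obtain ⟨k, rfl⟩ := forms_zero hf'
  obtain ⟨u, hu, hhu⟩ := forms_factor_two hbr hhform e11 e21
  obtain ⟨m', hm', hmm'⟩ := forms_factor_two hbr hmform e10 e20
  have hm'y : m' y = 0 := by
    have := hmm' y
    rw [e00] at this
    exact (mul_eq_zero.1 this.symm).resolve_left
      (mul_ne_zero hbr (bracket_fr_fr_ne_zero hL hbr))
  obtain ⟨m'', hm'', hmm''⟩ := forms_factor hy0 hm' hm'y
  obtain ⟨m₀, rfl⟩ := forms_zero hm''
  rw [pow_one] at hu
  obtain ⟨u₀, u₁, rfl⟩ := mem_linForms.1 hu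
  beta_reduce at hff' hmm'' hhu
  have hk : k ≠ 0 := by
    rintro rfl
    exact hfy (by rw [hff', mul_zero])
  have huy : u₀ * y 0 + u₁ * y 1 ≠ 0 := fun h0 => hhy (by rw [hhu, h0, mul_zero])
  have hm₀ : m₀ ≠ 0 := by
    rintro rfl
    have hLcard : 3 < Nat.card L := by
      have : FiniteDimensional K L := FiniteDimensional.of_finrank_pos (by omega)
      rw [Module.natCard_eq_pow_finrank (K := K), hL]
      have : 2 ≤ Nat.card K := Finite.one_lt_card
      calc 3 < 2 ^ 3 := by norm_num
        _ ≤ _ := Nat.pow_le_pow_left this 3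
    have hz : ∀ x, (LinearMap.proj 0 ∘ₗ c) (curve (fun i => incl K L (R.nrc i)) x) = 0 := by
      intro x
      have hx : A.mulVec ((R.proj⁻¹.val.map (algebraMap K L)).mulVec x) = x := by
        rw [Matrix.mulVec_mulVec, ← Matrix.map_mul, Units.mul_inv]
        simp
      rw [← hx]
      change m _ = 0
      rw [hmm', hmm'', mul_zero, mul_zero]
    have hnH : ∀ i, R.nrc i ∈ H := fun i =>
      (hc.mem_hyperplane _).2 (coeff_eq_zero_of_curve _ _ hLcard hz i)
    have hTn : Submodule.span K (Set.range R.nrc) = T := by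
      refine Submodule.eq_of_le_of_finrank_le ?_ ?_
      · rw [Submodule.span_le]
        rintro _ ⟨i, rfl⟩
        exact hnT i
      · rw [hT4, finrank_span_eq_card R.nrc_indep, Fintype.card_fin]
    apply hTH
    rw [← hTn, Submodule.span_le]
    rintro _ ⟨i, rfl⟩
    exact hnH i
  let M₀ : (Fin 3 → L) →ₗ[L] (Fin 3 → L) :=
    { toFun := fun z => ![m₀ * bracket ![z 0, z 1] y, u₀ * z 0 + u₁ * z 1, k * z 2]
      map_add' := fun z w => by
        ext i
        fin_cases i <;> simp [bracket] <;> ring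
      map_smul' := fun r z => by
        ext i
        fin_cases i <;> simp [bracket] <;> ring }
  have hM₀ : ∀ z, M₀ z = ![m₀ * bracket ![z 0, z 1] y, u₀ * z 0 + u₁ * z 1, k * z 2] :=
    fun z => rfl
  have hinj : Function.Injective M₀ := by
    rw [injective_iff_map_eq_zero]
    intro z hz
    rw [hM₀] at hz
    simp only [Matrix.cons_eq_zero_iff, mul_eq_zero, hm₀, hk, false_or] at hz
    obtain ⟨r, hr⟩ := (bracket_eq_zero_iff hy0).1 hz.1
    have hr0 : z 0 = r * y 0 := congrFun hr 0
    have hr1 : z 1 = r * y 1 := congrFun hr 1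
    have hr2 : r * (u₀ * y 0 + u₁ * y 1) = 0 := by
      rw [← hz.2.1, hr0, hr1]
      ring
    have hr3 : r = 0 := (mul_eq_zero.1 hr2).resolve_right huy
    ext i
    fin_cases i
    · simp [hr0, hr3]
    · simp [hr1, hr3]
    · exact hz.2.2.1
  let M : (Fin 3 → L) ≃ₗ[L] (Fin 3 → L) := LinearEquiv.ofInjectiveEndo M₀ hinj
  have hM : ∀ z, M z = ![m₀ * bracket ![z 0, z 1] y, u₀ * z 0 + u₁ * z 1, k * z 2] :=
    fun z => rfl
  have hxv : ∀ x : Fin 2 → K, ![algebraMap K L (x 0), algebraMap K L (x 1)] = emb L x := by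
    intro x
    ext i
    fin_cases i <;> simp
  refine ⟨_, _, hc.trans M, ?_, ?_, ?_⟩
  · change M ![0, 0, 1] 0 = 0
    rw [hM]
    simp [bracket]
  · intro x hx
    change M ![algebraMap K L (x 0), algebraMap K L (x 1), 0] 0 ≠ 0
    rw [hM]
    simp only [Matrix.cons_val_zero, Matrix.cons_val_one, hxv]
    exact mul_ne_zero hm₀ (bracket_emb_ne_zero hbr hx)
  · intro x hx
    have hx1 := bracket_emb_ne_zero hbr hx
    refine ⟨bracket (emb L x) (fr K y) * bracket (emb L x) (fr K (fr K y)), ?_, ?_, ?_⟩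
    · rw [bracket_emb_fr, bracket_emb_fr, bracket_emb_fr]
      simpa using hx1
    · change M.symm (c _) = _
      rw [LinearEquiv.symm_apply_eq, incl_curve, hf, hff', map_smul, hM]
      ext i
      fin_cases i <;> simp [bracket]
    · change M.symm (c _) = _
      rw [LinearEquiv.symm_apply_eq, incl_curve, emb_mulVec, hmh, hhu, hmm', hmm'', map_smul, hM]
      simp only [Matrix.cons_val_zero, Matrix.cons_val_one, hxv]
      ext i
      fin_cases i <;> simp [-mul_eq_mul_left_iff]
      ring

end Special

/-! ### The special surface of a tangent subplane -/

section StdSurface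

variable {K L : Type*} [Field K] [Finite K] [Field L] [Algebra K L]
  {c : V7 L →ₗ[L] (Fin 3 → L)} {Λ : (Fin 3 → L) →ₗ[L] L}
  {H : Submodule K (V7 K)} {S : Set (Submodule K (V7 K))} {g : Submodule L (V7 L)}

theorem curve_two {F : Type*} [Field F] (a : Fin 3 → V7 F) (x : Fin 2 → F) :
    curve (d := 2) a x = x 0 ^ 2 • a 0 + (x 0 * x 1) • a 1 + x 1 ^ 2 • a 2 := by
  simp [curve, Fin.sum_univ_succ, add_assoc]

theorem curve_three {F : Type*} [Field F] (a : Fin 4 → V7 F) (x : Fin 2 → F) :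
    curve (d := 3) a x = x 0 ^ 3 • a 0 + (x 0 ^ 2 * x 1) • a 1 + (x 0 * x 1 ^ 2) • a 2 +
      x 1 ^ 3 • a 3 := by
  simp [curve, Fin.sum_univ_succ, add_assoc]

/-- A linear form over `L` without zeros over `K` is not proportional to its conjugate. -/
theorem mul_phi_sub_ne_zero (hL : finrank K L = 3) {a b : L}
    (h : ∀ x : Fin 2 → K, x ≠ 0 → a * algebraMap K L (x 0) + b * algebraMap K L (x 1) ≠ 0) :
    a * phi K L b - b * phi K L a ≠ 0 := by
  intro h0
  have hb : b ≠ 0 := by simpa using h ![0, 1] (by simp)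
  have hb' : phi K L b ≠ 0 := by simpa using hb
  have h1 : phi K L (a / b) = a / b := by
    rw [map_div₀]
    field_simp
    linear_combination -h0
  obtain ⟨k, hk⟩ := (phi_eq_self_iff hL).1 h1
  apply h ![1, -k] (by simp)
  simp [hk]
  field_simp
  ring

theorem mul_phi_phi_sub_ne_zero (hL : finrank K L = 3) {a b : L}
    (h : a * phi K L b - b * phi K L a ≠ 0) :
    a * phi K L (phi K L b) - b * phi K L (phi K L a) ≠ 0 := by
  intro h0
  apply h
  have h1 := congrArg (phi K L) h0
  simp only [map_sub, map_mul, phi_phi_phi hL, map_zero] at h1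
  linear_combination -h1

/-- The coefficients of the product of the two conjugates of a linear form without zeros over `K`
are linearly independent over `K`. -/
theorem coeff_indep (hL : finrank K L = 3) {a b : L}
    (h : ∀ x : Fin 2 → K, x ≠ 0 → a * algebraMap K L (x 0) + b * algebraMap K L (x 1) ≠ 0)
    {k₀ k₁ k₂ : K} (h0 : algebraMap K L k₀ * (phi K L a * phi K L (phi K L a)) +
      algebraMap K L k₁ * (phi K L a * phi K L (phi K L b) + phi K L b * phi K L (phi K L a)) +
      algebraMap K L k₂ * (phi K L b * phi K L (phi K L b)) = 0) :
    k₀ = 0 ∧ k₁ = 0 ∧ k₂ = 0 := by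
  have hd := mul_phi_phi_sub_ne_zero hL (mul_phi_sub_ne_zero hL h)
  have h1 := congrArg (phi K L) (congrArg (phi K L) h0)
  simp only [map_add, map_mul, phi_phi_phi hL, map_zero, AlgHom.commutes] at h1
  have hp : (a * phi K L (phi K L b) - b * phi K L (phi K L a)) *
      (algebraMap K L k₀ * phi K L a + algebraMap K L k₁ * phi K L b) = 0 := by
    linear_combination phi K L (phi K L b) * h1 - b * h0
  have hr : (a * phi K L (phi K L b) - b * phi K L (phi K L a)) *
      (algebraMap K L k₁ * phi K L a + algebraMap K L k₂ * phi K L b) = 0 := by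
    linear_combination a * h0 - phi K L (phi K L a) * h1
  have key : ∀ {k l : K}, algebraMap K L k * phi K L a + algebraMap K L l * phi K L b = 0 →
      k = 0 ∧ l = 0 := by
    intro k l hkl
    by_contra hne
    apply h ![k, l] (by simpa using hne)
    apply phi_injective (K := K)
    simp only [map_add, map_mul, AlgHom.commutes, map_zero, Matrix.cons_val_zero,
      Matrix.cons_val_one]
    linear_combination hkl
  obtain ⟨hk0, hk1⟩ := key ((mul_eq_zero.1 hp).resolve_left hd)
  exact ⟨hk0, hk1, (key ((mul_eq_zero.1 hr).resolve_left hd)).2⟩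

theorem finrank_span_pair_of_map {K L : Type*} [Field K] [Field L] [Algebra K L]
    {c : V7 L →ₗ[L] (Fin 3 → L)} {u v : V7 K} {x : Fin 2 → K}
    (hx : x ≠ 0) {a : L} (ha : a ≠ 0) (hu : c (incl K L u) = a • ![0, 0, 1])
    (hv : c (incl K L v) = a • ![algebraMap K L (x 0), algebraMap K L (x 1), 0]) :
    finrank K (Submodule.span K {u, v}) = 2 := by
  have hli : LinearIndependent K ![u, v] := by
    rw [LinearIndependent.pair_iff]
    intro s t hst
    have h := map_comb hu hv s t
    rw [hst, map_zero, map_zero] at h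
    have h1 : ![t * x 0, t * x 1, s] = 0 := emb_injective (L := L)
      (((smul_eq_zero.1 h.symm).resolve_left ha).trans emb_zero.symm)
    refine ⟨congrFun h1 2, ?_⟩
    by_contra ht
    apply hx
    ext i
    fin_cases i
    · exact (mul_eq_zero.1 (congrFun h1 0)).resolve_left ht
    · exact (mul_eq_zero.1 (congrFun h1 1)).resolve_left ht
  have h := finrank_span_eq_card hli
  rwa [Matrix.range_cons_cons_empty, Fintype.card_fin] at h

/-- Every tangent subplane comes from a special surface. With `l = Λ (x 0, x 1, 0)`, the points
`(0, 0, 1)` and `(x 0, x 1, 0)` are multiplied by the product of the conjugates `l^q` and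
`l^(q^2)`: this gives a conic, and, since `l l^q l^(q^2)` is a form over `K`, a normal rational
curve over `K`. -/
theorem exists_isStdSurface_isSpecial (hL : finrank K L = 3) (hc : IsCoord H g c Λ)
    (hS : IsRegularSpread H S g) (hinf : Λ ![0, 0, 1] = 0)
    (haff : ∀ x : Fin 2 → K, x ≠ 0 → Λ ![algebraMap K L (x 0), algebraMap K L (x 1), 0] ≠ 0) :
    ∃ R : RuledSurface K, IsStdSurface c Λ R ∧ R.IsSpecial H S g := by
  obtain ⟨α, hα⟩ : ∃ α, α = Λ ![1, 0, 0] := ⟨_, rfl⟩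
  obtain ⟨β, hβ⟩ : ∃ β, β = Λ ![0, 1, 0] := ⟨_, rfl⟩
  have hΛ : ∀ x y z, Λ ![x, y, z] = α * x + β * y := by
    intro x y z
    rw [map_vec_eq hinf, hα, hβ, mul_comm, mul_comm (Λ _), ← smul_eq_mul, ← smul_eq_mul,
      ← map_smul, ← map_smul, ← map_add]
    congr 1
    ext i
    fin_cases i <;> simp
  have hℓ : ∀ x : Fin 2 → K, x ≠ 0 →
      α * algebraMap K L (x 0) + β * algebraMap K L (x 1) ≠ 0 := by
    intro x hx
    rw [← hΛ _ _ 0]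
    exact haff x hx
  let ℓ : (Fin 2 → L) → L := fun x => α * x 0 + β * x 1
  let ℓ₁ : (Fin 2 → L) → L := fun x => phi K L α * x 0 + phi K L β * x 1
  let ℓ₂ : (Fin 2 → L) → L := fun x => phi K L (phi K L α) * x 0 + phi K L (phi K L β) * x 1
  let a₀ := phi K L α * phi K L (phi K L α)
  let a₁ := phi K L α * phi K L (phi K L β) + phi K L β * phi K L (phi K L α)
  let a₂ := phi K L β * phi K L (phi K L β)
  -- the coefficient vectors
  have hconic : ∀ i : Fin 3, ∃ v : V7 K, c (incl K L v) = ![a₀, a₁, a₂] i • ![0, 0, 1] :=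
    fun i => hc.surj _ ⟨0, by rw [map_smul, hinf, smul_zero, map_zero]⟩
  choose C hC using hconic
  have hnrc : ∀ i : Fin 4, ∃ v : V7 K, c (incl K L v) =
      ![![a₀, 0, 0], ![a₁, a₀, 0], ![a₂, a₁, 0], ![0, a₂, 0]] i := by
    refine fun i => hc.surj _ ((phi_eq_self_iff hL).1 ?_)
    fin_cases i <;> simp [hΛ, a₀, a₁, a₂, phi_phi_phi hL] <;> ring
  choose N hN using hnrc
  have hCcurve : ∀ x, c (curve (fun i => incl K L (C i)) x) =
      (ℓ₁ x * ℓ₂ x) • ![0, 0, 1] := by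
    intro x
    simp only [curve_two, map_add, map_smul, hC]
    ext i
    fin_cases i <;> simp [ℓ₁, ℓ₂, a₀, a₁, a₂]
    ring
  have hNcurve : ∀ x, c (curve (fun i => incl K L (N i)) x) =
      (ℓ₁ x * ℓ₂ x) • ![x 0, x 1, 0] := by
    intro x
    simp only [curve_three, map_add, map_smul, hN]
    ext i
    fin_cases i <;> simp [ℓ₁, ℓ₂, a₀, a₁, a₂] <;> ring
  have hℓ₁ : ∀ x : Fin 2 → L, ℓ₁ (fr K x) = phi K L (ℓ x) := fun x => by simp [ℓ, ℓ₁]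
  have hℓ₂ : ∀ x : Fin 2 → L, ℓ₂ (fr K (fr K x)) = phi K L (phi K L (ℓ x)) := fun x => by
    simp [ℓ, ℓ₂]
  have hne : ∀ x : Fin 2 → K, x ≠ 0 → ℓ₁ (emb L x) * ℓ₂ (emb L x) ≠ 0 := by
    intro x hx
    have hfr : fr K (emb L x) = emb L x := fr_algebraMap x
    have h1 := hℓ₁ (emb L x)
    have h2 := hℓ₂ (emb L x)
    rw [hfr] at h1
    rw [hfr, hfr] at h2
    rw [h1, h2]
    have h0 : ℓ (emb L x) ≠ 0 := hℓ x hx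
    simpa only [ne_eq, mul_eq_zero, map_eq_zero, or_self] using h0
  have hCK : ∀ x : Fin 2 → K, c (incl K L (curve C x)) =
      (ℓ₁ (emb L x) * ℓ₂ (emb L x)) • ![0, 0, 1] := fun x => by rw [incl_curve, hCcurve]
  have hNK : ∀ x : Fin 2 → K, c (incl K L (curve N x)) =
      (ℓ₁ (emb L x) * ℓ₂ (emb L x)) • ![algebraMap K L (x 0), algebraMap K L (x 1), 0] :=
    fun x => by rw [incl_curve, hNcurve]; rfl
  let R : RuledSurface K :=
    { conic := C
      conic_indep := by
        rw [Fintype.linearIndependent_iff]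
        intro k hk
        have h := congrArg (fun v => c (incl K L v) 2) hk
        simp only [Fin.sum_univ_three, map_add, incl_smul, map_zero] at h
        simp only [map_smul, hC] at h
        obtain ⟨h0, h1, h2⟩ := coeff_indep hL hℓ (k₀ := k 0) (k₁ := k 1) (k₂ := k 2)
          (by simpa [a₀, a₁, a₂, Algebra.smul_def, mul_add] using h)
        intro i
        fin_cases i
        · exact h0
        · exact h1
        · exact h2
      nrc := N
      nrc_indep := by
        rw [Fintype.linearIndependent_iff]
        intro k hk
        have h := congrArg (fun v => c (incl K L v) 0) hk
        have h' := congrArg (fun v => c (incl K L v) 1) hk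
        simp only [Fin.sum_univ_four, map_add, incl_smul, map_zero] at h h'
        simp only [map_smul, hN] at h h'
        obtain ⟨h0, h1, h2⟩ := coeff_indep hL hℓ (k₀ := k 0) (k₁ := k 1) (k₂ := k 2)
          (by simpa [a₀, a₁, a₂, Algebra.smul_def, mul_add] using h)
        obtain ⟨-, -, h3⟩ := coeff_indep hL hℓ (k₀ := k 1) (k₁ := k 2) (k₂ := k 3)
          (by simpa [a₀, a₁, a₂, Algebra.smul_def, mul_add] using h')
        intro i
        fin_cases i
        · exact h0
        · exact h1
        · exact h2
        · exact h3
      proj := 1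
      join_line := fun x hx => by
        rw [join, Units.val_one, Matrix.one_mulVec]
        exact finrank_span_pair_of_map hx (hne x hx) (hCK x) (hNK x) }
  refine ⟨R, ⟨hinf, haff, fun x hx => ⟨_, hne x hx, hCK x, ?_⟩⟩, ?_⟩
  · have h1 : R.proj.val.mulVec x = x := by simp [R]
    rw [h1]
    exact hNK x
  · let y : Fin 2 → L := ![-β, α]
    have hy : ℓ y = 0 := by simp [ℓ, y]; ring
    have hβα := mul_phi_sub_ne_zero hL hℓ
    have hβα' := mul_phi_phi_sub_ne_zero hL hβα
    have hy12 : ℓ₁ y * ℓ₂ y ≠ 0 := by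
      refine mul_ne_zero (fun h => hβα ?_) (fun h => hβα' ?_)
      · simp only [ℓ₁, y, Matrix.cons_val_zero, Matrix.cons_val_one] at h
        linear_combination h
      · simp only [ℓ₂, y, Matrix.cons_val_zero, Matrix.cons_val_one] at h
        linear_combination h
    have hα0 : α ≠ 0 := by simpa using hℓ ![1, 0] (by simp)
    have hy1 : ℓ₁ (fr K y) * ℓ₂ (fr K y) = 0 := by rw [hℓ₁, hy, map_zero, zero_mul]
    have hy2 : ℓ₁ (fr K (fr K y)) * ℓ₂ (fr K (fr K y)) = 0 := by
      rw [hℓ₂, hy, map_zero, map_zero, mul_zero]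
    have hyA : (R.proj.val.map (algebraMap K L)).mulVec y = y := by simp [R]
    have hyC : curve (fun i => incl K L (R.conic i)) y ∈ g := by
      rw [hc.mem_line, fr_curve, fr_curve]
      refine ⟨(hCcurve _).trans ?_, (hCcurve _).trans ?_⟩
      · rw [hy1, zero_smul]
      · rw [hy2, zero_smul]
    have hyN : curve (fun i => incl K L (R.nrc i)) y ∈ g := by
      rw [hc.mem_line, fr_curve, fr_curve]
      refine ⟨(hNcurve _).trans ?_, (hNcurve _).trans ?_⟩
      · rw [hy1, zero_smul]
      · rw [hy2, zero_smul]
    refine R.isSpecial_of_mem hL hc hS (W := ptOf K c ![0, 0, 1]) (x := y) ?_ ?_ ⟨0, ?_⟩ hyC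
      (hyA.symm ▸ hyN) ?_
    · exact (hc.mem_spread hL hS _).2 ⟨_, by simp, hinf, rfl⟩
    · exact fun i => mem_ptOf.2 ⟨_, hC i⟩
    · change N 0 ∉ H
      rw [hc.mem_hyperplane, hN]
      simp [hΛ, a₀, hα0]
    · rw [hyA, LinearIndependent.pair_iff]
      intro s t hst
      have h := congrArg c hst
      rw [map_add, map_smul, map_smul, map_zero] at h
      have h' : s • (ℓ₁ y * ℓ₂ y) • ![0, 0, 1] + t • (ℓ₁ y * ℓ₂ y) • ![y 0, y 1, 0] = 0 := by
        rw [← hCcurve, ← hNcurve]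
        exact h
      have h1 := congrFun h' 1
      have h2 := congrFun h' 2
      simp only [Pi.add_apply, Pi.smul_apply, smul_eq_mul, Matrix.cons_val_one,
        Matrix.cons_val, mul_zero, mul_one, zero_add, add_zero, Pi.zero_apply] at h1 h2
      refine ⟨(mul_eq_zero.1 h2).resolve_right hy12, (mul_eq_zero.1 h1).resolve_right ?_⟩
      exact mul_ne_zero hy12 hα0

end StdSurface

/-! ### Ruled surfaces that correspond to tangent subplanes -/

section Tangent

variable {K L : Type*} [Field K] [Field L] [Algebra K L]
  {c : V7 L →ₗ[L] (Fin 3 → L)} {Λ : (Fin 3 → L) →ₗ[L] L}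
  {H : Submodule K (V7 K)} {S B : Set (Submodule K (V7 K))} {g : Submodule L (V7 L)}

theorem exists_span_pair_eq {K : Type*} [Field K] {H J : Submodule K (V7 K)}
    (hH : finrank K H = 6) (hJ : finrank K J = 2) (hJH : ¬ J ≤ H) :
    ∃ a v, a ∉ H ∧ v ∈ H ∧ v ≠ 0 ∧ J = Submodule.span K {a, v} := by
  obtain ⟨a, haJ, haH⟩ := SetLike.not_le_iff_exists.1 hJH
  have h1 := Submodule.finrank_sup_add_finrank_inf_eq J H
  have h2 := Submodule.finrank_le (J ⊔ H)
  rw [finrank_fin_fun] at h2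
  have h3 : J ⊓ H ≠ ⊥ := by
    intro h
    rw [h, finrank_bot] at h1
    omega
  obtain ⟨v, ⟨hvJ, hvH⟩, hv0⟩ := (Submodule.ne_bot_iff _).1 h3
  refine ⟨a, v, haH, hvH, hv0, Eq.symm ?_⟩
  have hli : LinearIndependent K ![v, a] := by
    rw [LinearIndependent.pair_iff' hv0]
    rintro k rfl
    exact haH (H.smul_mem k hvH)
  refine Submodule.eq_of_le_of_finrank_le ?_ ?_
  · rw [Submodule.span_le]
    rintro _ (rfl | rfl)
    · exact haJ
    · exact hvJ
  · have h := finrank_span_eq_card hli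
    rw [Matrix.range_cons_cons_empty, Fintype.card_fin, Set.pair_comm] at h
    rw [h, hJ]

theorem join_smul {F : Type*} [Field F] (a : Fin 3 → V7 F) (b : Fin 4 → V7 F)
    (A : Matrix (Fin 2) (Fin 2) F) {k : F} (hk : k ≠ 0) (x : Fin 2 → F) :
    join a b A (k • x) = join a b A x := by
  have h2 : IsUnit (k ^ 2) := (IsUnit.mk0 k hk).pow 2
  have h3 : IsUnit (k ^ 3) := (IsUnit.mk0 k hk).pow 3
  rw [join, Matrix.mulVec_smul, curve_smul, curve_smul, Submodule.span_insert,
    Submodule.span_singleton_smul_eq h2, Submodule.span_singleton_smul_eq h3,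
    ← Submodule.span_insert, join]

theorem exists_smul_rep {F : Type*} [Field F] {x : Fin 2 → F} (hx : x ≠ 0) :
    ∃ k : F, k ≠ 0 ∧ x = k • (Projectivization.mk F x hx).rep := by
  obtain ⟨a, ha⟩ := Projectivization.exists_smul_eq_mk_rep F x hx
  refine ⟨(a⁻¹ : Fˣ), (a⁻¹).ne_zero, ?_⟩
  rw [← ha]
  exact (inv_smul_smul a x).symm

theorem CorrespondsTo.span_mem {R : RuledSurface K} (hR : CorrespondsTo H S R.points B)
    {x : Fin 2 → K} (hx : x ≠ 0) {v : V7 K} (hv : v ∈ join R.conic R.nrc R.proj.val x)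
    (hvH : v ∉ H) : Submodule.span K {v} ∈ B := by
  have hv0 : v ≠ 0 := by
    rintro rfl
    exact hvH H.zero_mem
  rw [hR]
  refine ⟨Or.inl ⟨finrank_span_singleton hv0,
    fun h => hvH (h (Submodule.mem_span_singleton_self v))⟩,
    Projectivization.mk K v hv0, ⟨x, hx, ?_⟩, ?_⟩
  · rwa [Projectivization.submodule_mk, Submodule.span_singleton_le_iff_mem]
  · rw [Projectivization.submodule_mk]

theorem CorrespondsTo.exists_eq_span (hS : IsRegularSpread H S g) {R : RuledSurface K}
    (hR : CorrespondsTo H S R.points B) {W : Submodule K (V7 K)} (hW : W ∈ B) (hWH : ¬ W ≤ H) :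
    ∃ x : Fin 2 → K, x ≠ 0 ∧ ∃ v ∈ join R.conic R.nrc R.proj.val x, v ∉ H ∧
      W = Submodule.span K {v} := by
  rw [hR] at hW
  obtain ⟨h | h, p, ⟨x, hx, hpx⟩, hpW⟩ := hW
  · have hpW' : p.submodule = W :=
      Submodule.eq_of_le_of_finrank_le hpW (by rw [h.1, p.finrank_submodule])
    rw [p.submodule_eq] at hpW' hpx
    refine ⟨x, hx, p.rep, (Submodule.span_singleton_le_iff_mem _ _).1 hpx, fun h' => hWH ?_,
      hpW'.symm⟩
    rwa [← hpW', Submodule.span_singleton_le_iff_mem]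
  · exact absurd (hS.plane W h).1 hWH

theorem IsTangent.ncard_affine (hB : IsSubplane H S (Nat.card K) B) (hT : IsTangent H B) :
    {W | W ∈ B ∧ ¬ W ≤ H}.ncard = Nat.card K ^ 2 + Nat.card K := by
  obtain ⟨W, hW, hW'⟩ := hT
  have h : {W | W ∈ B ∧ ¬ W ≤ H} = B \ {W} := by
    ext V
    refine and_congr_right fun hV => not_congr ⟨fun h => hW' V ⟨hV, h⟩, ?_⟩
    rintro rfl
    exact hW.2
  rw [h, Set.ncard_sdiff_singleton_of_mem hW.1, hB.card, Nat.add_sub_cancel]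

/-- The line `J` is the generator with parameter `y` of the special surface of the tangent subplane
given by the coordinates. -/
def IsGen (c : V7 L →ₗ[L] (Fin 3 → L)) (Λ : (Fin 3 → L) →ₗ[L] L) (y : Fin 2 → K)
    (J : Submodule K (V7 K)) : Prop :=
  ∀ v, v ∈ J ↔ ∃ s t : K, c (incl K L v) =
    (Λ ![algebraMap K L (y 0), algebraMap K L (y 1), 0])⁻¹ • emb L ![t * y 0, t * y 1, s]

theorem IsGen.eq {y : Fin 2 → K} {J J' : Submodule K (V7 K)} (h : IsGen c Λ y J)
    (h' : IsGen c Λ y J') : J = J' := by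
  ext v
  rw [h v, h' v]

theorem IsGen.smul {y : Fin 2 → K} {J : Submodule K (V7 K)} (h : IsGen c Λ y J) {k : K}
    (hk : k ≠ 0) : IsGen c Λ (k • y) J := by
  intro v
  have hΛ : Λ ![algebraMap K L ((k • y) 0), algebraMap K L ((k • y) 1), 0] =
      algebraMap K L k * Λ ![algebraMap K L (y 0), algebraMap K L (y 1), 0] := by
    rw [← smul_eq_mul, ← map_smul]
    congr 1
    ext i
    fin_cases i <;> simp
  have hv : ∀ s t : K,
      (Λ ![algebraMap K L ((k • y) 0), algebraMap K L ((k • y) 1), 0])⁻¹ •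
        emb L ![t * (k • y) 0, t * (k • y) 1, s] =
      (Λ ![algebraMap K L (y 0), algebraMap K L (y 1), 0])⁻¹ •
        emb L ![t * y 0, t * y 1, k⁻¹ * s] := by
    intro s t
    have hk' : algebraMap K L k ≠ 0 := by simpa using hk
    rw [hΛ]
    ext i
    fin_cases i <;> simp <;> field_simp
  rw [h v]
  constructor
  · rintro ⟨s, t, hst⟩
    refine ⟨k * s, t, ?_⟩
    rw [hv, inv_mul_cancel_left₀ hk, hst]
  · rintro ⟨s, t, hst⟩
    exact ⟨k⁻¹ * s, t, by rw [← hv, hst]⟩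

theorem IsGen.exists_smul_eq {y y' : Fin 2 → K}
    (hy : y ≠ 0) (hy' : y' ≠ 0)
    {J : Submodule K (V7 K)} (h : IsGen c Λ y J) {v : V7 K} (hv : v ∈ J) {a : L} {s₀ : K}
    (ha : a ≠ 0) (hva : c (incl K L v) = a • emb L ![y' 0, y' 1, s₀]) :
    ∃ k : K, k ≠ 0 ∧ y' = k • y := by
  obtain ⟨s, t, hst⟩ := (h v).1 hv
  rw [hva] at hst
  obtain ⟨b, hb⟩ : ∃ b, b = (Λ ![algebraMap K L (y 0), algebraMap K L (y 1), 0])⁻¹ := ⟨_, rfl⟩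
  rw [← hb] at hst
  have h1 : emb L y' = (a⁻¹ * b * algebraMap K L t) • emb L y := by
    have h0 := congrFun hst 0
    have h1 := congrFun hst 1
    simp only [Pi.smul_apply, smul_eq_mul, emb_apply, Matrix.cons_val_zero,
      Matrix.cons_val_one, map_mul] at h0 h1
    ext i
    fin_cases i
    · simp only [Pi.smul_apply, smul_eq_mul, emb_apply, Fin.zero_eta]
      field_simp
      linear_combination h0
    · simp only [Pi.smul_apply, smul_eq_mul, emb_apply, Fin.mk_one]
      field_simp
      linear_combination h1
  obtain ⟨k, -, hk⟩ := exists_of_emb_eq_smul hy h1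
  exact ⟨k, fun h => hy' (by rw [hk, h, zero_smul]), hk⟩

variable [Finite K]

/-- Each generator that is not at infinity has `q` points outside the hyperplane at infinity. -/
theorem ncard_affine_le (hH : finrank K H = 6) (hS : IsRegularSpread H S g) {R : RuledSurface K}
    (hR : CorrespondsTo H S R.points B) :
    {W | W ∈ B ∧ ¬ W ≤ H}.ncard ≤
      {p : ℙ K (Fin 2 → K) | ¬ join R.conic R.nrc R.proj.val p.rep ≤ H}.ncard * Nat.card K := by
  have hJ : ∀ p : ℙ K (Fin 2 → K), ¬ join R.conic R.nrc R.proj.val p.rep ≤ H → ∃ a v, a ∉ H ∧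
      v ∈ H ∧ v ≠ 0 ∧ join R.conic R.nrc R.proj.val p.rep = Submodule.span K {a, v} :=
    fun p hp => exists_span_pair_eq hH (R.join_line _ p.rep_nonzero) hp
  choose! a v ha hv hv0 hav using hJ
  let f : ℙ K (Fin 2 → K) × K → Submodule K (V7 K) :=
    fun pt => Submodule.span K {a pt.1 + pt.2 • v pt.1}
  have hsub : {W | W ∈ B ∧ ¬ W ≤ H} ⊆
      f '' ({p | ¬ join R.conic R.nrc R.proj.val p.rep ≤ H} ×ˢ Set.univ) := by
    rintro W ⟨hW, hWH⟩
    obtain ⟨x, hx, w, hw, hwH, rfl⟩ := hR.exists_eq_span hS hW hWH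
    obtain ⟨k, hk, hxk⟩ := exists_smul_rep hx
    rw [hxk, join_smul _ _ _ hk] at hw
    obtain ⟨p, hp⟩ : ∃ p, p = Projectivization.mk K x hx := ⟨_, rfl⟩
    rw [← hp] at hw
    have hpH : ¬ join R.conic R.nrc R.proj.val p.rep ≤ H := fun h => hwH (h hw)
    rw [hav p hpH, Submodule.mem_span_pair] at hw
    obtain ⟨s, t, rfl⟩ := hw
    have hs : s ≠ 0 := by
      rintro rfl
      rw [zero_smul, zero_add] at hwH
      exact hwH (H.smul_mem t (hv p hpH))
    refine ⟨(p, s⁻¹ * t), ⟨hpH, trivial⟩, ?_⟩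
    change Submodule.span K {a p + (s⁻¹ * t) • v p} = _
    rw [← Submodule.span_singleton_smul_eq (IsUnit.mk0 s hs), smul_add, smul_smul,
      mul_inv_cancel_left₀ hs]
  calc _ ≤ (f '' ({p | ¬ join R.conic R.nrc R.proj.val p.rep ≤ H} ×ˢ Set.univ)).ncard :=
        Set.ncard_le_ncard hsub (Set.toFinite _)
    _ ≤ _ := Set.ncard_image_le (Set.toFinite _)
    _ = _ := by rw [Set.ncard_prod, Set.ncard_univ]

theorem card_projectivization_two : Nat.card (ℙ K (Fin 2 → K)) = Nat.card K + 1 :=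
  Projectivization.card_of_finrank_two K _ (finrank_fin_fun K)

theorem IsTangent.not_join_le (hH : finrank K H = 6) (hS : IsRegularSpread H S g)
    {R : RuledSurface K} (hB : IsSubplane H S (Nat.card K) B) (hT : IsTangent H B)
    (hR : CorrespondsTo H S R.points B) {x : Fin 2 → K} (hx : x ≠ 0) :
    ¬ join R.conic R.nrc R.proj.val x ≤ H := by
  have h1 := ncard_affine_le hH hS hR
  rw [hT.ncard_affine hB, sq, ← Nat.succ_mul] at h1
  have h2 := Nat.le_of_mul_le_mul_right h1 Nat.card_pos
  have h3 : {p : ℙ K (Fin 2 → K) | ¬ join R.conic R.nrc R.proj.val p.rep ≤ H} = Set.univ := by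
    refine Set.eq_of_subset_of_ncard_le (Set.subset_univ _) ?_ (Set.toFinite _)
    rwa [Set.ncard_univ, card_projectivization_two]
  obtain ⟨k, hk, hxk⟩ := exists_smul_rep hx
  rw [hxk, join_smul _ _ _ hk]
  exact h3.symm.subset (Set.mem_univ _)

theorem IsTangent.exists_isCoord (hL : finrank K L = 3) (hH : finrank K H = 6)
    (hS : IsRegularSpread H S g) (hB : IsSubplane H S (Nat.card K) B) (hT : IsTangent H B) :
    ∃ (c : V7 L →ₗ[L] (Fin 3 → L)) (Λ : (Fin 3 → L) →ₗ[L] L), IsCoord H g c Λ ∧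
      B = stdSubplane K c ∧ Λ ![0, 0, 1] = 0 ∧
      ∀ x : Fin 2 → K, x ≠ 0 → Λ ![algebraMap K L (x 0), algebraMap K L (x 1), 0] ≠ 0 := by
  obtain ⟨c₀, Λ₀, hc₀⟩ := exists_isCoord' hL hH hS
  obtain ⟨c₁, Λ₁, hc₁, rfl⟩ := exists_isCoord_eq_stdSubplane hL hc₀ hS hB
  obtain ⟨W, ⟨⟨z, hz, rfl⟩, hW⟩, hW'⟩ := hT
  obtain ⟨c, Λ, hc, hcB, hcz, hΛz⟩ := exists_isCoord_point hc₁ hz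
  rw [hc₁.ptOf_le] at hW
  rw [hW] at hΛz
  refine ⟨c, Λ, hc, hcB.symm, hΛz, fun x hx h => hx ?_⟩
  have hv : ![algebraMap K L (x 0), algebraMap K L (x 1), 0] = emb L ![x 0, x 1, 0] := by
    ext i
    fin_cases i <;> simp
  have he : (![0, 0, 1] : Fin 3 → L) = emb L ![(0 : K), 0, 1] := by
    ext i
    fin_cases i <;> simp
  by_contra hx0
  have hx3 : ![x 0, x 1, 0] ≠ 0 := by
    intro h3
    apply hx0
    ext i
    fin_cases i
    · exact congrFun h3 0
    · exact congrFun h3 1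
  have h1 := hW' (ptOf K c (emb L ![x 0, x 1, 0])) ⟨hcB ▸ ⟨_, hx3, rfl⟩, by
    rwa [hc.ptOf_le, ← hv]⟩
  rw [← hcz, he, hc.ptOf_eq_iff (emb_ne_zero (by simp))] at h1
  obtain ⟨a, -, ha⟩ := h1
  simpa using congrFun ha 2

theorem isGen_span_pair (hL : finrank K L = 3) (hc : IsCoord H g c Λ) (hinf : Λ ![0, 0, 1] = 0)
    (haff : ∀ x : Fin 2 → K, x ≠ 0 → Λ ![algebraMap K L (x 0), algebraMap K L (x 1), 0] ≠ 0)
    {y : Fin 2 → K} (hy : y ≠ 0) {a v : V7 K} {l : L} {s₀ k : K} (hl : l ≠ 0) (hk : k ≠ 0)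
    (ha : c (incl K L a) = l • emb L ![y 0, y 1, s₀])
    (hv : c (incl K L v) = (l * algebraMap K L k) • ![0, 0, 1]) :
    IsGen c Λ y (Submodule.span K {a, v}) := by
  obtain ⟨m, hm⟩ := hc.mem_range hL a
  obtain ⟨ℓ, hℓ⟩ : ∃ ℓ, ℓ = Λ ![algebraMap K L (y 0), algebraMap K L (y 1), 0] := ⟨_, rfl⟩
  have hℓ0 : ℓ ≠ 0 := hℓ ▸ haff y hy
  have he : emb L ![y 0, y 1, s₀] = ![algebraMap K L (y 0), algebraMap K L (y 1),
      algebraMap K L s₀] := by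
    ext i
    fin_cases i <;> simp
  rw [ha, map_smul, he, map_vec_eq hinf, ← hℓ, smul_eq_mul] at hm
  have hm0 : m ≠ 0 := by
    rintro rfl
    rw [map_zero] at hm
    exact mul_ne_zero hl hℓ0 hm.symm
  obtain rfl : l = ℓ⁻¹ * algebraMap K L m := by
    rw [hm]
    field_simp
  have hcomb : ∀ s t : K, c (incl K L (s • a + t • v)) =
      ℓ⁻¹ • emb L ![m * s * y 0, m * s * y 1, m * (s * s₀ + t * k)] := by
    intro s t
    rw [map_add, incl_smul, incl_smul, map_add, map_smul, map_smul, ha, hv]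
    ext i
    fin_cases i <;> simp [Algebra.smul_def] <;> ring
  intro w
  rw [← hℓ, Submodule.mem_span_pair]
  constructor
  · rintro ⟨s, t, rfl⟩
    exact ⟨_, _, hcomb s t⟩
  · rintro ⟨s, t, hst⟩
    refine ⟨m⁻¹ * t, (m⁻¹ * s - m⁻¹ * t * s₀) * k⁻¹, hc.injective ?_⟩
    have h1 : m * (m⁻¹ * t) = t := mul_inv_cancel_left₀ hm0 t
    have h2 : m * (m⁻¹ * t * s₀ + (m⁻¹ * s - m⁻¹ * t * s₀) * k⁻¹ * k) = s := by
      rw [inv_mul_cancel_right₀ hk, add_sub_cancel, mul_inv_cancel_left₀ hm0]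
    rw [hcomb, hst, h1, h2]

theorem IsStdSurface.isGen (hL : finrank K L = 3) (hc : IsCoord H g c Λ) {R : RuledSurface K}
    (hR : IsStdSurface c Λ R) {x : Fin 2 → K} (hx : x ≠ 0) :
    IsGen c Λ x (join R.conic R.nrc R.proj.val x) := by
  obtain ⟨a, ha, hC, hN⟩ := hR.gen x hx
  rw [join, Set.pair_comm]
  refine isGen_span_pair hL hc hR.inf hR.aff hx (s₀ := 0) ha one_ne_zero ?_ ?_
  · rw [hN]
    congr 1
    ext i
    fin_cases i <;> simp
  · rw [hC, map_one, mul_one]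

/-- If a ruled surface corresponds to a tangent subplane, then its generators are generators of the
special surface: a generator meets the hyperplane at infinity in a point `v` of the spread element
of the subplane, and if `a` is another point of the generator, then `a` and `a + v` are affine
points of the subplane, which determines the factor of `v` up to `K`. -/
theorem exists_isGen (hL : finrank K L = 3) (hH : finrank K H = 6) (hc : IsCoord H g c Λ)
    (hS : IsRegularSpread H S g) (hinf : Λ ![0, 0, 1] = 0)
    (haff : ∀ x : Fin 2 → K, x ≠ 0 → Λ ![algebraMap K L (x 0), algebraMap K L (x 1), 0] ≠ 0)
    {R : RuledSurface K} (hT : IsTangent H (stdSubplane K c))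
    (hR : CorrespondsTo H S R.points (stdSubplane K c)) {x : Fin 2 → K} (hx : x ≠ 0) :
    ∃ y : Fin 2 → K, y ≠ 0 ∧ IsGen c Λ y (join R.conic R.nrc R.proj.val x) := by
  have hJ := hT.not_join_le hH hS (isSubplane_stdSubplane hL hc hS) hR hx
  obtain ⟨a, v, haH, hvH, hv0, hav⟩ := exists_span_pair_eq hH (R.join_line x hx) hJ
  have haJ : a ∈ join R.conic R.nrc R.proj.val x := hav ▸ Submodule.subset_span (by simp)
  have hvJ : v ∈ join R.conic R.nrc R.proj.val x := hav ▸ Submodule.subset_span (by simp)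
  have he : (![0, 0, 1] : Fin 3 → L) = emb L ![(0 : K), 0, 1] := by
    ext i
    fin_cases i <;> simp
  -- affine points of the generator
  have hpt : ∀ u ∈ join R.conic R.nrc R.proj.val x, u ∉ H →
      ∃ (z : Fin 3 → K) (l : L), l ≠ 0 ∧ c (incl K L u) = l • emb L z := by
    intro u hu huH
    obtain ⟨z, hz, hzu⟩ := hR.span_mem hx hu huH
    obtain ⟨l, hl⟩ := mem_ptOf.1 (hzu.le (Submodule.mem_span_singleton_self u))
    refine ⟨z, l, ?_, hl⟩
    rintro rfl
    rw [zero_smul] at hl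
    rw [hc.eq_zero hl] at huH
    exact huH H.zero_mem
  -- the point at infinity
  have hve : v ∈ ptOf K c ![0, 0, 1] := by
    obtain ⟨W, ⟨hWS, hvW⟩, -⟩ := hS.partition v hvH hv0
    have hWB : W ∈ stdSubplane K c := by
      rw [hR]
      refine ⟨Or.inr hWS, Projectivization.mk K v hv0, ⟨x, hx, ?_⟩, ?_⟩
      · rwa [Projectivization.submodule_mk, Submodule.span_singleton_le_iff_mem]
      · rwa [Projectivization.submodule_mk, Submodule.span_singleton_le_iff_mem]
    have heB : ptOf K c ![0, 0, 1] ∈ stdSubplane K c := he ▸ ⟨_, by simp, rfl⟩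
    rwa [hT.unique ⟨hWB, (hS.plane W hWS).1⟩ ⟨heB, (hc.ptOf_le _).2 hinf⟩] at hvW
  obtain ⟨m, hm⟩ := mem_ptOf.1 hve
  obtain ⟨z, l, hl, hz⟩ := hpt a haJ haH
  obtain ⟨z', l', -, hz'⟩ := hpt (a + v) (add_mem haJ hvJ) fun h => haH (by
    simpa using H.sub_mem h hvH)
  have hy : ![z 0, z 1] ≠ 0 := by
    intro h
    have h0 : z 0 = 0 := congrFun h 0
    have h1 : z 1 = 0 := congrFun h 1
    apply haH
    have hze : emb L z = algebraMap K L (z 2) • ![0, 0, 1] := by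
      ext i
      fin_cases i <;> simp [h0, h1]
    rw [hc.mem_hyperplane, hz, hze, map_smul, map_smul, hinf, smul_zero, smul_zero]
  have hsum : l • emb L z + m • ![0, 0, 1] = l' • emb L z' := by
    rw [← hz, ← hm, ← map_add, ← map_add, hz']
  have h0 := congrFun hsum 0
  have h1 := congrFun hsum 1
  have h2 := congrFun hsum 2
  simp only [Pi.add_apply, Pi.smul_apply, smul_eq_mul, emb_apply, Matrix.cons_val_zero,
    Matrix.cons_val_one, Matrix.cons_val, mul_zero, add_zero, mul_one] at h0 h1 h2
  obtain ⟨k, hk⟩ : ∃ k : K, m = l * algebraMap K L k := by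
    have key : ∀ {s s' : K}, s ≠ 0 → l * algebraMap K L s = l' * algebraMap K L s' →
        ∃ k : K, m = l * algebraMap K L k := by
      intro s s' hs hss
      have hs' : algebraMap K L s' ≠ 0 := by
        intro h
        rw [h, mul_zero] at hss
        simp [hl, hs] at hss
      refine ⟨s / s' * z' 2 - z 2, ?_⟩
      have hl' : l' = l * algebraMap K L s / algebraMap K L s' := by
        rw [hss]
        field_simp
      rw [hl'] at h2
      rw [map_sub, map_mul, map_div₀]
      linear_combination h2
    by_cases hz0 : z 0 = 0
    · exact key (fun h => hy (by rw [hz0, h]; simp)) h1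
    · exact key hz0 h0
  have hk0 : k ≠ 0 := by
    rintro rfl
    apply hv0
    apply hc.eq_zero
    rw [hm, hk, map_zero, mul_zero, zero_smul]
  refine ⟨![z 0, z 1], hy, ?_⟩
  rw [hav]
  refine isGen_span_pair hL hc hinf haff hy (s₀ := z 2) hl hk0 ?_ (hk ▸ hm)
  rw [hz]
  congr 2
  ext i
  fin_cases i <;> simp

theorem exists_isGen_join (hL : finrank K L = 3) (hH : finrank K H = 6) (hc : IsCoord H g c Λ)
    (hS : IsRegularSpread H S g) (hinf : Λ ![0, 0, 1] = 0)
    (haff : ∀ x : Fin 2 → K, x ≠ 0 → Λ ![algebraMap K L (x 0), algebraMap K L (x 1), 0] ≠ 0)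
    {R : RuledSurface K} (hT : IsTangent H (stdSubplane K c))
    (hR : CorrespondsTo H S R.points (stdSubplane K c)) {y : Fin 2 → K} (hy : y ≠ 0) :
    ∃ x : Fin 2 → K, x ≠ 0 ∧ IsGen c Λ y (join R.conic R.nrc R.proj.val x) := by
  have hy3 : ![y 0, y 1, 0] ≠ 0 := by
    intro h3
    apply hy
    ext i
    fin_cases i
    · exact congrFun h3 0
    · exact congrFun h3 1
  have hv : emb L ![y 0, y 1, 0] = ![algebraMap K L (y 0), algebraMap K L (y 1), 0] := by
    ext i
    fin_cases i <;> simp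
  obtain ⟨x, hx, w, hw, hwH, hwW⟩ := hR.exists_eq_span hS
    (W := ptOf K c (emb L ![y 0, y 1, 0])) ⟨_, hy3, rfl⟩ (by
      rw [hc.ptOf_le, hv]
      exact haff y hy)
  obtain ⟨a, ha⟩ := mem_ptOf.1 (hwW.symm.le (Submodule.mem_span_singleton_self w))
  have ha0 : a ≠ 0 := by
    rintro rfl
    rw [zero_smul] at ha
    rw [hc.eq_zero ha] at hwH
    exact hwH H.zero_mem
  obtain ⟨y', hy', hg⟩ := exists_isGen hL hH hc hS hinf haff hT hR hx
  obtain ⟨k, hk, rfl⟩ := hg.exists_smul_eq hy' hy hw ha0 ha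
  exact ⟨x, hx, hg.smul hk⟩

theorem points_eq_of_isStdSurface (hL : finrank K L = 3) (hH : finrank K H = 6)
    (hc : IsCoord H g c Λ) (hS : IsRegularSpread H S g) {R R' : RuledSurface K}
    (hT : IsTangent H (stdSubplane K c)) (hR : CorrespondsTo H S R.points (stdSubplane K c))
    (hR' : IsStdSurface c Λ R') : R'.points = R.points := by
  ext p
  constructor
  · rintro ⟨y, hy, hp⟩
    obtain ⟨x, hx, hg⟩ := exists_isGen_join hL hH hc hS hR'.inf hR'.aff hT hR hy
    exact ⟨x, hx, hg.eq (hR'.isGen hL hc hy) ▸ hp⟩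
  · rintro ⟨x, hx, hp⟩
    obtain ⟨y, hy, hg⟩ := exists_isGen hL hH hc hS hR'.inf hR'.aff hT hR hx
    exact ⟨y, hy, hg.eq (hR'.isGen hL hc hy) ▸ hp⟩

end Tangent

/-! ### Quadratic forms with proportional inverses -/

section Quadratic

/-- The binary quadratic form with coefficients `f 0, f 1, f 2`. -/
def quad {L : Type*} [Field L] (f : Fin 3 → L) (x : Fin 2 → L) : L :=
  f 0 * x 0 ^ 2 + f 1 * (x 0 * x 1) + f 2 * x 1 ^ 2

/-- The polynomial with coefficients `f 0, f 1, f 2`. -/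
noncomputable def quadPoly {L : Type*} [Field L] (f : Fin 3 → L) : Polynomial L :=
  Polynomial.C (f 2) * Polynomial.X ^ 2 + Polynomial.C (f 1) * Polynomial.X + Polynomial.C (f 0)

theorem quad_mem_forms {L : Type*} [Field L] (f : Fin 3 → L) : quad f ∈ linForms L ^ 2 := by
  have h0 := coord_mem_linForms (L := L) 0
  have h1 := coord_mem_linForms (L := L) 1
  have h01 := mul_mem_forms (d := 1) (e := 1) (by rwa [pow_one]) (by rwa [pow_one])
    (F := fun x : Fin 2 → L => x 0) (G := fun x => x 1)
  exact Submodule.add_mem _ (Submodule.add_mem _ (const_mul_mem_forms _ (pow_mem_forms h0 2))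
    (const_mul_mem_forms _ h01)) (const_mul_mem_forms _ (pow_mem_forms h1 2))

theorem eval_quadPoly {L : Type*} [Field L] (f : Fin 3 → L) (t : L) :
    (quadPoly f).eval t = quad f ![1, t] := by
  simp [quadPoly, quad]
  ring

theorem coeff_quadPoly {L : Type*} [Field L] (f : Fin 3 → L) (i : Fin 3) :
    (quadPoly f).coeff i = f i := by
  fin_cases i <;> simp [quadPoly, Polynomial.coeff_X, Polynomial.coeff_C]

theorem eq_mul_of_quadPoly_dvd {L : Type*} [Field L] {f f' : Fin 3 → L} (hf : f 2 ≠ 0)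
    (h : quadPoly f ∣ quadPoly f') : ∃ k, ∀ i, f' i = k * f i := by
  obtain ⟨r, hr⟩ := h
  have hdeg : (quadPoly f).natDegree = 2 := Polynomial.natDegree_quadratic hf
  have hdeg' : (quadPoly f').natDegree ≤ 2 := Polynomial.natDegree_quadratic_le
  have hr0 : r.natDegree = 0 := by
    by_cases hr0 : r = 0
    · rw [hr0, Polynomial.natDegree_zero]
    · have hp : quadPoly f ≠ 0 := by
        intro hp
        simp [hp] at hdeg
      rw [hr, Polynomial.natDegree_mul hp hr0, hdeg] at hdeg'
      omega
  refine ⟨r.coeff 0, fun i => ?_⟩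
  rw [Polynomial.eq_C_of_natDegree_eq_zero hr0] at hr
  rw [← coeff_quadPoly f', hr, Polynomial.coeff_mul_C, coeff_quadPoly, mul_comm]

theorem four_lt_card {K L : Type*} [Field K] [Field L] [Algebra K L]
    (hL : finrank K L = 3) (hq : 4 ≤ Nat.card K) :
    4 < Nat.card L := by
  have : FiniteDimensional K L := FiniteDimensional.of_finrank_pos (by omega)
  rw [Module.natCard_eq_pow_finrank (K := K), hL]
  calc 4 < 4 ^ 3 := by norm_num
    _ ≤ _ := Nat.pow_le_pow_left hq 3

variable {K L : Type*} [Field K] [Finite K] [Field L] [Algebra K L]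

theorem phi_quad (f : Fin 3 → L) (x : Fin 2 → L) :
    phi K L (quad f x) = quad (fr K f) (fr K x) := by
  simp [quad]

/-- Let `f` be a quadratic form over `L` without zeros over `K`, such that `f 0 / f 2` is not in
`K`. If the values of `1 / f` at the points over `K` lie in a plane of the `K`-space `L`, then two
conjugate points are zeros of `f`. Here the plane is the kernel of `a ↦ Tr (e * a)`. Clearing
denominators gives a relation of degree four between `f` and its conjugates, which holds
identically because of the number of points. So if `f` were irreducible, it would divide
a conjugate, and `f 0 / f 2` would be invariant under conjugation. A zero of `f` is,
by the same relation, also a zero of a conjugate of `f`. -/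
theorem exists_conjugate_zeros (hL : finrank K L = 3) (hq : 4 ≤ Nat.card K) {f : Fin 3 → L}
    {e : L} (he : e ≠ 0) (hf : ∀ k : K, f 0 ≠ algebraMap K L k * f 2)
    (hne : ∀ x : Fin 2 → K, x ≠ 0 → quad f (emb L x) ≠ 0)
    (hrel : ∀ x : Fin 2 → K, x ≠ 0 →
      e * (phi K L (quad f (emb L x)) * phi K L (phi K L (quad f (emb L x)))) +
      phi K L e * (quad f (emb L x) * phi K L (phi K L (quad f (emb L x)))) +
      phi K L (phi K L e) * (quad f (emb L x) * phi K L (quad f (emb L x))) = 0) :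
    ∃ y : Fin 2 → L, bracket y (fr K y) ≠ 0 ∧ quad f (fr K y) = 0 ∧
      quad f (fr K (fr K y)) = 0 := by
  classical
  have := finite_of_finrank_eq_three hL
  let := Fintype.ofFinite L
  let := Fintype.ofFinite (ℙ K (Fin 2 → K))
  have hfr : ∀ x : Fin 2 → K, fr K (emb L x) = emb L x := fun x => fr_algebraMap x
  let f₁ := fr K f
  let f₂ := fr K f₁
  have hid : ∀ x, e * (quad f₁ x * quad f₂ x) + phi K L e * (quad f x * quad f₂ x) +
      phi K L (phi K L e) * (quad f x * quad f₁ x) = 0 := by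
    refine forms_eq_zero_of_points (K := K) (d := 4) ?_ Finset.univ ?_ ?_
    · exact Submodule.add_mem _ (Submodule.add_mem _
        (const_mul_mem_forms _ (mul_mem_forms (quad_mem_forms _) (quad_mem_forms _)))
        (const_mul_mem_forms _ (mul_mem_forms (quad_mem_forms _) (quad_mem_forms _))))
        (const_mul_mem_forms _ (mul_mem_forms (quad_mem_forms _) (quad_mem_forms _)))
    · rw [Finset.card_univ, ← Nat.card_eq_fintype_card, card_projectivization_two]
      omega
    · intro p _
      have h := hrel p.rep p.rep_nonzero
      rw [phi_quad, phi_quad, hfr, hfr] at h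
      exact h
  have hf2 : f 2 ≠ 0 := by
    have h := hne ![0, 1] (by simp)
    simpa [quad] using h
  have hroot : ∃ t, quad f ![1, t] = 0 := by
    by_contra! hroot
    have hdeg : (quadPoly f).natDegree = 2 := Polynomial.natDegree_quadratic hf2
    have hirr : Irreducible (quadPoly f) := by
      refine Polynomial.irreducible_of_degree_le_three_of_not_isRoot (by simp [hdeg])
        fun t ht => hroot t ?_
      rw [← eval_quadPoly]
      exact ht
    have hP : Polynomial.C e * (quadPoly f₁ * quadPoly f₂) +
        Polynomial.C (phi K L e) * (quadPoly f * quadPoly f₂) +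
        Polynomial.C (phi K L (phi K L e)) * (quadPoly f * quadPoly f₁) = 0 := by
      refine Polynomial.eq_zero_of_natDegree_lt_card_of_eval_eq_zero' _ Finset.univ
        (fun t _ => ?_) ?_
      · simp only [Polynomial.eval_add, Polynomial.eval_mul, Polynomial.eval_C, eval_quadPoly]
        exact hid _
      · rw [Finset.card_univ, ← Nat.card_eq_fintype_card]
        refine lt_of_le_of_lt ?_ (four_lt_card hL hq)
        simp only [quadPoly]
        compute_degree
    have hdvd : quadPoly f ∣ quadPoly f₁ * quadPoly f₂ := by
      have hu : IsUnit (Polynomial.C e) := Polynomial.isUnit_C.2 he.isUnit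
      rw [← hu.dvd_mul_left]
      refine ⟨-(Polynomial.C (phi K L e) * quadPoly f₂ +
        Polynomial.C (phi K L (phi K L e)) * quadPoly f₁), ?_⟩
      linear_combination hP
    rcases hirr.prime.dvd_or_dvd hdvd with h | h
    · obtain ⟨k, hk⟩ := eq_mul_of_quadPoly_dvd hf2 h
      have h0 : phi K L (f 0) = k * f 0 := hk 0
      have h2 : phi K L (f 2) = k * f 2 := hk 2
      have hk0 : k ≠ 0 := by
        rintro rfl
        simp [hf2] at h2
      obtain ⟨r, hr⟩ := (phi_eq_self_iff hL (x := f 0 / f 2)).1 (by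
        rw [map_div₀, h0, h2]
        field_simp)
      exact hf r (by rw [hr]; field_simp)
    · obtain ⟨k, hk⟩ := eq_mul_of_quadPoly_dvd hf2 h
      have h0 : phi K L (phi K L (f 0)) = k * f 0 := hk 0
      have h2 : phi K L (phi K L (f 2)) = k * f 2 := hk 2
      have hk0 : k ≠ 0 := by
        rintro rfl
        simp [hf2] at h2
      obtain ⟨r, hr⟩ := (phi_phi_eq_self_iff hL (x := f 0 / f 2)).1 (by
        rw [map_div₀, map_div₀, h0, h2]
        field_simp)
      exact hf r (by rw [hr]; field_simp)
  obtain ⟨t, ht⟩ := hroot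
  obtain ⟨z, hz⟩ : ∃ z : Fin 2 → L, z = ![1, t] := ⟨_, rfl⟩
  rw [← hz] at ht
  have hbr : bracket z (fr K z) ≠ 0 := by
    intro h
    have h1 : phi K L t = t := by
      simp only [hz, bracket, fr_apply, Matrix.cons_val_zero, Matrix.cons_val_one, map_one,
        one_mul, mul_one] at h
      linear_combination h
    obtain ⟨r, hr⟩ := (phi_eq_self_iff hL).1 h1
    apply hne ![1, r] (by simp)
    rw [← ht]
    congr 1
    ext i
    fin_cases i <;> simp [hz, hr]
  have hbr1 : bracket (fr K z) (fr K (fr K z)) ≠ 0 := by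
    rw [bracket_fr]
    simpa using hbr
  have hbr2 : bracket (fr K (fr K z)) z ≠ 0 := by
    rw [← fr_fr_fr (K := K) hL z, fr_fr_fr hL, bracket_fr]
    simpa using hbr1
  have h := hid z
  rw [ht, zero_mul, zero_mul, mul_zero, mul_zero, add_zero, add_zero] at h
  rcases mul_eq_zero.1 ((mul_eq_zero.1 h).resolve_left he) with h | h
  · refine ⟨fr K z, hbr1, ?_, by rwa [fr_fr_fr hL]⟩
    apply phi_injective (K := K)
    rw [phi_quad, fr_fr_fr hL, map_zero]
    exact h
  · refine ⟨fr K (fr K z), by rwa [fr_fr_fr hL], by rwa [fr_fr_fr hL], ?_⟩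
    rw [fr_fr_fr hL]
    apply phi_injective (K := K)
    apply phi_injective (K := K)
    rw [phi_quad, phi_quad, fr_fr_fr hL, map_zero, map_zero]
    exact h

end Quadratic

/-! ### Ruled surfaces that correspond to subplanes, for `q ≥ 4` -/

section Special

variable {K L : Type*} [Field K] [Field L] [Algebra K L]
  {c : V7 L →ₗ[L] (Fin 3 → L)} {Λ : (Fin 3 → L) →ₗ[L] L}
  {H : Submodule K (V7 K)} {S B : Set (Submodule K (V7 K))} {g : Submodule L (V7 L)}

theorem RuledSurface.linearIndependent_join (R : RuledSurface K) {x : Fin 2 → K} (hx : x ≠ 0) :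
    LinearIndependent K ![curve R.conic x, curve R.nrc (R.proj.val.mulVec x)] := by
  rw [linearIndependent_iff_card_eq_finrank_span, Fintype.card_fin, Set.finrank,
    Matrix.range_cons_cons_empty]
  exact (R.join_line x hx).symm

theorem RuledSurface.conic_mem_join (R : RuledSurface K) (x : Fin 2 → K) :
    curve R.conic x ∈ join R.conic R.nrc R.proj.val x :=
  Submodule.subset_span (by simp)

theorem RuledSurface.nrc_mem_join (R : RuledSurface K) (x : Fin 2 → K) :
    curve R.nrc (R.proj.val.mulVec x) ∈ join R.conic R.nrc R.proj.val x :=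
  Submodule.subset_span (by simp)

/-- A normal rational curve in a 3-space with more than three points in a subspace lies in this
subspace. -/
theorem RuledSurface.nrc_mem (hq : 4 ≤ Nat.card K) (R : RuledSurface K)
    {U : Submodule K (V7 K)} (s : Finset (ℙ K (Fin 2 → K))) (hs : 3 < s.card)
    (h : ∀ p ∈ s, curve R.nrc (R.proj.val.mulVec p.rep) ∈ U) (i : Fin 4) : R.nrc i ∈ U := by
  by_contra hi
  obtain ⟨ψ, hψ, hU⟩ := Submodule.exists_le_ker_of_notMem hi
  have h0 : ∀ x, ψ (curve R.nrc (R.proj.val.mulVec x)) = 0 :=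
    forms_eq_zero_of_points (K := K) (curve_mem_forms ψ R.nrc R.proj.val) s hs
      fun p hp => hU (h p hp)
  refine hψ (coeff_eq_zero_of_curve ψ R.nrc hq (fun x => ?_) i)
  have hx : R.proj.val.mulVec (R.proj⁻¹.val.mulVec x) = x := by
    rw [Matrix.mulVec_mulVec, Units.mul_inv, Matrix.one_mulVec]
  rw [← hx]
  exact h0 _

/-- A conic with more than two points in a subspace lies in this subspace. -/
theorem RuledSurface.conic_mem (hq : 4 ≤ Nat.card K) (R : RuledSurface K)
    {U : Submodule K (V7 K)} (s : Finset (ℙ K (Fin 2 → K))) (hs : 2 < s.card)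
    (h : ∀ p ∈ s, curve R.conic p.rep ∈ U) (i : Fin 3) : R.conic i ∈ U := by
  by_contra hi
  obtain ⟨ψ, hψ, hU⟩ := Submodule.exists_le_ker_of_notMem hi
  have h1 := curve_mem_forms ψ R.conic 1
  simp only [Matrix.one_mulVec] at h1
  exact hψ (coeff_eq_zero_of_curve ψ R.conic (by omega)
    (forms_eq_zero_of_points (K := K) h1 s hs fun p hp => hU (h p hp)) i)

variable [Finite K]

theorem IsCoord.exists_map_emb_ne_zero (hc : IsCoord H g c Λ) :
    ∃ z : Fin 3 → K, Λ (emb L z) ≠ 0 := by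
  by_contra! h
  refine hc.ne_zero ((Pi.basisFun L (Fin 3)).ext fun i => ?_)
  rw [Pi.basisFun_apply, LinearMap.zero_apply, ← h (Pi.single i 1)]
  congr 1
  ext j
  by_cases hj : j = i
  · subst hj
    simp
  · simp [hj]

/-- The subplane cannot have two points at infinity: otherwise it has at most `q + 1` points at
infinity, so at least four generators contain affine points. These points lie in a plane of
`PG(6, K)`, since the line at infinity of the subplane is that of `PG(2, L)`; but then this plane
contains at least four points of the normal rational curve. -/
theorem eq_of_le_of_four_le (hL : finrank K L = 3) (hH : finrank K H = 6)
    (hq : 4 ≤ Nat.card K) (hc : IsCoord H g c Λ) (hS : IsRegularSpread H S g)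
    {R : RuledSurface K} (hR : CorrespondsTo H S R.points (stdSubplane K c))
    {V W : Submodule K (V7 K)} (hV : V ∈ stdSubplane K c) (hVH : V ≤ H)
    (hW : W ∈ stdSubplane K c) (hWH : W ≤ H) : V = W := by
  classical
  by_contra hVW
  obtain ⟨z₀, hz₀⟩ := hc.exists_map_emb_ne_zero
  let N : (Fin 3 → K) →ₗ[K] L :=
    Λ.restrictScalars K ∘ₗ (Algebra.linearMap K L).compLeft (Fin 3)
  have hker : finrank K (LinearMap.ker N) = 2 := by
    have h1 : LinearMap.ker N < ⊤ := by
      refine lt_top_iff_ne_top.2 fun h => hz₀ ?_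
      have : z₀ ∈ LinearMap.ker N := h ▸ Submodule.mem_top
      exact this
    have h2 := Submodule.finrank_lt h1.ne
    rw [finrank_fin_fun] at h2
    have h3 : 2 ≤ finrank K (LinearMap.ker N) :=
      two_le_finrank_of_ne (a := Λ) hc hV hW hVW (by rwa [hc.lnOf_eq]) (by rwa [hc.lnOf_eq])
    omega
  -- the values of `Λ` at the points of the subplane are proportional over `K`
  have hval : ∀ z : Fin 3 → K, ∃ k : K, Λ (emb L z) = algebraMap K L k * Λ (emb L z₀) := by
    have h1 := N.finrank_range_add_finrank_ker
    rw [hker, finrank_fin_fun] at h1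
    have h2 : finrank K (LinearMap.range N) = 1 := by omega
    intro z
    obtain ⟨k, hk⟩ := (finrank_eq_one_iff_of_nonzero' (⟨N z₀, z₀, rfl⟩ : LinearMap.range N)
      (fun h => hz₀ (congrArg Subtype.val h))).1 h2 ⟨N z, z, rfl⟩
    refine ⟨k, ?_⟩
    rw [← Algebra.smul_def]
    exact (congrArg Subtype.val hk).symm
  have hinf : {W | W ∈ stdSubplane K c ∧ W ≤ H}.ncard ≤ Nat.card K + 1 := by
    let f : ℙ K (LinearMap.ker N) → Submodule K (V7 K) :=
      fun p => ptOf K c (emb L (p.rep : Fin 3 → K))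
    have hsub : {W | W ∈ stdSubplane K c ∧ W ≤ H} ⊆ f '' Set.univ := by
      rintro _ ⟨⟨z, hz, rfl⟩, hzH⟩
      rw [hc.ptOf_le] at hzH
      have hz' : (⟨z, hzH⟩ : LinearMap.ker N) ≠ 0 := fun h => hz (congrArg Subtype.val h)
      obtain ⟨a, ha⟩ := Projectivization.exists_smul_eq_mk_rep K _ hz'
      refine ⟨Projectivization.mk K _ hz', trivial, ?_⟩
      have h1 : ((Projectivization.mk K _ hz').rep : Fin 3 → K) = (a : K) • z :=
        (congrArg Subtype.val ha).symm
      change ptOf K c (emb L ((Projectivization.mk K _ hz').rep : Fin 3 → K)) = _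
      rw [h1, emb_smul, ptOf_smul (by simp)]
    calc _ ≤ (f '' Set.univ).ncard := Set.ncard_le_ncard hsub (Set.toFinite _)
      _ ≤ _ := Set.ncard_image_le (Set.toFinite _)
      _ = _ := by rw [Set.ncard_univ, Projectivization.card_of_finrank_two K _ hker]
  obtain ⟨s, hs⟩ : ∃ s : Finset (ℙ K (Fin 2 → K)),
      (s : Set (ℙ K (Fin 2 → K))) = {p | ¬ join R.conic R.nrc R.proj.val p.rep ≤ H} :=
    ⟨(Set.toFinite _).toFinset, Set.Finite.coe_toFinset _⟩
  have hcard : 3 < s.card := by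
    have h1 := ncard_affine_le hH hS hR
    rw [← hs, Set.ncard_coe_finset] at h1
    have h2 : {W | W ∈ stdSubplane K c ∧ W ≤ H}.ncard +
        {W | W ∈ stdSubplane K c ∧ ¬ W ≤ H}.ncard = (stdSubplane K c).ncard :=
      Set.ncard_inter_add_ncard_sdiff_eq_ncard (stdSubplane K c) {W | W ≤ H} (Set.toFinite _)
    rw [ncard_stdSubplane hc] at h2
    have h3 : Nat.card K * Nat.card K ≤ s.card * Nat.card K := by nlinarith
    have h4 := Nat.le_of_mul_le_mul_right h3 Nat.card_pos
    omega
  -- the plane that contains the affine points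
  let E : (Fin 3 → K) →ₗ[K] (Fin 3 → L) :=
    { toFun := fun z => (Λ (emb L z₀))⁻¹ • emb L z
      map_add' := fun z z' => by rw [emb_add, smul_add]
      map_smul' := fun k z => by
        rw [emb_smul, smul_comm, RingHom.id_apply, algebraMap_smul] }
  let ρ : V7 K →ₗ[K] (Fin 3 → L) := c.restrictScalars K ∘ₗ incl K L
  have hρ : Function.Injective ρ := fun v v' h => hc.injective h
  let U : Submodule K (V7 K) := (LinearMap.range E).comap ρ
  have hU : finrank K U ≤ 3 := by
    have : FiniteDimensional K (LinearMap.range E) := inferInstance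
    have h1 : U.map ρ ≤ LinearMap.range E := Submodule.map_comap_le _ _
    have h2 := Submodule.finrank_mono h1
    have h3 := LinearMap.finrank_range_le E
    rw [finrank_fin_fun] at h3
    rw [← (Submodule.equivMapOfInjective ρ hρ U).finrank_eq] at h2
    omega
  have hUJ : ∀ p ∈ s, join R.conic R.nrc R.proj.val p.rep ≤ U := by
    intro p hp
    have hpH : ¬ join R.conic R.nrc R.proj.val p.rep ≤ H := by
      have : p ∈ (s : Set (ℙ K (Fin 2 → K))) := hp
      rwa [hs] at this
    obtain ⟨a, v, haH, hvH, -, hav⟩ := exists_span_pair_eq hH (R.join_line _ p.rep_nonzero) hpH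
    have key : ∀ u ∈ join R.conic R.nrc R.proj.val p.rep, u ∉ H → u ∈ U := by
      intro u hu huH
      obtain ⟨z, hz, hzu⟩ := hR.span_mem p.rep_nonzero hu huH
      obtain ⟨l, hl⟩ := mem_ptOf.1 (hzu.le (Submodule.mem_span_singleton_self u))
      obtain ⟨k, hk⟩ := hval z
      obtain ⟨m, hm⟩ := hc.mem_range hL u
      rw [hc.mem_hyperplane] at huH
      rw [← hm, map_eq_zero] at huH
      rw [hl, map_smul, smul_eq_mul, hk] at hm
      have hk0 : algebraMap K L k ≠ 0 := by
        intro h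
        rw [h, zero_mul, mul_zero, map_eq_zero] at hm
        exact huH hm
      refine ⟨(m / k) • z, ?_⟩
      change (Λ (emb L z₀))⁻¹ • emb L ((m / k) • z) = c (incl K L u)
      rw [hl, emb_smul, smul_smul, map_div₀, hm]
      congr 1
      field_simp
    have haJ : a ∈ join R.conic R.nrc R.proj.val p.rep := hav ▸ Submodule.subset_span (by simp)
    have hvJ : v ∈ join R.conic R.nrc R.proj.val p.rep := hav ▸ Submodule.subset_span (by simp)
    have haU := key a haJ haH
    have havU := key (a + v) (add_mem haJ hvJ) fun h => haH (by simpa using H.sub_mem h hvH)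
    rw [hav, Submodule.span_le]
    rintro _ (rfl | rfl)
    · exact haU
    · simpa using U.sub_mem havU haU
  have hn := R.nrc_mem hq s hcard fun p hp => hUJ p hp (R.nrc_mem_join _)
  have h1 : Submodule.span K (Set.range R.nrc) ≤ U := by
    rw [Submodule.span_le]
    rintro _ ⟨i, rfl⟩
    exact hn i
  have h2 := Submodule.finrank_mono h1
  rw [finrank_span_eq_card R.nrc_indep, Fintype.card_fin] at h2
  omega

theorem isTangent_of_four_le (hL : finrank K L = 3) (hH : finrank K H = 6)
    (hq : 4 ≤ Nat.card K) (hS : IsRegularSpread H S g)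
    {R : RuledSurface K} (hB : IsSubplane H S (Nat.card K) B)
    (hR : CorrespondsTo H S R.points B) : IsTangent H B := by
  obtain ⟨c₀, Λ₀, hc₀⟩ := exists_isCoord' hL hH hS
  obtain ⟨c, Λ, hc, rfl⟩ := exists_isCoord_eq_stdSubplane hL hc₀ hS hB
  obtain ⟨W, hW, hWH⟩ : ∃ W ∈ stdSubplane K c, W ≤ H := by
    by_contra! h
    have h1 := ncard_affine_le hH hS hR
    have h2 : {W | W ∈ stdSubplane K c ∧ ¬ W ≤ H} = stdSubplane K c :=
      Set.Subset.antisymm (fun W hW => hW.1) fun W hW => ⟨hW, h W hW⟩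
    have h3 := Set.ncard_le_ncard (Set.subset_univ
      {p : ℙ K (Fin 2 → K) | ¬ join R.conic R.nrc R.proj.val p.rep ≤ H}) (Set.toFinite _)
    rw [Set.ncard_univ, card_projectivization_two] at h3
    rw [h2, ncard_stdSubplane hc] at h1
    have h4 := Nat.mul_le_mul_right (Nat.card K) h3
    nlinarith
  exact ⟨W, ⟨hW, hWH⟩, fun V hV => eq_of_le_of_four_le hL hH hq hc hS hR hV.1 hV.2 hW hWH⟩

end Special

section Special

variable {K L : Type*} [Field K] [Field L] [Algebra K L]
  {c : V7 L →ₗ[L] (Fin 3 → L)} {Λ : (Fin 3 → L) →ₗ[L] L}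
  {H : Submodule K (V7 K)} {S B : Set (Submodule K (V7 K))} {g : Submodule L (V7 L)}

theorem RuledSurface.linearIndependent_conic (R : RuledSurface K) {p p' : ℙ K (Fin 2 → K)}
    (h : p ≠ p') : LinearIndependent K ![curve R.conic p.rep, curve R.conic p'.rep] := by
  obtain ⟨x, hx⟩ : ∃ x, x = p.rep := ⟨_, rfl⟩
  obtain ⟨x', hx'⟩ : ∃ x', x' = p'.rep := ⟨_, rfl⟩
  have hb : bracket x x' ≠ 0 := by
    intro hb
    rw [hx, hx', bracket_eq_zero_iff p'.rep_nonzero] at hb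
    obtain ⟨a, ha⟩ := hb
    apply h
    rw [← p.mk_rep, ← p'.mk_rep]
    exact (Projectivization.mk_eq_mk_iff' K _ _ _ _).2 ⟨a, ha.symm⟩
  rw [← hx, ← hx', LinearIndependent.pair_iff]
  intro s t hst
  rw [curve_two, curve_two] at hst
  have h1 := Fintype.linearIndependent_iff.1 R.conic_indep
    ![s * x 0 ^ 2 + t * x' 0 ^ 2, s * (x 0 * x 1) + t * (x' 0 * x' 1),
      s * x 1 ^ 2 + t * x' 1 ^ 2] (by
        rw [← hst, Fin.sum_univ_three]
        simp only [Matrix.cons_val_zero, Matrix.cons_val_one, Matrix.cons_val]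
        module)
  have h10 : s * x 0 ^ 2 + t * x' 0 ^ 2 = 0 := h1 0
  have h11 : s * (x 0 * x 1) + t * (x' 0 * x' 1) = 0 := h1 1
  have h12 : s * x 1 ^ 2 + t * x' 1 ^ 2 = 0 := h1 2
  have hs : s * bracket x x' ^ 2 = 0 := by
    rw [bracket]
    linear_combination x' 1 ^ 2 * h10 - 2 * x' 0 * x' 1 * h11 + x' 0 ^ 2 * h12
  have ht : t * bracket x x' ^ 2 = 0 := by
    rw [bracket]
    linear_combination x 1 ^ 2 * h10 - 2 * x 0 * x 1 * h11 + x 0 ^ 2 * h12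
  exact ⟨(mul_eq_zero.1 hs).resolve_right (pow_ne_zero 2 hb),
    (mul_eq_zero.1 ht).resolve_right (pow_ne_zero 2 hb)⟩

variable [Finite K]

theorem IsGen.exists_map_eq (hc : IsCoord H g c Λ) (hinf : Λ ![0, 0, 1] = 0)
    {y : Fin 2 → K} (hy : Λ ![algebraMap K L (y 0), algebraMap K L (y 1), 0] ≠ 0)
    {J : Submodule K (V7 K)} (h : IsGen c Λ y J) {v : V7 K} (hv : v ∈ J) (hvH : v ∈ H) :
    ∃ s : K, c (incl K L v) =
      ((Λ ![algebraMap K L (y 0), algebraMap K L (y 1), 0])⁻¹ * algebraMap K L s) •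
        ![0, 0, 1] := by
  obtain ⟨s, t, hst⟩ := (h v).1 hv
  have he : emb L ![t * y 0, t * y 1, s] =
      ![algebraMap K L t * algebraMap K L (y 0), algebraMap K L t * algebraMap K L (y 1),
        algebraMap K L s] := by
    ext i
    fin_cases i <;> simp
  have he' : (![algebraMap K L t * algebraMap K L (y 0), algebraMap K L t * algebraMap K L (y 1),
      0] : Fin 3 → L) = algebraMap K L t • ![algebraMap K L (y 0), algebraMap K L (y 1), 0] := by
    ext i
    fin_cases i <;> simp
  have ht : t = 0 := by
    rw [hc.mem_hyperplane, hst, he, map_smul, map_vec_eq hinf (algebraMap K L t * _), he',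
      map_smul] at hvH
    simpa [hy] using hvH
  refine ⟨s, ?_⟩
  rw [hst, ht]
  ext i
  fin_cases i <;> simp

theorem mem_ptOf_of_mem_join (hL : finrank K L = 3) (hH : finrank K H = 6)
    (hc : IsCoord H g c Λ) (hS : IsRegularSpread H S g) (hinf : Λ ![0, 0, 1] = 0)
    (haff : ∀ x : Fin 2 → K, x ≠ 0 → Λ ![algebraMap K L (x 0), algebraMap K L (x 1), 0] ≠ 0)
    {R : RuledSurface K} (hT : IsTangent H (stdSubplane K c))
    (hR : CorrespondsTo H S R.points (stdSubplane K c)) {x : Fin 2 → K} (hx : x ≠ 0)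
    {v : V7 K} (hv : v ∈ join R.conic R.nrc R.proj.val x) (hvH : v ∈ H) :
    v ∈ ptOf K c ![0, 0, 1] := by
  obtain ⟨y, hy, hg⟩ := exists_isGen hL hH hc hS hinf haff hT hR hx
  obtain ⟨s, hs⟩ := hg.exists_map_eq hc hinf (haff y hy) hv hvH
  exact mem_ptOf.2 ⟨_, hs⟩

/-- Four points of the normal rational curve directrix of a standard surface, and the spread element
of its conic, span `PG(6, K)`. -/
theorem IsStdSurface.seven_le_finrank (hq : 4 ≤ Nat.card K) (hc : IsCoord H g c Λ)
    {R : RuledSurface K} (hR : IsStdSurface c Λ R)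
    (hW : finrank K (ptOf K c ![0, 0, 1]) = 3) {U : Submodule K (V7 K)}
    (hWU : ptOf K c ![0, 0, 1] ≤ U) (s : Finset (ℙ K (Fin 2 → K))) (hs : 3 < s.card)
    (h : ∀ p ∈ s, curve R.nrc (R.proj.val.mulVec p.rep) ∈ U) : 7 ≤ finrank K U := by
  let := Fintype.ofFinite (ℙ K (Fin 2 → K))
  have hTU : Submodule.span K (Set.range R.nrc) ≤ U := by
    rw [Submodule.span_le]
    rintro _ ⟨i, rfl⟩
    exact R.nrc_mem hq s hs h i
  have hT2 : Submodule.span K (Set.range R.nrc) ≤ lnOf K c (LinearMap.proj 2) := by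
    rw [Submodule.span_le]
    rintro _ ⟨i, rfl⟩
    refine R.nrc_mem hq Finset.univ ?_ (fun p _ => ?_) i
    · rw [Finset.card_univ, ← Nat.card_eq_fintype_card, card_projectivization_two]
      omega
    · obtain ⟨a, -, -, ha⟩ := hR.gen p.rep p.rep_nonzero
      rw [mem_lnOf, ha]
      simp
  have hinf : Submodule.span K (Set.range R.nrc) ⊓ ptOf K c ![0, 0, 1] = ⊥ := by
    rw [Submodule.eq_bot_iff]
    rintro v ⟨hvT, hvW⟩
    obtain ⟨a, ha⟩ := mem_ptOf.1 hvW
    have h2 := mem_lnOf.1 (hT2 hvT)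
    have ha0 : a = 0 := by simpa [ha] using h2
    exact hc.eq_zero (by rw [ha, ha0, zero_smul])
  have h1 := Submodule.finrank_sup_add_finrank_inf_eq (Submodule.span K (Set.range R.nrc))
    (ptOf K c ![0, 0, 1])
  rw [hinf, finrank_bot, hW, finrank_span_eq_card R.nrc_indep, Fintype.card_fin] at h1
  have h2 := Submodule.finrank_mono (sup_le hTU hWU)
  omega

/-- The conic lies in the spread element of the tangent subplane. Otherwise at most two of its
points are at infinity. For the other parameters, the corresponding point of the normal rational
curve of the special surface lies in the span of the conic and of the spread element; with one more
point of that curve, if there are two points of the conic at infinity, this leads to at least four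
points of the curve in a proper subspace that contains the spread element. -/
theorem conic_mem_ptOf (hL : finrank K L = 3) (hH : finrank K H = 6) (hq : 4 ≤ Nat.card K)
    (hc : IsCoord H g c Λ) (hS : IsRegularSpread H S g) (hinf : Λ ![0, 0, 1] = 0)
    (haff : ∀ x : Fin 2 → K, x ≠ 0 → Λ ![algebraMap K L (x 0), algebraMap K L (x 1), 0] ≠ 0)
    {R : RuledSurface K} (hT : IsTangent H (stdSubplane K c))
    (hR : CorrespondsTo H S R.points (stdSubplane K c)) (i : Fin 3) :
    R.conic i ∈ ptOf K c ![0, 0, 1] := by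
  classical
  let := Fintype.ofFinite (ℙ K (Fin 2 → K))
  obtain ⟨R', hR', -⟩ := exists_isStdSurface_isSpecial hL hc hS hinf haff
  obtain ⟨W, hW⟩ : ∃ W, W = ptOf K c ![0, 0, 1] := ⟨_, rfl⟩
  have hWS : W ∈ S := (hc.mem_spread hL hS W).2 ⟨_, by simp, hinf, hW⟩
  obtain ⟨hWH, hW3⟩ := hS.plane W hWS
  have hJW : ∀ x : Fin 2 → K, x ≠ 0 → ∀ v ∈ join R.conic R.nrc R.proj.val x, v ∈ H → v ∈ W :=
    fun x hx v hv hvH => hW ▸ mem_ptOf_of_mem_join hL hH hc hS hinf haff hT hR hx hv hvH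
  have hcard : Fintype.card (ℙ K (Fin 2 → K)) = Nat.card K + 1 := by
    rw [← Nat.card_eq_fintype_card, card_projectivization_two]
  let D : Finset (ℙ K (Fin 2 → K)) := Finset.univ.filter fun p => curve R.conic p.rep ∈ H
  have hDW : ∀ p ∈ D, curve R.conic p.rep ∈ W := fun p hp =>
    hJW _ p.rep_nonzero _ (R.conic_mem_join _) (Finset.mem_filter.1 hp).2
  rw [← hW]
  by_contra hi
  have hD2 : D.card ≤ 2 := by
    by_contra! hD
    exact hi (R.conic_mem hq D hD hDW i)
  -- the generator of the given surface with a given parameter on the special surface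
  have hη : ∀ p : ℙ K (Fin 2 → K), ∃ p' : ℙ K (Fin 2 → K),
      join R'.conic R'.nrc R'.proj.val p.rep = join R.conic R.nrc R.proj.val p'.rep := by
    intro p
    obtain ⟨x, hx, hg⟩ := exists_isGen_join hL hH hc hS hinf haff hT hR p.rep_nonzero
    obtain ⟨k, hk, hxk⟩ := exists_smul_rep hx
    refine ⟨Projectivization.mk K x hx, ?_⟩
    rw [← join_smul R.conic R.nrc R.proj.val hk, ← hxk]
    exact (hR'.isGen hL hc p.rep_nonzero).eq hg
  choose η hη using hη
  have hηinj : Function.Injective η := by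
    intro p p' hp
    have h1 : join R'.conic R'.nrc R'.proj.val p.rep =
        join R'.conic R'.nrc R'.proj.val p'.rep := by rw [hη, hη, hp]
    obtain ⟨a, ha, -, hN⟩ := hR'.gen p'.rep p'.rep_nonzero
    have hv : ![algebraMap K L (p'.rep 0), algebraMap K L (p'.rep 1), 0] =
        emb L ![p'.rep 0, p'.rep 1, 0] := by
      ext i
      fin_cases i <;> simp
    rw [hv] at hN
    obtain ⟨k, -, hk⟩ := (hR'.isGen hL hc p.rep_nonzero).exists_smul_eq p.rep_nonzero
      p'.rep_nonzero (h1 ▸ R'.nrc_mem_join p'.rep) ha hN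
    rw [← p.mk_rep, ← p'.mk_rep, eq_comm]
    exact (Projectivization.mk_eq_mk_iff' K _ _ _ _).2 ⟨k, hk.symm⟩
  obtain ⟨γ, hγ⟩ : ∃ γ, γ = Submodule.span K (Set.range R.conic) := ⟨_, rfl⟩
  have hγ3 : finrank K γ = 3 := by
    rw [hγ, finrank_span_eq_card R.conic_indep, Fintype.card_fin]
  have hγmem : ∀ x, curve R.conic x ∈ γ := fun x =>
    curve_mem (fun j => hγ ▸ Submodule.subset_span ⟨j, rfl⟩) x
  have hn : ∀ p, η p ∉ D → curve R'.nrc (R'.proj.val.mulVec p.rep) ∈ γ ⊔ W := by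
    intro p hp
    have hpH : curve R.conic (η p).rep ∉ H := fun h =>
      hp (Finset.mem_filter.2 ⟨Finset.mem_univ _, h⟩)
    obtain ⟨t, ht⟩ := exists_smul_sub_mem (U := H) (T := ⊤) le_top
      (by rw [finrank_top, finrank_fin_fun, hH]) Submodule.mem_top hpH
      (Submodule.mem_top (x := curve R'.nrc (R'.proj.val.mulVec p.rep)))
    have hJ := hη p ▸ R'.nrc_mem_join p.rep
    have h1 := hJW _ (η p).rep_nonzero _
      (Submodule.sub_mem _ hJ (Submodule.smul_mem _ t (R.conic_mem_join _))) ht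
    rw [← sub_add_cancel (curve R'.nrc (R'.proj.val.mulVec p.rep)) (t • curve R.conic (η p).rep)]
    exact add_mem (Submodule.mem_sup_right h1)
      (Submodule.mem_sup_left (Submodule.smul_mem _ t (hγmem _)))
  have hsup := Submodule.finrank_sup_add_finrank_inf_eq γ W
  rw [hγ3, hW3] at hsup
  obtain ⟨U, D', hU, hU6, hD', hUD'⟩ : ∃ (U : Submodule K (V7 K))
      (D' : Finset (ℙ K (Fin 2 → K))), γ ⊔ W ≤ U ∧ finrank K U ≤ 6 ∧ D'.card ≤ 1 ∧
      ∀ p, η p ∉ D' → curve R'.nrc (R'.proj.val.mulVec p.rep) ∈ U := by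
    by_cases hD1 : D.card ≤ 1
    · exact ⟨γ ⊔ W, D, le_rfl, by omega, hD1, hn⟩
    · obtain ⟨d, e, hde, hD⟩ := Finset.card_eq_two.1 (show D.card = 2 by omega)
      obtain ⟨p, hp⟩ := (Finite.injective_iff_surjective.1 hηinj) d
      have h2 : 2 ≤ finrank K (γ ⊓ W : Submodule K (V7 K)) := by
        have h3 : Submodule.span K
            (Set.range ![curve R.conic d.rep, curve R.conic e.rep]) ≤ γ ⊓ W := by
          rw [Submodule.span_le]
          rintro _ ⟨j, rfl⟩
          fin_cases j
          · exact ⟨hγmem _, hDW d (by rw [hD]; simp)⟩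
          · exact ⟨hγmem _, hDW e (by rw [hD]; simp)⟩
        have h4 := Submodule.finrank_mono h3
        rwa [finrank_span_eq_card (R.linearIndependent_conic hde), Fintype.card_fin] at h4
      refine ⟨γ ⊔ W ⊔ Submodule.span K {curve R'.nrc (R'.proj.val.mulVec p.rep)}, {e},
        le_sup_left, ?_, by simp, fun p' hp' => ?_⟩
      · have h5 := Submodule.finrank_add_le_finrank_add_finrank (γ ⊔ W)
          (Submodule.span K {curve R'.nrc (R'.proj.val.mulVec p.rep)})
        have h6 := finrank_span_singleton (K := K)
          ((R'.linearIndependent_join p.rep_nonzero).ne_zero 1)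
        rw [Matrix.cons_val_one, Matrix.cons_val_zero] at h6
        omega
      · by_cases hpp : p' = p
        · rw [hpp]
          exact Submodule.mem_sup_right (Submodule.mem_span_singleton_self _)
        · refine Submodule.mem_sup_left (hn p' ?_)
          rw [hD, Finset.mem_insert, not_or]
          exact ⟨fun h => hpp (hηinj (h.trans hp.symm)), hp'⟩
  have h7 := hR'.seven_le_finrank hq hc (hW ▸ hW3) (hW ▸ le_sup_right.trans hU)
    (Finset.univ.filter fun p => η p ∉ D') ?_ fun p hp => hUD' p (Finset.mem_filter.1 hp).2
  · omega
  · have h8 : (Finset.univ.filter fun p => η p ∈ D').card ≤ 1 := by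
      refine (Finset.card_le_card_of_injOn η (fun p hp => ?_) hηinj.injOn).trans hD'
      exact (Finset.mem_filter.1 hp).2
    have h9 := Finset.card_filter_add_card_filter_not (s := Finset.univ) (fun p => η p ∈ D')
    rw [Finset.card_univ, hcard] at h9
    omega

/-- If a ruled surface corresponds to a tangent subplane, then it is special. The conic has
coordinates `quad f`, and by `exists_conjugate_zeros` this form has zeros `y^q` and `y^(q^2)`. The
product of the linear form with the zero `y` and the coordinates of the normal rational curve has
values in `K` at the points over `K`; so it is invariant under conjugation, and it vanishes not only
at `y`, but also at `y^q` and `y^(q^2)`. So `y` is a parameter of a point of the normal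
rational curve on `g`. -/
theorem isSpecial_of_isTangent (hL : finrank K L = 3) (hH : finrank K H = 6)
    (hq : 4 ≤ Nat.card K) (hc : IsCoord H g c Λ) (hS : IsRegularSpread H S g)
    (hinf : Λ ![0, 0, 1] = 0)
    (haff : ∀ x : Fin 2 → K, x ≠ 0 → Λ ![algebraMap K L (x 0), algebraMap K L (x 1), 0] ≠ 0)
    {R : RuledSurface K} (hT : IsTangent H (stdSubplane K c))
    (hR : CorrespondsTo H S R.points (stdSubplane K c)) : R.IsSpecial H S g := by
  classical
  let := Fintype.ofFinite (ℙ K (Fin 2 → K))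
  have hW : ptOf K c ![0, 0, 1] ∈ S := (hc.mem_spread hL hS _).2 ⟨_, by simp, hinf, rfl⟩
  have hcW := conic_mem_ptOf hL hH hq hc hS hinf haff hT hR
  have hcH : ∀ x, curve R.conic x ∈ H :=
    fun x => (hS.plane _ hW).1 (curve_mem hcW x)
  have hfr : ∀ x : Fin 2 → K, fr K (emb L x) = emb L x := fun x => fr_algebraMap x
  obtain ⟨α, hα⟩ : ∃ α, α = Λ ![1, 0, 0] := ⟨_, rfl⟩
  obtain ⟨β, hβ⟩ : ∃ β, β = Λ ![0, 1, 0] := ⟨_, rfl⟩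
  have hΛ : ∀ x y, Λ ![x, y, 0] = α * x + β * y := by
    intro x y
    rw [hα, hβ, mul_comm, mul_comm (Λ _), ← smul_eq_mul, ← smul_eq_mul,
      ← map_smul, ← map_smul, ← map_add]
    congr 1
    ext i
    fin_cases i <;> simp
  choose f hf using fun i => mem_ptOf.1 (hcW i)
  have hC : ∀ x, c (curve (fun i => incl K L (R.conic i)) x) = quad f x • ![0, 0, 1] := by
    intro x
    simp only [curve_two, map_add, map_smul, hf]
    rw [quad]
    module
  have hCK : ∀ x : Fin 2 → K, c (incl K L (curve R.conic x)) = quad f (emb L x) • ![0, 0, 1] :=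
    fun x => by rw [incl_curve, hC]
  have hne : ∀ x : Fin 2 → K, x ≠ 0 → quad f (emb L x) ≠ 0 := by
    intro x hx h
    refine (R.linearIndependent_join hx).ne_zero 0 (hc.eq_zero ?_)
    rw [Matrix.cons_val_zero, hCK, h, zero_smul]
  -- the values of `1 / quad f` are proportional over `K` to those of `Λ`
  have hfΛ : ∀ x y : Fin 2 → K, x ≠ 0 → y ≠ 0 → IsGen c Λ y (join R.conic R.nrc R.proj.val x) →
      ∃ s : K, s ≠ 0 ∧ quad f (emb L x) =
        (Λ ![algebraMap K L (y 0), algebraMap K L (y 1), 0])⁻¹ * algebraMap K L s := by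
    intro x y hx hy hg
    obtain ⟨s, hs⟩ := hg.exists_map_eq hc hinf (haff y hy) (R.conic_mem_join x) (hcH x)
    rw [hCK] at hs
    have h2 := congrFun hs 2
    simp only [Pi.smul_apply, smul_eq_mul, Matrix.cons_val, mul_one] at h2
    refine ⟨s, ?_, h2⟩
    rintro rfl
    apply hne x hx
    rw [h2, map_zero, mul_zero]
  have hαβ : α * phi K L β - β * phi K L α ≠ 0 := mul_phi_sub_ne_zero hL fun x hx => by
    rw [← hΛ]
    exact haff x hx
  obtain ⟨y, hy, hy1, hy2⟩ : ∃ y : Fin 2 → L, bracket y (fr K y) ≠ 0 ∧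
      quad f (fr K y) = 0 ∧ quad f (fr K (fr K y)) = 0 := by
    refine exists_conjugate_zeros hL hq (e := phi K L α * phi K L (phi K L β) -
      phi K L (phi K L α) * phi K L β) ?_ ?_ hne ?_
    · intro h
      apply hαβ
      apply phi_injective (K := K)
      rw [map_sub, map_mul, map_mul, map_zero]
      linear_combination h
    · intro k hk
      have h1 : R.conic 0 = k • R.conic 2 := hc.injective (by
        rw [hf, incl_smul, map_smul, hf, hk, mul_smul])
      have h2 := Fintype.linearIndependent_iff.1 R.conic_indep ![1, 0, -k] (by
        rw [Fin.sum_univ_three, h1]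
        simp) 0
      exact one_ne_zero h2
    · intro x hx
      obtain ⟨y, hy, hg⟩ := exists_isGen hL hH hc hS hinf haff hT hR hx
      obtain ⟨s, -, hs⟩ := hfΛ x y hx hy hg
      have h0 := haff y hy
      have h1 : phi K L (Λ ![algebraMap K L (y 0), algebraMap K L (y 1), 0]) ≠ 0 := by
        simpa only [ne_eq, map_eq_zero] using h0
      have h2 : phi K L (phi K L (Λ ![algebraMap K L (y 0), algebraMap K L (y 1), 0])) ≠ 0 := by
        simpa only [ne_eq, map_eq_zero] using h0
      rw [hs]
      simp only [map_mul, map_inv₀, AlgHom.commutes]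
      field_simp
      simp only [hΛ, map_add, map_sub, map_mul, AlgHom.commutes, phi_phi_phi hL]
      ring
  have hy0 : y ≠ 0 := by
    rintro rfl
    simp [bracket] at hy
  obtain ⟨k₀, hk₀, hfk⟩ := forms_factor_two hy (quad_mem_forms f) hy1 hy2
  obtain ⟨k, rfl⟩ := forms_zero hk₀
  have hk : k ≠ 0 := by
    rintro rfl
    exact hne ![1, 0] (by simp) (by rw [hfk, mul_zero])
  -- coordinates of the normal rational curve
  let A := R.proj.val.map (algebraMap K L)
  let m : Fin 3 → (Fin 2 → L) → L := fun j x =>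
    c (curve (fun i => incl K L (R.nrc i)) (A.mulVec x)) j
  have hm : ∀ j, m j ∈ linForms L ^ 3 := fun j =>
    curve_mem_forms (LinearMap.proj j ∘ₗ c) (fun i => incl K L (R.nrc i)) A
  have hmK : ∀ x y : Fin 2 → K, x ≠ 0 → y ≠ 0 → IsGen c Λ y (join R.conic R.nrc R.proj.val x) →
      ∃ s t : K, t ≠ 0 ∧ ∀ j, m j (emb L x) =
        quad f (emb L x) * algebraMap K L (![t * y 0, t * y 1, s] j) := by
    intro x y hx hy hg
    obtain ⟨r, hr, hfr⟩ := hfΛ x y hx hy hg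
    obtain ⟨s, t, hst⟩ := (hg _).1 (R.nrc_mem_join x)
    have hr' : algebraMap K L r ≠ 0 := by simpa using hr
    have hv : c (incl K L (curve R.nrc (R.proj.val.mulVec x))) =
        quad f (emb L x) • emb L ![r⁻¹ * t * y 0, r⁻¹ * t * y 1, r⁻¹ * s] := by
      rw [hst, hfr]
      ext i
      fin_cases i <;> simp <;> field_simp
    refine ⟨r⁻¹ * s, r⁻¹ * t, ?_, fun j => ?_⟩
    · intro ht
      have h1 := LinearIndependent.pair_iff.1 (R.linearIndependent_join hx) (r⁻¹ * s) (-1)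
        (hc.eq_zero (by
          rw [map_add, incl_smul, incl_smul, map_add, map_smul, map_smul, hv, hCK, ht]
          ext i
          fin_cases i <;> simp [Algebra.smul_def]
          ring))
      exact one_ne_zero (neg_eq_zero.1 h1.2)
    · change c (curve (fun i => incl K L (R.nrc i)) (A.mulVec (emb L x))) j = _
      rw [← emb_mulVec, ← incl_curve, hv]
      rfl
  let G : Fin 3 → (Fin 2 → L) → L := fun j x => bracket x y * (k⁻¹ * m j x)
  have hG : ∀ j, G j ∈ linForms L ^ (1 + 3) := fun j =>
    mul_mem_forms (by rw [pow_one]; exact bracket_mem_linForms y)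
      (const_mul_mem_forms _ (hm j))
  have hGfr : ∀ j x, G j (fr K x) = phi K L (G j x) := by
    intro j
    have h1 : ∀ x, phi K L (G j (fr K (fr K x))) - G j x = 0 := by
      refine forms_eq_zero_of_points (K := K)
        (Submodule.sub_mem _ (conj_mem_forms hL (hG j)) (hG j)) Finset.univ ?_ fun p _ => ?_
      · rw [Finset.card_univ, ← Nat.card_eq_fintype_card, card_projectivization_two]
        omega
      · change phi K L (G j (fr K (fr K (emb L p.rep)))) - G j (emb L p.rep) = 0
        rw [hfr, hfr]
        obtain ⟨z, hz, hg⟩ := exists_isGen hL hH hc hS hinf haff hT hR p.rep_nonzero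
        obtain ⟨s, t, -, hst⟩ := hmK _ z p.rep_nonzero hz hg
        have h2 : G j (emb L p.rep) = bracket (emb L p.rep) y *
            phi K L (bracket (emb L p.rep) y) * phi K L (phi K L (bracket (emb L p.rep) y)) *
            algebraMap K L (![t * z 0, t * z 1, s] j) := by
          simp only [G]
          rw [hst, hfk, bracket_emb_fr, bracket_emb_fr, bracket_emb_fr]
          field_simp
        rw [h2]
        simp only [map_mul, phi_phi_phi hL, AlgHom.commutes]
        ring
    intro x
    rw [← sub_eq_zero.1 (h1 (fr K x)), fr_fr_fr hL]
  have hGy : ∀ j, G j y = 0 := fun j => by simp [G, bracket, mul_comm]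
  have hm1 : ∀ j, m j (fr K y) = 0 := by
    intro j
    have h1 := hGfr j y
    rw [hGy, map_zero] at h1
    simp only [G, mul_eq_zero, inv_eq_zero, hk, false_or] at h1
    refine h1.resolve_left ?_
    rw [bracket_swap]
    exact neg_ne_zero.2 hy
  have hm2 : ∀ j, m j (fr K (fr K y)) = 0 := by
    intro j
    have h1 := hGfr j (fr K y)
    rw [hGfr j y, hGy, map_zero, map_zero] at h1
    simp only [G, mul_eq_zero, inv_eq_zero, hk, false_or] at h1
    refine h1.resolve_left ?_
    rw [bracket_swap]
    exact neg_ne_zero.2 (bracket_fr_fr_ne_zero hL hy)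
  -- the first coordinate vanishes only for one parameter over `K`, so not at `y` as well
  have hm0 : m 0 y ≠ 0 := by
    intro h0
    obtain ⟨m', hm', hmm'⟩ := forms_factor_two hy (hm 0) (hm1 0) (hm2 0)
    have h1 := hmm' y
    rw [h0] at h1
    obtain ⟨m'', hm'', hmm''⟩ := forms_factor hy0 hm' ((mul_eq_zero.1 h1.symm).resolve_left
      (mul_ne_zero hy (bracket_fr_fr_ne_zero hL hy)))
    obtain ⟨r, rfl⟩ := forms_zero hm''
    obtain ⟨x, hx, hg⟩ := exists_isGen_join hL hH hc hS hinf haff hT hR (y := ![0, 1]) (by simp)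
    obtain ⟨s, t, ht, hst⟩ := hmK x _ hx (by simp) hg
    obtain ⟨x', hx', hg'⟩ := exists_isGen_join hL hH hc hS hinf haff hT hR (y := ![1, 0]) (by simp)
    obtain ⟨s', t', ht', hst'⟩ := hmK x' _ hx' (by simp) hg'
    have h2 := hst 0
    have h3 := hst' 0
    have hbr := bracket_emb_ne_zero hy hx
    rw [hmm', hmm'', bracket_emb_fr, bracket_emb_fr, bracket_emb_fr] at h2
    have hr : r = 0 := by simpa [hbr] using h2
    rw [hmm', hmm'', hr, mul_zero, mul_zero] at h3
    exact mul_ne_zero (hne x' hx') (by simpa using ht') h3.symm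
  have hyC : curve (fun i => incl K L (R.conic i)) y ∈ g := by
    rw [hc.mem_line, fr_curve, fr_curve, hC, hC, hy1, hy2, zero_smul]
    exact ⟨rfl, rfl⟩
  have hyN : curve (fun i => incl K L (R.nrc i)) (A.mulVec y) ∈ g := by
    rw [hc.mem_line, fr_curve, fr_curve, fr_mulVec, fr_mulVec]
    exact ⟨funext hm1, funext hm2⟩
  refine R.isSpecial_of_mem hL hc hS hW hcW ?_ hyC hyN ?_
  · by_contra! h
    have h1 := hT.not_join_le hH hS (isSubplane_stdSubplane hL hc hS) hR (x := ![1, 0]) (by simp)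
    apply h1
    rw [join, Submodule.span_le]
    rintro _ (rfl | rfl)
    · exact hcH _
    · exact curve_mem h _
  · rw [LinearIndependent.pair_iff]
    intro s t hst
    have h := congrArg c hst
    rw [map_add, map_smul, map_smul, hC, map_zero] at h
    have h0 := congrFun h 0
    have h2 := congrFun h 2
    simp only [Pi.add_apply, Pi.smul_apply, smul_eq_mul, Matrix.cons_val_zero, Matrix.cons_val,
      mul_zero, mul_one, zero_add, Pi.zero_apply] at h0 h2
    have ht : t = 0 := (mul_eq_zero.1 h0).resolve_right hm0
    refine ⟨?_, ht⟩
    rw [ht, zero_mul, add_zero] at h2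
    refine (mul_eq_zero.1 h2).resolve_right ?_
    rw [hfk]
    exact mul_ne_zero (mul_ne_zero hy (bracket_fr_fr_ne_zero hL hy)) hk

end Special

end BruckBose

theorem mainTheorem2 {K L : Type*} [Field K] [Finite K] [Field L] [Algebra K L]
    (hL : Module.finrank K L = 3)
    (H : Submodule K (BruckBose.V7 K)) (hH : Module.finrank K H = 6)
    (S : Set (Submodule K (BruckBose.V7 K))) (g : Submodule L (BruckBose.V7 L))
    (hS : BruckBose.IsRegularSpread H S g) (R : BruckBose.RuledSurface K) :
    (4 ≤ Nat.card K →
      ((∃ B, BruckBose.IsSubplane H S (Nat.card K) B ∧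
          BruckBose.CorrespondsTo H S R.points B) ↔
        R.IsSpecial H S g)) ∧
    ((∃ B, BruckBose.IsSubplane H S (Nat.card K) B ∧ BruckBose.IsTangent H B ∧
        BruckBose.CorrespondsTo H S R.points B) ↔
      ∃ R' : BruckBose.RuledSurface K, R'.points = R.points ∧ R'.IsSpecial H S g) := by
  refine ⟨fun hq => ⟨?_, fun hR => ?_⟩, ?_, ?_⟩
  · rintro ⟨B, hB, hR⟩
    have hT := BruckBose.isTangent_of_four_le hL hH hq hS hB hR
    obtain ⟨c, Λ, hc, rfl, hinf, haff⟩ := hT.exists_isCoord hL hH hS hB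
    exact BruckBose.isSpecial_of_isTangent hL hH hq hc hS hinf haff hT hR
  · obtain ⟨c, Λ, hc, hstd⟩ := hR.exists_isStdSurface hL hH hS
    exact ⟨_, BruckBose.isSubplane_stdSubplane hL hc hS, hstd.correspondsTo hL hc hS⟩
  · rintro ⟨B, hB, hT, hR⟩
    obtain ⟨c, Λ, hc, rfl, hinf, haff⟩ := hT.exists_isCoord hL hH hS hB
    obtain ⟨R', hstd, hR'⟩ := BruckBose.exists_isStdSurface_isSpecial hL hc hS hinf haff
    exact ⟨R', BruckBose.points_eq_of_isStdSurface hL hH hc hS hT hR hstd, hR'⟩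
  · rintro ⟨R', hpts, hR'⟩
    obtain ⟨c, Λ, hc, hstd⟩ := hR'.exists_isStdSurface hL hH hS
    exact ⟨_, BruckBose.isSubplane_stdSubplane hL hc hS, hstd.isTangent hc,
      hpts ▸ hstd.correspondsTo hL hc hS⟩
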